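/- **Setting.** Let $K$ be an algebra of holomorphic functions of the complex variables $q=(q_1,\dots,q_r)$: a commutative $\mathbb C$-algebra containing the coordinates $q_i$ and closed under $\partial/\partial q_i$, each of whose elements is a holomorphic function on a nonempty open domain of its own and is $0$ if it vanishes on a nonempty open set (for example polynomials, rational functions, or germs of holomorphic functions). Write $q_i=e^{t_i}$ and $\partial_i=\partial/\partial t_i=q_i\,\partial/\partial q_i$. Let $$\mathcal A=K[b_1,\dots,b_r]/(\mathcal R_1,\dots,\mathcal R_u).$$ Let $D^h$ be the ring of differential operators generated by $h\partial_1,\dots,h\partial_r$ with coefficients in $K[h]$, and for $P\in D^h$, written with its coefficients on the left, let $S(P)\in K[h][b_1,\dots,b_r]$ be the result of replacing each $h\partial_i$ by $b_i$. A *quantization* of $\mathcal A$ is a left module $M^h=D^h/(D^h_1,\dots,D^h_u)$ (quotient by the left ideal generated by the $D^h_i\in D^h$) such that (1) $M^h$ is free over $K[h]$ of rank $s+1$, and (2) $\lim_{h\to0}S(D^h_i)=\mathcal R_i$ for $i=1,\dots,u$. Let $M^h$ be a quantization of $\mathcal A$, and let $P_0,\dots,P_s\in D^h$ be such that $[P_0],\dots,[P_s]$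 is a $K[h]$-basis of $M^h$ and such that the classes $[c_0],\dots,[c_s]$ of $c_j=\lim_{h\to0}S(P_j)$ form a $K$-basis of $\mathcal A$. Define matrices $\Omega^h_i$ and $\omega_i$ by $$[h\partial_iP_j]=\sum_{k=0}^s(h\Omega^h_i)_{kj}[P_k]\ \text{ in } M^h,\qquad [b_ic_j]=\sum_{k=0}^s(\omega_i)_{kj}[c_k]\ \text{ in }\mathcal A,$$ and put $\Omega^h=\sum_i\Omega^h_i\,dt_i$, $\omega=\sum_i\omega_i\,dt_i$. The entries of $h\Omega^h_i$ lie in $K[h]$, and $\Omega^h=\frac1h\omega+\theta^{(0)}+h\theta^{(1)}+\dots+h^p\theta^{(p)}$ for some matrix-valued $1$-forms $\theta^{(k)}$ and some $p\ge 0$. **Proposition 3.2.** Assume that $\Omega^h$ depends holomorphically on $q$ for $q$ in an open subset $V$ of $\mathbb C^r$, i.e. the entries of all the coefficient matrices of the powers of $h$ in $\Omega^h_1,\dots,\Omega^h_r$ are holomorphic on $V$. Let $q_0\in V$ be a point all of whose coordinates are nonzero. Then there are an open neighbourhood $U_0\subseteq V$ of $q_0$, a holomorphic map $Q_0:U_0\to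 GL(\mathbb C^{s+1})$, and a holomorphic map $G:U_0\times\mathbb C\to GL(\mathbb C^{s+1})$, $(q,h)\mapsto G(q,h)$, with $G(q,0)=Q_0(q)$, such that for every complex $h\ne0$ the gauge transformation $G(\cdot,h)$ converts $\nabla=d+\Omega^h$ into $\hat\nabla=d+\hat\Omega^h$ with $$\hat\Omega^h=G\,\Omega^hG^{-1}+G\,d(G^{-1})=\frac1h\,\hat\omega,\qquad \hat\omega=Q_0\,\omega\,Q_0^{-1}\quad\text{on }U_0.$$ -/

import Mathlib

open Polynomial

noncomputable section

/-- An algebra `K` of functions of the complex variables `q₁, …, q_r`, with coordinates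
`q_i ∈ K` and stable under the partial derivatives `∂/∂q_i`.  Its elements are holomorphic
functions, each on an open domain of its own (so that polynomials, rational functions and germs
of holomorphic functions are all covered): `regularAt x` consists of those `f ∈ K` which are
holomorphic at the point `x`, and `ev x` evaluates them there.  An element which vanishes on a
nonempty open set is zero (identity principle). -/
structure FunctionAlgebra (r : ℕ) (K : Type*) [CommRing K] [Algebra ℂ K] where
  /-- the elements of `K` which are defined and holomorphic at `x` -/
  regularAt : (Fin r → ℂ) → Subalgebra ℂ K
  /-- evaluation at `x` -/
  ev : ∀ x, regularAt x →ₐ[ℂ] ℂ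
  isOpen_dom : ∀ f, IsOpen {x | f ∈ regularAt x}
  dom_nonempty : ∀ f, ∃ x, f ∈ regularAt x
  /-- elements of `K` are holomorphic functions on their domains -/
  holomorphic : ∀ (f : K) (val : (Fin r → ℂ) → ℂ),
    (∀ x (hx : f ∈ regularAt x), val x = ev x ⟨f, hx⟩) →
      AnalyticOnNhd ℂ val {x | f ∈ regularAt x}
  /-- elements of `K` are determined by their values on any nonempty open set -/
  eq_zero_of_ev : ∀ (f : K) (W : Set (Fin r → ℂ)), IsOpen W → W.Nonempty →
    (∀ x ∈ W, ∃ hx : f ∈ regularAt x, ev x ⟨f, hx⟩ = 0) → f = 0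
  /-- the coordinate function `q_i` -/
  coord : Fin r → K
  coord_mem : ∀ i x, coord i ∈ regularAt x
  ev_coord : ∀ i x, ev x ⟨coord i, coord_mem i x⟩ = x i
  /-- the partial derivative `∂/∂q_i` -/
  pd : Fin r → Derivation ℂ K K
  pd_mem : ∀ i f x, f ∈ regularAt x → pd i f ∈ regularAt x
  ev_pd : ∀ (i : Fin r) (f : K) (val : (Fin r → ℂ) → ℂ),
    (∀ x (hx : f ∈ regularAt x), val x = ev x ⟨f, hx⟩) →
      ∀ x (hx : f ∈ regularAt x),
        ev x ⟨pd i f, pd_mem i f x hx⟩ = fderiv ℂ val x (Pi.single i 1)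

namespace FunctionAlgebra

variable {r : ℕ} {K : Type*} [CommRing K] [Algebra ℂ K] (F : FunctionAlgebra r K)

open Classical in
/-- The value of `f ∈ K` at the point `x` (with the dummy value `0` off the domain of `f`). -/
def value (f : K) (x : Fin r → ℂ) : ℂ :=
  if hx : f ∈ F.regularAt x then F.ev x ⟨f, hx⟩ else 0

/-- The derivation `∂_i = ∂/∂t_i = q_i ∂/∂q_i` of `K`, where `q_i = exp t_i`. -/
def dlog (i : Fin r) : Derivation ℂ K K := F.coord i • F.pd i

/-- The operator `h∂_i` on `K[h]`, the variable `h` being a constant for `∂_i`: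
`∑ aₙ hⁿ ↦ ∑ ∂_i(aₙ) hⁿ⁺¹`. -/
def hdOp (i : Fin r) : Module.End ℂ K[X] :=
  Polynomial.lsum fun n =>
    ((Polynomial.monomial (n + 1) : K →ₗ[K] K[X]).restrictScalars ℂ) ∘ₗ
      (F.dlog i : K →ₗ[ℂ] K)

/-- The algebra of differential operators (acting on `K[h]`) generated by `h∂_1, …, h∂_r` with
coefficients in `K[h]`. -/
def diffOps : Subalgebra ℂ (Module.End ℂ K[X]) :=
  Algebra.adjoin ℂ (Set.range (LinearMap.mulLeft ℂ : K[X] → Module.End ℂ K[X]) ∪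
    Set.range F.hdOp)

/-- The (noncommutative) ring `D^h` of differential operators generated by `h∂_1, …, h∂_r` with
coefficients in `K[h]`. -/
def Dh : Type _ := F.diffOps

instance : Ring F.Dh := inferInstanceAs (Ring F.diffOps)

/-- The generator `h∂_i` of `D^h`. -/
def hd (i : Fin r) : F.Dh :=
  (⟨F.hdOp i, Algebra.subset_adjoin (Or.inr ⟨i, rfl⟩)⟩ : F.diffOps)

/-- The inclusion of the coefficients `K[h]` in `D^h`, as multiplication operators. -/
def coeff : K[X] →+* F.Dh where
  toFun a := (⟨LinearMap.mulLeft ℂ a, Algebra.subset_adjoin (Or.inl ⟨a, rfl⟩)⟩ : F.diffOps)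
  map_one' := Subtype.ext (LinearMap.mulLeft_one ℂ K[X])
  map_mul' a b := Subtype.ext (LinearMap.mulLeft_mul ℂ K[X] a b)
  map_zero' := Subtype.ext (LinearMap.mulLeft_zero_eq_zero ℂ K[X])
  map_add' a b := Subtype.ext (by ext1 x; exact add_mul a b x)

/-- The differential operator obtained from the polynomial `∑ a_I(q,h) b^I` by replacing `b_i`
by `h∂_i`, the coefficients being written on the left. -/
def ofSymbol (p : MvPolynomial (Fin r) K[X]) : F.Dh :=
  ∑ I ∈ p.support, F.coeff (p.coeff I) * (List.ofFn fun i => F.hd i ^ I i).prod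

/-- `S(P) = p`: the polynomial `p` is the result of replacing `h∂_1, …, h∂_r` by
`b_1, …, b_r` in `P` (written with coefficients on the left). -/
def IsSymbol (P : F.Dh) (p : MvPolynomial (Fin r) K[X]) : Prop := P = F.ofSymbol p

/-- `lim_{h → 0} S(P) = c`. -/
def HasLimit (P : F.Dh) (c : MvPolynomial (Fin r) K) : Prop :=
  ∃ p, F.IsSymbol P p ∧ MvPolynomial.map (Polynomial.evalRingHom (0 : K)) p = c

/-- The cyclic D-module `M^h = D^h / (D_1^h, …, D_u^h)`, where the denominator is the left ideal
generated by the `D_i^h`. -/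
def Mh {u : ℕ} (D : Fin u → F.Dh) : Type _ := F.Dh ⧸ Submodule.span F.Dh (Set.range D)

variable {u : ℕ}

instance (D : Fin u → F.Dh) : AddCommGroup (F.Mh D) :=
  inferInstanceAs (AddCommGroup (F.Dh ⧸ Submodule.span F.Dh (Set.range D)))

instance (D : Fin u → F.Dh) : Module F.Dh (F.Mh D) :=
  inferInstanceAs (Module F.Dh (F.Dh ⧸ Submodule.span F.Dh (Set.range D)))

instance (D : Fin u → F.Dh) : Module K[X] (F.Mh D) := Module.compHom (F.Mh D) F.coeff

/-- The class `[P]` of a differential operator `P` in `M^h`. -/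
def cls (D : Fin u → F.Dh) (P : F.Dh) : F.Mh D :=
  Submodule.Quotient.mk (p := Submodule.span F.Dh (Set.range D)) P

end FunctionAlgebra

/-- The commutative algebra `K[b_1, …, b_r] / (R_1, …, R_u)`. -/
abbrev RelAlgebra {r u : ℕ} {K : Type*} [CommRing K] (R : Fin u → MvPolynomial (Fin r) K) :
    Type _ :=
  MvPolynomial (Fin r) K ⧸ Ideal.span (Set.range R)

/-- The D-module `M^h = D^h / (D_1^h, …, D_u^h)` is a quantization of
`K[b_1, …, b_r] / (R_1, …, R_u)`. -/
structure IsQuantization {r u : ℕ} {K : Type*} [CommRing K] [Algebra ℂ K]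
    (F : FunctionAlgebra r K) (s : ℕ) (R : Fin u → MvPolynomial (Fin r) K)
    (D : Fin u → F.Dh) : Prop where
  /-- `M^h` is free over `K[h]` of rank `s + 1` -/
  free : Nonempty (Module.Basis (Fin (s + 1)) K[X] (F.Mh D))
  /-- `lim_{h → 0} S(D_i^h) = R_i` -/
  limit : ∀ i, F.HasLimit (D i) (R i)

namespace FunctionAlgebra

variable {r s u : ℕ} {K : Type*} [CommRing K] [Algebra ℂ K] (F : FunctionAlgebra r K)

/-- The matrix `hΩ^h_i` of the action of `h∂_i` on the `K[h]`-module `M^h`, with respect to a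
basis: `[h∂_i P_j] = ∑_k (hΩ^h_i)_{kj} [P_k]`. -/
def actionMatrix {D : Fin u → F.Dh} (bM : Module.Basis (Fin (s + 1)) K[X] (F.Mh D))
    (i : Fin r) : Matrix (Fin (s + 1)) (Fin (s + 1)) K[X] :=
  Matrix.of fun k j => bM.repr (F.hd i • bM j) k

/-- The value at the point `q = x` and at a complex number `h` of the matrix `Ω^h_i` of the action
of `∂_i` on `M^h`. The connection form is `Ω^h = ∑ Ω^h_i dt_i`. -/
def connForm {D : Fin u → F.Dh} (bM : Module.Basis (Fin (s + 1)) K[X] (F.Mh D))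
    (h : ℂ) (i : Fin r) (x : Fin r → ℂ) : Matrix (Fin (s + 1)) (Fin (s + 1)) ℂ :=
  Matrix.of fun k j =>
    h⁻¹ * (F.actionMatrix bM i k j).sum fun n a => F.value a x * h ^ n

/-- `Ω^h` depends holomorphically on `q ∈ V`: all the coefficients `ω, θ^(0), …, θ^(p)` of the
powers of `h` in all the entries of the `Ω^h_i` are holomorphic at every point of `V`. -/
def ConnHolomorphicOn {D : Fin u → F.Dh} (bM : Module.Basis (Fin (s + 1)) K[X] (F.Mh D))
    (V : Set (Fin r → ℂ)) : Prop :=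
  ∀ x ∈ V, ∀ i k j n, (F.actionMatrix bM i k j).coeff n ∈ F.regularAt x

/-- The value at `q = x` of the matrix `ω_i` of multiplication by `b_i` on the commutative algebra,
with respect to a basis: `[b_i c_j] = ∑_k (ω_i)_{kj} [c_k]`. -/
def mulForm {R : Fin u → MvPolynomial (Fin r) K}
    (bA : Module.Basis (Fin (s + 1)) K (RelAlgebra R))
    (i : Fin r) (x : Fin r → ℂ) : Matrix (Fin (s + 1)) (Fin (s + 1)) ℂ :=
  Matrix.of fun k j =>
    F.value (bA.repr (Ideal.Quotient.mk (Ideal.span (Set.range R)) (MvPolynomial.X i) * bA j) k) x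

end FunctionAlgebra

/-- The matrix `∂_i G`, where `∂_i = ∂/∂t_i = q_i ∂/∂q_i`, at the point `q = x`. -/
def matDlog {r n : ℕ} (i : Fin r) (G : (Fin r → ℂ) → Matrix (Fin n) (Fin n) ℂ)
    (x : Fin r → ℂ) : Matrix (Fin n) (Fin n) ℂ :=
  Matrix.of fun k j => x i * fderiv ℂ (fun y => G y k j) x (Pi.single i 1)

/-- A map into `GL(ℂⁿ)` is holomorphic on a set if its matrix entries are. -/
def GLHolomorphicOn {E : Type*} [NormedAddCommGroup E] [NormedSpace ℂ E] {n : ℕ}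
    (g : E → GL (Fin n) ℂ) (U : Set E) : Prop :=
  ∀ k j, DifferentiableOn ℂ (fun z => (g z : Matrix (Fin n) (Fin n) ℂ) k j) U

/-- For every nonzero complex number `h`, the gauge transformation `G(·, h)` converts the
connection `d + Ω^h` into `d + Ω̂^h` over `U`, that is
`Ω̂^h = G Ω^h G⁻¹ + G d(G⁻¹) = G Ω^h G⁻¹ - (dG) G⁻¹`.
Forms are given by their coefficients with respect to `dt_1, …, dt_r`. -/
def GaugeTransforms {r n : ℕ} (U : Set (Fin r → ℂ)) (G : (Fin r → ℂ) × ℂ → GL (Fin n) ℂ)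
    (Om Omhat : ℂ → Fin r → (Fin r → ℂ) → Matrix (Fin n) (Fin n) ℂ) : Prop :=
  ∀ h : ℂ, h ≠ 0 → ∀ x ∈ U, ∀ i,
    Omhat h i x =
      (G (x, h) : Matrix (Fin n) (Fin n) ℂ) * Om h i x * ((G (x, h))⁻¹ : GL (Fin n) ℂ) -
        matDlog i (fun y => (G (y, h) : Matrix (Fin n) (Fin n) ℂ)) x *
          ((G (x, h))⁻¹ : GL (Fin n) ℂ)

end

/-! Write hΩ^h = Σ h^k a_k. One looks for G = Σ h^n G_n with G = 1 at q₀ and dG = h⁻¹ (G Σ h^k a_k −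
b G), where b = G_0 a_0 G_0⁻¹; this says that G carries d + Ω^h to d + h⁻¹ b. The choice of b kills
the coefficient of h⁻¹, and the rest reads dG_n = Σ_k G_{n+1-k} a_k − b G_{n+1}. This infinite
system is governed by a bounded operator, `gaugeOp`, on the Banach space of bounded sequences,
depending analytically on the point and on G_0. Along the rays from q₀ it is an analytic ordinary
differential equation, and `exists_radial_solution` gives a solution holomorphic near q₀.

Flatness upgrades the radial solution to a solution in every direction
(`fderiv_eq_gaugeOp_of_radial`): the defect Y in a direction v satisfies ‖DY(y) y + Y‖ ≤ C ‖y‖ ‖Y‖,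
and Grönwall's inequality gives Y = 0. The form b is not known to be flat beforehand; the lowest
coefficients in h express its curvature through the defect itself.

Once G_0 is found, b is a known form and the equation is linear in G. Linear ray equations are
solvable on the whole ball of the power series of their coefficients
(`exists_radial_solution_of_linear`). Solving for the unknowns R^n G_n and comparing by uniqueness
shows that R^n G_n is bounded in n, for arbitrarily large R and on one common ball, so G is entire
in h (`exists_scale_eq`). Invertibility follows from the linear equation that an inverse would
satisfy (`exists_right_inverse`).

On the side of D-modules, flatness holds because the operators h∂_i commute
(`actionMatrix_mul_add`). The leading coefficient of the connection is ω because the limit of a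
symbol is well defined and turns left multiplication by operators into multiplication by polynomials
(`ofSymbol_injective`, `coeff_zero_actionMatrix`). -/

set_option maxSynthPendingDepth 3
open scoped ContDiff Topology BoundedContinuousFunction

/-! ### Power series acting on spaces of continuous functions -/

section Superposition

variable {T Y Z : Type*} [TopologicalSpace T] [CompactSpace T]
  [NormedAddCommGroup Y] [NormedSpace ℂ Y] [NormedAddCommGroup Z] [NormedSpace ℂ Z]

/-- A continuous multilinear map acting pointwise on continuous functions. -/
noncomputable def ContinuousMultilinearMap.pointwise {n : ℕ}
    (p : ContinuousMultilinearMap ℂ (fun _ : Fin n => Y) Z) :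
    ContinuousMultilinearMap ℂ (fun _ : Fin n => C(T, Y)) C(T, Z) :=
  MultilinearMap.mkContinuous
    { toFun := fun m => ⟨fun t => p fun i => m i t, p.cont.comp (by fun_prop)⟩
      map_update_add' := by
        intro _ m i x y
        ext t
        have h : ∀ f : C(T, Y), (fun j => (Function.update m i f j) t) =
            Function.update (fun j => m j t) i (f t) := by
          intro f; funext j
          by_cases hj : j = i
          · subst hj; simp
          · simp [hj]
        simp [h]
      map_update_smul' := by
        intro _ m i c x
        ext t
        have h : ∀ f : C(T, Y), (fun j => (Function.update m i f j) t) =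
            Function.update (fun j => m j t) i (f t) := by
          intro f; funext j
          by_cases hj : j = i
          · subst hj; simp
          · simp [hj]
        simp [h] }
    ‖p‖ (by
      intro m
      rw [ContinuousMap.norm_le _ (by positivity)]
      intro t
      refine (p.le_opNorm _).trans ?_
      gcongr with i
      exact (m i).norm_coe_le_norm t)

@[simp] theorem ContinuousMultilinearMap.pointwise_apply {n : ℕ}
    (p : ContinuousMultilinearMap ℂ (fun _ : Fin n => Y) Z) (m : Fin n → C(T, Y)) (t : T) :
    p.pointwise m t = p fun i => m i t := rfl

theorem ContinuousMultilinearMap.norm_pointwise_le {n : ℕ}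
    (p : ContinuousMultilinearMap ℂ (fun _ : Fin n => Y) Z) :
    ‖(p.pointwise : ContinuousMultilinearMap ℂ (fun _ : Fin n => C(T, Y)) C(T, Z))‖ ≤ ‖p‖ :=
  MultilinearMap.mkContinuous_norm_le _ (norm_nonneg _) _

/-- The pointwise coefficients have norm at most that of the original ones, so the radius does not
shrink, and evaluation at a point maps the ball for the sup norm into the original ball. An analytic
right-hand side thereby becomes an analytic map on paths. -/
theorem HasFPowerSeriesOnBall.exists_superposition [CompleteSpace Z] {f : Y → Z}
    {p : FormalMultilinearSeries ℂ Y Z} {z : Y} {r : ENNReal}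
    (hf : HasFPowerSeriesOnBall f p z r) :
    ∃ S : C(T, Y) → C(T, Z), AnalyticOnNhd ℂ S (Metric.eball (ContinuousMap.const T z) r) ∧
      ∀ y ∈ Metric.eball (ContinuousMap.const T z) r, ∀ t, S y t = f (y t) := by
  let q : FormalMultilinearSeries ℂ C(T, Y) C(T, Z) := fun n => (p n).pointwise
  have hq : p.radius ≤ q.radius := by
    refine ENNReal.le_of_forall_nnreal_lt fun s hs => ?_
    obtain ⟨C, -, hC⟩ := p.norm_mul_pow_le_of_lt_radius hs
    refine q.le_radius_of_bound C fun n => (le_trans ?_ (hC n))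
    gcongr
    exact (p n).norm_pointwise_le
  have hr : r ≤ q.radius := hf.r_le.trans hq
  have h0 := (q.hasFPowerSeriesOnBall (hf.r_pos.trans_le hr)).mono hf.r_pos hr
  have h1 := h0.comp_sub (ContinuousMap.const T z)
  rw [zero_add] at h1
  refine ⟨_, h1.analyticOnNhd, fun y hy t => ?_⟩
  have hy' : y - ContinuousMap.const T z ∈ Metric.eball (0 : C(T, Y)) r := by
    simpa [edist_eq_enorm_sub] using hy
  have hs := h0.hasSum hy'
  have hs' := (ContinuousMap.evalCLM ℂ t : C(T, Z) →L[ℂ] Z).hasSum hs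
  have hyt : y t - z ∈ Metric.eball (0 : Y) r := by
    have : ‖y t - z‖ ≤ ‖y - ContinuousMap.const T z‖ :=
      (y - ContinuousMap.const T z).norm_coe_le_norm t
    rw [mem_eball_zero_iff] at hy' ⊢
    refine lt_of_le_of_lt ?_ hy'
    rw [← ofReal_norm, ← ofReal_norm]
    exact ENNReal.ofReal_le_ofReal this
  have hs2 := hf.hasSum hyt
  rw [add_sub_cancel] at hs2
  rw [zero_add] at hs'
  refine hs'.unique ?_
  exact hs2

end Superposition

theorem AnalyticAt.clm_apply {E F G : Type*} [NormedAddCommGroup E] [NormedSpace ℂ E]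
    [NormedAddCommGroup F] [NormedSpace ℂ F] [NormedAddCommGroup G] [NormedSpace ℂ G]
    {f : E → F →L[ℂ] G} {g : E → F} {x : E} (hf : AnalyticAt ℂ f x) (hg : AnalyticAt ℂ g x) :
    AnalyticAt ℂ (fun y => f y (g y)) x :=
  ((ContinuousLinearMap.id ℂ (F →L[ℂ] G)).analyticAt_bilinear (f x, g x)).comp₂ hf hg

theorem AnalyticAt.const_clm_apply {E F G : Type*} [NormedAddCommGroup E] [NormedSpace ℂ E]
    [NormedAddCommGroup F] [NormedSpace ℂ F] [NormedAddCommGroup G] [NormedSpace ℂ G]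
    (L : F →L[ℂ] G) {g : E → F} {x : E} (hg : AnalyticAt ℂ g x) :
    AnalyticAt ℂ (fun y => L (g y)) x :=
  (L.analyticAt _).comp hg

/-! ### Linear and integral operators on continuous functions -/

namespace ContinuousMap

section

variable {T E W Z : Type*} [TopologicalSpace T] [CompactSpace T]
  [NormedAddCommGroup E] [NormedSpace ℂ E] [NormedAddCommGroup W] [NormedSpace ℂ W]
  [NormedAddCommGroup Z] [NormedSpace ℂ Z]

/-- The continuous linear map `x ↦ (t ↦ φ t • x)`. -/
noncomputable def smulCLM (φ : C(T, ℂ)) : E →L[ℂ] C(T, E) :=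
  LinearMap.mkContinuous
    { toFun := fun x => ⟨fun t => φ t • x, by fun_prop⟩
      map_add' := fun x y => by ext t; simp
      map_smul' := fun c x => by ext t; simp [smul_smul, mul_comm] } ‖φ‖ (by
      intro x
      rw [ContinuousMap.norm_le _ (by positivity)]
      intro t
      simp only [LinearMap.coe_mk, AddHom.coe_mk, ContinuousMap.coe_mk, norm_smul]
      gcongr
      exact φ.norm_coe_le_norm t)

@[simp] theorem smulCLM_apply (φ : C(T, ℂ)) (x : E) (t : T) : smulCLM φ x t = φ t • x := rfl

/-- The pointwise action of a continuous family of continuous linear maps. -/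
noncomputable def pointwiseCLM (A : C(T, W →L[ℂ] Z)) : C(T, W) →L[ℂ] C(T, Z) :=
  LinearMap.mkContinuous
    { toFun := fun y : C(T, W) => (⟨fun t => A t (y t), by fun_prop⟩ : C(T, Z))
      map_add' := fun y z => by ext t; simp
      map_smul' := fun c y => by ext t; simp } ‖A‖ (by
    intro y
    rw [ContinuousMap.norm_le _ (by positivity)]
    intro t
    refine ((A t).le_opNorm _).trans ?_
    gcongr
    · exact A.norm_coe_le_norm t
    · exact y.norm_coe_le_norm t)

theorem norm_pointwiseCLM_le (A : C(T, W →L[ℂ] Z)) : ‖pointwiseCLM A‖ ≤ ‖A‖ :=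
  LinearMap.mkContinuous_norm_le _ (norm_nonneg _) _

/-- The pointwise action of a continuous family of coefficients on continuous functions. -/
noncomputable def actionCLM (ev : Z →L[ℂ] E →L[ℂ] W →L[ℂ] W) :
    C(T, Z) →L[ℂ] E →L[ℂ] (C(T, W) →L[ℂ] C(T, W)) :=
  LinearMap.mkContinuous₂
    (LinearMap.mk₂ ℂ (fun (α : C(T, Z)) (x : E) =>
        pointwiseCLM (⟨fun t => ev (α t) x, by fun_prop⟩ : C(T, W →L[ℂ] W)))
      (fun α β x => by ext y t; simp [pointwiseCLM]) (fun c α x => by ext y t; simp [pointwiseCLM])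
      (fun α x x' => by ext y t; simp [pointwiseCLM])
      (fun c α x => by ext y t; simp [pointwiseCLM])) ‖ev‖ (by
    intro α x
    refine (norm_pointwiseCLM_le _).trans ?_
    rw [ContinuousMap.norm_le _ (by positivity)]
    intro t
    refine (ev.le_opNorm₂ _ _).trans ?_
    gcongr
    exact α.norm_coe_le_norm t)

@[simp] theorem actionCLM_apply (ev : Z →L[ℂ] E →L[ℂ] W →L[ℂ] W) (α : C(T, Z)) (x : E)
    (y : C(T, W)) (t : T) : actionCLM ev α x y t = ev (α t) x (y t) := rfl

end

section

variable {W : Type*} [NormedAddCommGroup W] [NormedSpace ℂ W]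

open scoped unitInterval

theorem continuous_IccExtend {V : Type*} [NormedAddCommGroup V] (f : C(I, V)) :
    Continuous (Set.IccExtend (zero_le_one' ℝ) f) :=
  f.continuous.Icc_extend'

theorem norm_IccExtend_le {V : Type*} [NormedAddCommGroup V] (f : C(I, V)) (t : ℝ) :
    ‖Set.IccExtend (zero_le_one' ℝ) f t‖ ≤ ‖f‖ :=
  f.norm_coe_le_norm _

/-- The operator `f ↦ ∫₀ᵗ f` on continuous functions on the unit interval. -/
noncomputable def volterra : C(I, W) →L[ℂ] C(I, W) :=
  LinearMap.mkContinuous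
    { toFun := fun f => ⟨fun t => ∫ s in (0:ℝ)..t, Set.IccExtend (zero_le_one' ℝ) f s,
        (intervalIntegral.continuous_primitive
          (fun a b => (continuous_IccExtend f).intervalIntegrable a b) 0).comp
          continuous_subtype_val⟩
      map_add' := fun f g => by
        ext t
        simp only [ContinuousMap.coe_mk, ContinuousMap.add_apply]
        rw [← intervalIntegral.integral_add ((continuous_IccExtend f).intervalIntegrable _ _)
          ((continuous_IccExtend g).intervalIntegrable _ _)]
        rfl
      map_smul' := fun c f => by
        ext t
        simp only [ContinuousMap.coe_mk, ContinuousMap.smul_apply, RingHom.id_apply]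
        rw [← intervalIntegral.integral_smul]
        rfl } 1 (by
      intro f
      rw [ContinuousMap.norm_le _ (by positivity)]
      intro t
      refine (intervalIntegral.norm_integral_le_of_norm_le_const (C := ‖f‖)
        fun s _ => norm_IccExtend_le f s).trans ?_
      rw [sub_zero, abs_of_nonneg t.2.1, one_mul]
      exact mul_le_of_le_one_right (norm_nonneg _) t.2.2)

theorem volterra_apply (f : C(I, W)) (t : I) :
    volterra f t = ∫ s in (0:ℝ)..t, Set.IccExtend (zero_le_one' ℝ) f s := rfl

/-- Substitution in the integral. It makes the integral equations attached to x and to s x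
reparametrizations of one another. -/
theorem volterra_scale (f : C(I, W)) (s t : I) :
    volterra f (s * t) =
      volterra (((s : ℝ) : ℂ) • f.comp ⟨fun t => s * t, by fun_prop⟩) t := by
  rw [volterra_apply, volterra_apply]
  have h := intervalIntegral.smul_integral_comp_mul_left (a := 0) (b := t)
    (Set.IccExtend (zero_le_one' ℝ) f) (s : ℝ)
  rw [mul_zero] at h
  rw [show ((s * t : I) : ℝ) = (s : ℝ) * t from rfl, ← h, ← intervalIntegral.integral_smul]
  refine intervalIntegral.integral_congr fun u hu => ?_
  rw [Set.uIcc_of_le t.2.1] at hu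
  have hu1 : u ∈ Set.Icc (0:ℝ) 1 := ⟨hu.1, hu.2.trans t.2.2⟩
  have hu2 : (s : ℝ) * u ∈ Set.Icc (0:ℝ) 1 := ⟨mul_nonneg s.2.1 hu1.1,
    mul_le_one₀ s.2.2 hu1.1 hu1.2⟩
  rw [Set.IccExtend_of_mem _ _ hu1, Set.IccExtend_of_mem _ _ hu2]
  simp only [ContinuousMap.smul_apply, ContinuousMap.comp_apply, ContinuousMap.coe_mk]
  rw [← Complex.coe_smul]
  rfl

theorem hasDerivWithinAt_volterra [CompleteSpace W] (f : C(I, W)) (t : I) :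
    HasDerivWithinAt (fun t => ∫ s in (0:ℝ)..t, Set.IccExtend (zero_le_one' ℝ) f s) (f t)
      (Set.Icc 0 1) (t : ℝ) := by
  have hc := continuous_IccExtend f
  have h := intervalIntegral.integral_hasDerivAt_right (hc.intervalIntegrable 0 (t:ℝ))
    (hc.stronglyMeasurableAtFilter _ _) hc.continuousAt
  rw [Set.IccExtend_val] at h
  exact h.hasDerivWithinAt

/-- The bound on M is pointwise in t; this is what lets the repeated integrals accumulate the factor
t ^ n / n!. -/
theorem norm_volterra_comp_pow_le {M : C(I, W) →L[ℂ] C(I, W)} {c : ℝ} (hc : 0 ≤ c)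
    (hM : ∀ f t, ‖M f t‖ ≤ c * ‖f t‖) (n : ℕ) (f : C(I, W)) (t : I) :
    ‖((volterra ∘L M) ^ n) f t‖ ≤ c ^ n * t ^ n / n.factorial * ‖f‖ := by
  induction n generalizing t with
  | zero => simpa using f.norm_coe_le_norm t
  | succ n ih =>
    rw [pow_succ', mul_apply_eq_comp, ContinuousLinearMap.comp_apply, volterra_apply]
    set g := ((volterra ∘L M) ^ n) f with hg
    have hint : ∫ u in (0:ℝ)..t, c ^ (n+1) * u ^ n / n.factorial * ‖f‖ =
        c ^ (n+1) * (t:ℝ) ^ (n+1) / (n+1).factorial * ‖f‖ := by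
      rw [intervalIntegral.integral_mul_const, intervalIntegral.integral_div,
        intervalIntegral.integral_const_mul, integral_pow]
      rw [Nat.factorial_succ]
      have : (n.factorial : ℝ) ≠ 0 := by positivity
      push_cast
      field_simp
      simp
    rw [← hint]
    refine intervalIntegral.norm_integral_le_of_norm_le t.2.1 ?_ ?_
    · refine Filter.Eventually.of_forall fun u hu => ?_
      have hu1 : u ∈ Set.Icc (0:ℝ) 1 := ⟨hu.1.le, hu.2.trans t.2.2⟩
      rw [Set.IccExtend_of_mem _ _ hu1]
      refine (hM _ _).trans ?_
      calc c * ‖g ⟨u, hu1⟩‖ ≤ c * (c ^ n * u ^ n / n.factorial * ‖f‖) := by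
            gcongr
            exact ih ⟨u, hu1⟩
        _ = _ := by ring
    · exact Continuous.intervalIntegrable (by fun_prop) _ _

/-- Some power of S has norm less than 1 whatever the size of c, and 1 − S ^ n is a product of
commuting factors one of which is 1 − S. Since c need not be small, linear equations can be solved
without shrinking the ball. -/
theorem isUnit_one_sub_volterra_comp [CompleteSpace W] {M : C(I, W) →L[ℂ] C(I, W)} {c : ℝ}
    (hc : 0 ≤ c) (hM : ∀ f t, ‖M f t‖ ≤ c * ‖f t‖) :
    IsUnit (1 - volterra ∘L M : C(I, W) →L[ℂ] C(I, W)) := by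
  set S : C(I, W) →L[ℂ] C(I, W) := volterra ∘L M with hS
  have hle : ∀ n, ‖S ^ n‖ ≤ c ^ n / n.factorial := by
    intro n
    refine ContinuousLinearMap.opNorm_le_bound _ (by positivity) fun f => ?_
    rw [ContinuousMap.norm_le _ (by positivity)]
    intro t
    refine (norm_volterra_comp_pow_le hc hM n f t).trans ?_
    gcongr
    exact mul_le_of_le_one_right (by positivity) (pow_le_one₀ t.2.1 t.2.2)
  obtain ⟨n, hn⟩ := ((FloorSemiring.tendsto_pow_div_factorial_atTop c).eventually
    (gt_mem_nhds one_pos)).exists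
  have hu : IsUnit (1 - S ^ n) := isUnit_one_sub_of_norm_lt_one (R := C(I, W) →L[ℂ] C(I, W))
    ((hle n).trans_lt hn)
  rw [← mul_neg_geom_sum] at hu
  refine ((Commute.isUnit_mul_iff ?_).1 hu).1
  rw [Commute, SemiconjBy, mul_neg_geom_sum, geom_sum_mul_neg]

end

end ContinuousMap

/-! ### Holomorphic differential equations along rays: existence -/

section Ray

variable {E W : Type*} [NormedAddCommGroup E] [NormedSpace ℂ E]
  [NormedAddCommGroup W] [NormedSpace ℂ W] [CompleteSpace W]

open scoped unitInterval

/-- The inclusion of the unit interval in the complex plane. -/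
noncomputable def unitInterval.toComplex : C(unitInterval, ℂ) :=
  ⟨fun t => ((t : ℝ) : ℂ), by fun_prop⟩

@[simp] theorem unitInterval.toComplex_apply (t : I) :
    unitInterval.toComplex t = ((t : ℝ) : ℂ) := rfl

/-- Both sides are the one-sided derivative at s = 1 of s ↦ G (s x), once by the chain rule and once
by the fundamental theorem of calculus. -/
theorem fderiv_radial_of_volterra {G : E → W} {x : E} (hG : DifferentiableAt ℂ G x) (w : W)
    (y f : C(I, W)) (hy : ∀ s : I, y s = w + ContinuousMap.volterra f s)
    (hGy : ∀ s : I, G (((s : ℝ) : ℂ) • x) = y s) : fderiv ℂ G x x = f 1 := by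
  have h1 : HasDerivWithinAt (fun s : ℝ => G ((s : ℂ) • x)) (fderiv ℂ G x x) (Set.Icc 0 1) 1 := by
    have h2 : HasDerivAt (fun s : ℂ => s • x) x 1 := by
      simpa using (hasDerivAt_id (1:ℂ)).smul_const x
    have h3 : HasFDerivAt G (fderiv ℂ G x) ((1:ℂ) • x) := by
      rw [one_smul]; exact hG.hasFDerivAt
    have h4 : HasDerivAt (fun s : ℂ => G (s • x)) (fderiv ℂ G x x) ((1:ℝ):ℂ) := by
      rw [Complex.ofReal_one]
      exact h3.comp_hasDerivAt (1:ℂ) h2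
    have h7 := HasDerivAt.scomp (1:ℝ) h4 Complex.ofRealCLM.hasDerivAt
    simp only [Complex.ofRealCLM_apply, Complex.ofReal_one, one_smul] at h7
    exact h7.hasDerivWithinAt
  have h5 : HasDerivWithinAt (fun s : ℝ => G ((s : ℂ) • x)) (f 1) (Set.Icc 0 1) 1 := by
    have h6 := (ContinuousMap.hasDerivWithinAt_volterra f 1).const_add w
    refine h6.congr (fun s hs => ?_) ?_
    · rw [hGy ⟨s, hs⟩, hy]; rfl
    · have := hGy 1
      rw [hy 1] at this
      exact this
  exact (uniqueDiffOn_Icc zero_lt_one 1 (by simp)).eq_deriv _ h1 h5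

end Ray

section RadialODE

variable {E W : Type*} [NormedAddCommGroup E] [NormedSpace ℂ E]
  [NormedAddCommGroup W] [NormedSpace ℂ W] [CompleteSpace W]

open scoped unitInterval

open ContinuousMap

theorem norm_smulCLM_toComplex_le (x : E) :
    ‖(smulCLM unitInterval.toComplex x : C(I, E))‖ ≤ ‖x‖ := by
  rw [ContinuousMap.norm_le _ (norm_nonneg _)]
  intro t
  rw [smulCLM_apply, norm_smul]
  refine mul_le_of_le_one_left (norm_nonneg _) ?_
  rw [unitInterval.toComplex_apply, Complex.norm_real, Real.norm_of_nonneg t.2.1]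
  exact t.2.2

/-- A linear differential equation along rays has a holomorphic solution on every ball on which
its coefficients are given by a power series. -/
theorem exists_radial_solution_of_linear {Z : Type*} [NormedAddCommGroup Z] [NormedSpace ℂ Z]
    [CompleteSpace Z] (ev : Z →L[ℂ] E →L[ℂ] W →L[ℂ] W) {A : E → Z}
    {p : FormalMultilinearSeries ℂ E Z} {r : ENNReal}
    (hA : HasFPowerSeriesOnBall A p 0 r) (w : W) :
    ∃ G : E → W, AnalyticOnNhd ℂ G (Metric.eball 0 r) ∧ G 0 = w ∧
      ∀ x ∈ Metric.eball (0 : E) r, fderiv ℂ G x x = ev (A x) x (G x) := by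
  obtain ⟨S, hS, hSA⟩ := hA.exists_superposition (T := I)
  have hball : ∀ x ∈ Metric.eball (0 : E) r,
      (smulCLM unitInterval.toComplex x : C(I, E)) ∈
        Metric.eball (ContinuousMap.const I (0:E)) r := by
    intro x hx
    have h0 : ContinuousMap.const I (0:E) = 0 := rfl
    rw [h0, mem_eball_zero_iff]
    rw [mem_eball_zero_iff] at hx
    refine lt_of_le_of_lt ?_ hx
    rw [← ofReal_norm, ← ofReal_norm]
    exact ENNReal.ofReal_le_ofReal (norm_smulCLM_toComplex_le x)
  -- The unknown is the whole path y = (t ↦ G (t x)), a solution of the linear integral equation (1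
  -- − `volterra` ∘ B x) y = w.
  let B : E → C(I, W) →L[ℂ] C(I, W) := fun x =>
    actionCLM ev (S (smulCLM unitInterval.toComplex x)) x
  have hB : ∀ x ∈ Metric.eball (0 : E) r, ∀ y, ∀ t : I,
      B x y t = ev (A (((t : ℝ) : ℂ) • x)) x (y t) := by
    intro x hx y t
    simp only [B, actionCLM_apply, hSA _ (hball x hx)]
    rfl
  have hBn : ∀ x y t, ‖B x y t‖ ≤
      ‖ev‖ * ‖S (smulCLM unitInterval.toComplex x)‖ * ‖x‖ * ‖y t‖ := by
    intro x y t
    refine ((ev _ x).le_opNorm _).trans ?_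
    gcongr
    refine (ev.le_opNorm₂ _ _).trans ?_
    gcongr
    exact ContinuousMap.norm_coe_le_norm _ t
  have hBan : AnalyticOnNhd ℂ B (Metric.eball 0 r) := by
    intro x hx
    have h1 : AnalyticAt ℂ (fun x : E => S (smulCLM unitInterval.toComplex x)) x :=
      (hS _ (hball x hx)).comp ((smulCLM unitInterval.toComplex : E →L[ℂ] C(I, E)).analyticAt x)
    have h2 : AnalyticAt ℂ
        (fun x : E => actionCLM ev (S (smulCLM unitInterval.toComplex x))) x :=
      AnalyticAt.const_clm_apply (actionCLM ev) h1
    exact h2.clm_apply analyticAt_id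
  let D : E → C(I, W) →L[ℂ] C(I, W) := fun x => 1 - volterra ∘L B x
  have hDu : ∀ x, IsUnit (D x) := fun x =>
    isUnit_one_sub_volterra_comp (by positivity) (hBn x)
  have hDan : AnalyticOnNhd ℂ D (Metric.eball 0 r) := by
    intro x hx
    refine analyticAt_const.sub ?_
    exact AnalyticAt.const_clm_apply (F := C(I, W) →L[ℂ] C(I, W)) (G := C(I, W) →L[ℂ] C(I, W))
      (ContinuousLinearMap.compL ℂ C(I, W) C(I, W) C(I, W) volterra) (hBan x hx)
  let y : E → C(I, W) := fun x => Ring.inverse (D x) (ContinuousMap.const I w)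
  have hyan : AnalyticOnNhd ℂ y (Metric.eball 0 r) := by
    intro x hx
    have h1 : AnalyticAt ℂ (Ring.inverse : (C(I, W) →L[ℂ] C(I, W)) → _) (D x) :=
      analyticAt_inverse (𝕜 := ℂ) (A := C(I, W) →L[ℂ] C(I, W)) (hDu x).unit
    exact (h1.comp (hDan x hx)).clm_apply analyticAt_const
  have hDy : ∀ x, D x (y x) = ContinuousMap.const I w := by
    intro x
    have := Ring.mul_inverse_cancel _ (hDu x)
    exact DFunLike.congr_fun this (ContinuousMap.const I w)
  have hyeq : ∀ x, ∀ t, y x t = w + volterra (B x (y x)) t := by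
    intro x t
    have := DFunLike.congr_fun (hDy x) t
    rw [← sub_eq_iff_eq_add]
    exact this
  have hinj : ∀ x z, D x z = ContinuousMap.const I w → z = y x := by
    intro x z hz
    have h1 := Ring.inverse_mul_cancel _ (hDu x)
    have h2 := DFunLike.congr_fun h1 z
    rw [mul_apply_eq_comp, hz] at h2
    exact h2.symm
  -- By uniqueness the path at s x is the path at x reparametrized by t ↦ s t. Hence the function x
  -- ↦ y x 1 takes the value y x s at s x.
  have hscale : ∀ x ∈ Metric.eball (0 : E) r, ∀ s : I,
      (y x).comp ⟨fun t => s * t, by fun_prop⟩ = y (((s : ℝ) : ℂ) • x) := by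
    intro x hx s
    have hsx : ((s : ℝ) : ℂ) • x ∈ Metric.eball (0 : E) r := by
      rw [mem_eball_zero_iff] at hx ⊢
      refine lt_of_le_of_lt ?_ hx
      rw [← ofReal_norm, ← ofReal_norm]
      refine ENNReal.ofReal_le_ofReal ?_
      rw [norm_smul, Complex.norm_real, Real.norm_of_nonneg s.2.1]
      exact mul_le_of_le_one_left (norm_nonneg _) s.2.2
    apply hinj
    ext t
    have h1 : B (((s : ℝ) : ℂ) • x) ((y x).comp ⟨fun t => s * t, by fun_prop⟩) =
        ((s : ℝ) : ℂ) • (B x (y x)).comp ⟨fun t => s * t, by fun_prop⟩ := by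
      ext t
      simp only [ContinuousMap.comp_apply, ContinuousMap.coe_mk,
        ContinuousMap.smul_apply]
      rw [hB _ hsx, hB _ hx, smul_smul, map_smul, _root_.smul_apply]
      congr 4
      rw [mul_comm, ← Complex.ofReal_mul]
      rfl
    have h2 := hyeq x (s * t)
    rw [volterra_scale, ← h1, ← sub_eq_iff_eq_add] at h2
    exact h2
  refine ⟨fun x => y x 1, fun x hx => ?_, ?_, fun x hx => ?_⟩
  · exact ((ContinuousMap.evalCLM ℂ (1:I) : C(I, W) →L[ℂ] W).analyticAt _).comp (hyan x hx)
  · have h := hyeq 0 1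
    have h0 : B 0 = 0 := map_zero (actionCLM ev (S (smulCLM unitInterval.toComplex 0)))
    rw [h0] at h
    simpa using h
  · have hG : AnalyticAt ℂ (fun x => y x 1) x :=
      ((ContinuousMap.evalCLM ℂ (1:I) : C(I, W) →L[ℂ] W).analyticAt _).comp (hyan x hx)
    rw [fderiv_radial_of_volterra hG.differentiableAt w (y x) (B x (y x)) (hyeq x)]
    · rw [hB x hx]
      simp
    · intro s
      rw [← hscale x hx s]
      simp

/-- A holomorphic differential equation along rays has a local holomorphic solution. -/
theorem exists_radial_solution [CompleteSpace E] {F : E × W → E →L[ℂ] W} {w : W}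
    (hF : AnalyticAt ℂ F (0, w)) :
    ∃ G : E → W, AnalyticAt ℂ G 0 ∧ G 0 = w ∧ ∀ᶠ x in 𝓝 (0 : E),
      fderiv ℂ G x x = F (x, G x) x := by
  -- Base point and direction are separate arguments: on the ray the first becomes t x while the
  -- second stays x.
  let f : (E × E) × W → W := fun z => F (z.1.1, z.2) z.1.2
  have hf : AnalyticAt ℂ f ((0, 0), w) := by
    have h1 : AnalyticAt ℂ (fun z : (E × E) × W => F (z.1.1, z.2)) ((0, 0), w) := by
      refine AnalyticAt.comp (g := F) (f := fun z : (E × E) × W => (z.1.1, z.2)) hF ?_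
      exact ((ContinuousLinearMap.fst ℂ E E ∘L ContinuousLinearMap.fst ℂ (E × E) W).prod
        (ContinuousLinearMap.snd ℂ (E × E) W)).analyticAt _
    exact h1.clm_apply
      ((ContinuousLinearMap.snd ℂ E E ∘L ContinuousLinearMap.fst ℂ (E × E) W).analyticAt _)
  obtain ⟨p, r, hp⟩ := hf
  obtain ⟨S, hS, hSf⟩ := hp.exists_superposition (T := I)
  let c : C(I, (E × E) × W) := ContinuousMap.const I ((0, 0), w)
  let ι : E × C(I, W) →L[ℂ] C(I, (E × E) × W) :=
    LinearMap.mkContinuous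
      { toFun := fun z => ⟨fun t => ((((t : ℝ) : ℂ) • z.1, z.1), z.2 t), by fun_prop⟩
        map_add' := fun a b => by ext t <;> simp
        map_smul' := fun a b => by ext t <;> simp [-Complex.coe_smul, smul_smul, mul_comm] } 1 (by
        intro z
        rw [ContinuousMap.norm_le _ (by positivity), one_mul]
        intro t
        simp only [LinearMap.coe_mk, AddHom.coe_mk, ContinuousMap.coe_mk]
        have h1 : ‖z.1‖ ≤ ‖z‖ := norm_fst_le z
        have h2 : ‖z.2 t‖ ≤ ‖z‖ := (z.2.norm_coe_le_norm t).trans (norm_snd_le z)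
        have h3 : ‖((t : ℝ) : ℂ) • z.1‖ ≤ ‖z‖ :=
          ((smulCLM unitInterval.toComplex z.1).norm_coe_le_norm t).trans
            ((norm_smulCLM_toComplex_le z.1).trans h1)
        exact norm_prod_le_iff.2 ⟨norm_prod_le_iff.2 ⟨h3, h1⟩, h2⟩)
  have hι : ∀ z t, ι z t = ((((t : ℝ) : ℂ) • z.1, z.1), z.2 t) := fun z t => rfl
  let z₀ : E × C(I, W) := (0, ContinuousMap.const I w)
  have hιz₀ : ι z₀ = c := by ext t <;> simp [hι, z₀, c]
  let Φ : E × C(I, W) → C(I, W) := fun z => z.2 - ContinuousMap.const I w - volterra (S (ι z))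
  have hc : c ∈ Metric.eball c r := Metric.mem_eball_self hp.r_pos
  have hΦan : AnalyticAt ℂ Φ z₀ := by
    have h1 : AnalyticAt ℂ (fun z => S (ι z)) z₀ := by
      refine AnalyticAt.comp (g := S) ?_ (ι.analyticAt _)
      rw [hιz₀]; exact hS c hc
    have h2 : AnalyticAt ℂ (fun z => volterra (S (ι z))) z₀ :=
      ((volterra : C(I, W) →L[ℂ] C(I, W)).analyticAt _).comp h1
    exact (analyticAt_snd.sub analyticAt_const).sub h2
  have hnear : ∀ᶠ z in 𝓝 z₀, ι z ∈ Metric.eball c r := by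
    refine ι.continuous.continuousAt.eventually_mem ?_
    rw [hιz₀]; exact Metric.eball_mem_nhds c hp.r_pos
  -- For direction 0 the right-hand side vanishes, so the partial derivative of Φ in y is the
  -- identity at z₀, as the implicit function theorem requires.
  have hΦ0 : ∀ᶠ y in 𝓝 (ContinuousMap.const I w), Φ (0, y) = y - ContinuousMap.const I w := by
    have h1 : Filter.Tendsto (fun y : C(I, W) => ((0 : E), y))
        (𝓝 (ContinuousMap.const I w)) (𝓝 z₀) :=
      (Continuous.prodMk_right (0:E)).tendsto _
    filter_upwards [h1.eventually hnear] with y hy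
    have h2 : S (ι (0, y)) = 0 := by
      ext t
      rw [hSf _ hy, hι]
      simp [f]
    simp only [Φ, h2, map_zero, sub_zero]
  have hΦz₀ : Φ z₀ = 0 := by
    have := hΦ0.self_of_nhds
    simpa [z₀] using this
  have hder : fderiv ℂ Φ z₀ ∘L .inr ℂ E C(I, W) = ContinuousLinearMap.id ℂ _ := by
    have h1 : HasFDerivAt (fun y => Φ (0, y)) (fderiv ℂ Φ z₀ ∘L .inr ℂ E C(I, W))
        (ContinuousMap.const I w) := by
      have h2 : HasFDerivAt (fun y : C(I, W) => ((0 : E), y)) (.inr ℂ E C(I, W))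
          (ContinuousMap.const I w) := (ContinuousLinearMap.inr ℂ E C(I, W)).hasFDerivAt
      exact HasFDerivAt.comp (ContinuousMap.const I w) hΦan.differentiableAt.hasFDerivAt h2
    have h3 : HasFDerivAt (fun y => Φ (0, y)) (ContinuousLinearMap.id ℂ _)
        (ContinuousMap.const I w) :=
      ((hasFDerivAt_id _).sub_const _).congr_of_eventuallyEq hΦ0
    exact h1.unique h3
  have hinv : (fderiv ℂ Φ z₀ ∘L .inr ℂ E C(I, W)).IsInvertible := by
    rw [hder]; exact ⟨ContinuousLinearEquiv.refl ℂ _, rfl⟩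
  have hcd : ContDiffAt ℂ ω Φ z₀ := hΦan.contDiffAt
  have hω : (ω : WithTop ℕ∞) ≠ 0 := by simp
  let y := hcd.implicitFunction hω hinv
  have hyan : AnalyticAt ℂ y 0 := (hcd.contDiffAt_implicitFunction hω hinv).analyticAt
  have hy0 : y 0 = ContinuousMap.const I w := hcd.implicitFunction_apply_self hω hinv
  have huniq := hcd.eventually_apply_eq_iff_implicitFunction hω hinv
  have hmap : Filter.Tendsto (fun x => (x, y x)) (𝓝 0) (𝓝 z₀) := by
    have : ContinuousAt (fun x => (x, y x)) 0 := continuousAt_id.prodMk hyan.continuousAt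
    have h := this.tendsto
    rwa [hy0] at h
  obtain ⟨ε, hε, hεb⟩ := Metric.eventually_nhds_iff_ball.1 (huniq.and hnear)
  have hsmall : ∀ᶠ x in 𝓝 (0:E), (x, y x) ∈ Metric.ball z₀ ε ∧ AnalyticAt ℂ y x :=
    (hmap.eventually (Metric.ball_mem_nhds z₀ hε)).and hyan.eventually_analyticAt
  refine ⟨fun x => y x 1, ?_, by simp [hy0], ?_⟩
  · exact ((ContinuousMap.evalCLM ℂ (1:I) : C(I, W) →L[ℂ] W).analyticAt _).comp hyan
  filter_upwards [hsmall] with x hx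
  obtain ⟨hxb, hxan⟩ := hx
  have hG : AnalyticAt ℂ (fun x => y x 1) x :=
    ((ContinuousMap.evalCLM ℂ (1:I) : C(I, W) →L[ℂ] W).analyticAt _).comp hxan
  have heq : Φ (x, y x) = 0 := by
    rw [← hΦz₀]; exact (hεb _ hxb).1.2 rfl
  have hyeq : ∀ t, y x t = w + volterra (S (ι (x, y x))) t := by
    intro t
    have := DFunLike.congr_fun heq t
    simp only [Φ, ContinuousMap.sub_apply, ContinuousMap.const_apply, ContinuousMap.zero_apply]
      at this
    rw [sub_sub, sub_eq_zero] at this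
    exact this
  rw [fderiv_radial_of_volterra hG.differentiableAt w (y x) (S (ι (x, y x))) hyeq]
  · rw [hSf _ (hεb _ hxb).2, hι]
    simp [f]
  · intro s
    -- Scaling x and reparametrizing the path do not increase the distance to z₀, so the pair stays
    -- where the implicit function is the only solution.
    have hmem : ((((s : ℝ) : ℂ) • x, (y x).comp ⟨fun t => s * t, by fun_prop⟩) : E × C(I, W)) ∈
        Metric.ball z₀ ε := by
      rw [Metric.mem_ball, dist_eq_norm] at hxb ⊢
      refine lt_of_le_of_lt ?_ hxb
      refine norm_prod_le_iff.2 ⟨?_, ?_⟩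
      · refine le_trans ?_ (norm_fst_le _)
        simp only [z₀, Prod.fst_sub, sub_zero]
        rw [norm_smul, Complex.norm_real, Real.norm_of_nonneg s.2.1]
        exact mul_le_of_le_one_left (norm_nonneg _) s.2.2
      · refine le_trans ?_ (norm_snd_le _)
        simp only [z₀, Prod.snd_sub]
        rw [ContinuousMap.norm_le _ (norm_nonneg _)]
        intro t
        exact (y x - ContinuousMap.const I w).norm_coe_le_norm (s * t)
    have hΦs : Φ (((s : ℝ) : ℂ) • x, (y x).comp ⟨fun t => s * t, by fun_prop⟩) = Φ z₀ := by
      rw [hΦz₀]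
      have h1 : S (ι (((s : ℝ) : ℂ) • x, (y x).comp ⟨fun t => s * t, by fun_prop⟩)) =
          ((s : ℝ) : ℂ) • (S (ι (x, y x))).comp ⟨fun t => s * t, by fun_prop⟩ := by
        ext t
        rw [hSf _ (hεb _ hmem).2, hι]
        simp only [ContinuousMap.comp_apply, ContinuousMap.coe_mk, ContinuousMap.smul_apply]
        rw [hSf _ (hεb _ hxb).2, hι]
        simp only [f, map_smul, smul_smul]
        congr 5
        rw [mul_comm, ← Complex.ofReal_mul]
        rfl
      ext t
      have h2 := hyeq (s * t)
      rw [volterra_scale, ← h1, ← sub_eq_zero, ← sub_sub] at h2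
      exact h2
    have := (hεb _ hmem).1.1 hΦs
    simp only at this
    rw [show y (((s : ℝ) : ℂ) • x) = _ from this]
    simp

end RadialODE

/-! ### Uniqueness along rays, by Grönwall's inequality -/

section RadialUniqueness

variable {E W : Type*} [NormedAddCommGroup E] [NormedSpace ℂ E]
  [NormedAddCommGroup W] [NormedSpace ℂ W]

theorem hasDerivAt_radial {Y : E → W} {x : E} {t : ℝ}
    (hY : DifferentiableAt ℂ Y ((t : ℂ) • x)) :
    HasDerivAt (fun s : ℝ => Y ((s : ℂ) • x)) (fderiv ℂ Y ((t : ℂ) • x) x) t := by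
  have h2 : HasDerivAt (fun s : ℂ => s • x) x (t : ℂ) := by
    simpa using (hasDerivAt_id (t : ℂ)).smul_const x
  have h4 : HasDerivAt (fun s : ℂ => Y (s • x)) (fderiv ℂ Y ((t : ℂ) • x) x) (t : ℂ) :=
    hY.hasFDerivAt.comp_hasDerivAt (t : ℂ) h2
  have h7 := HasDerivAt.scomp t h4 Complex.ofRealCLM.hasDerivAt
  simp only [Complex.ofRealCLM_apply, Complex.ofReal_one, one_smul] at h7
  exact h7

/-- Grönwall for t ↦ Y (t x). The hypothesis concerns the direction t x; division by t gives the
needed bound for t > 0, and continuity of the derivative gives it at t = 0. -/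
theorem eq_zero_of_norm_fderiv_radial_le [CompleteSpace W] {Y : E → W} {x : E} {c : ℝ}
    (hY : ∀ t ∈ Set.Icc (0:ℝ) 1, AnalyticAt ℂ Y ((t : ℂ) • x)) (h0 : Y 0 = 0)
    (hb : ∀ t ∈ Set.Icc (0:ℝ) 1,
      ‖fderiv ℂ Y ((t : ℂ) • x) ((t : ℂ) • x)‖ ≤ c * t * ‖Y ((t : ℂ) • x)‖) : Y x = 0 := by
  have hd : ∀ t ∈ Set.Icc (0:ℝ) 1, HasDerivAt (fun s : ℝ => Y ((s : ℂ) • x))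
      (fderiv ℂ Y ((t : ℂ) • x) x) t := fun t ht => hasDerivAt_radial (hY t ht).differentiableAt
  have hpos : ∀ t ∈ Set.Ioc (0:ℝ) 1, ‖fderiv ℂ Y ((t : ℂ) • x) x‖ ≤ c * ‖Y ((t : ℂ) • x)‖ := by
    intro t ht
    have h := hb t ⟨ht.1.le, ht.2⟩
    rw [map_smul, norm_smul, Complex.norm_real, Real.norm_of_nonneg ht.1.le, mul_comm c,
      mul_assoc] at h
    exact le_of_mul_le_mul_left h ht.1
  have hc1 : ContinuousAt (fun t : ℝ => ‖fderiv ℂ Y ((t : ℂ) • x) x‖) 0 := by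
    have h1 : ContinuousAt (fderiv ℂ Y) (((0:ℝ) : ℂ) • x) :=
      (hY 0 (by simp)).fderiv.continuousAt
    have h2 : ContinuousAt (fun t : ℝ => fderiv ℂ Y ((t : ℂ) • x)) 0 :=
      ContinuousAt.comp (f := fun t : ℝ => (t : ℂ) • x) h1 (by fun_prop)
    exact (h2.clm_apply continuousAt_const).norm
  have hc2 : ContinuousAt (fun t : ℝ => c * ‖Y ((t : ℂ) • x)‖) 0 :=
    continuousAt_const.mul (hd 0 (by simp)).continuousAt.norm
  have hall : ∀ t ∈ Set.Icc (0:ℝ) 1, ‖fderiv ℂ Y ((t : ℂ) • x) x‖ ≤ c * ‖Y ((t : ℂ) • x)‖ := by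
    intro t ht
    rcases ht.1.eq_or_lt with rfl | hlt
    · refine le_of_tendsto_of_tendsto (hc1.tendsto.mono_left (nhdsWithin_le_nhds (s := Set.Ioi 0)))
        (hc2.tendsto.mono_left (nhdsWithin_le_nhds (s := Set.Ioi 0))) ?_
      filter_upwards [Ioc_mem_nhdsGT (zero_lt_one' ℝ)] with s hs using hpos s hs
    · exact hpos t ⟨hlt, ht.2⟩
  have h := eq_zero_of_abs_deriv_le_mul_abs_self_of_eq_zero_right
    (f := fun s : ℝ => Y ((s : ℂ) • x)) (f' := fun t => fderiv ℂ Y ((t : ℂ) • x) x) (K := c)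
    (a := 0) (b := 1) (fun t ht => (hd t ht).continuousAt.continuousWithinAt)
    (fun t ht => (hd t ⟨ht.1, ht.2.le⟩).hasDerivWithinAt) (by simp [h0])
    (fun t ht => hall t ⟨ht.1, ht.2.le⟩) 1 (by simp)
  simpa using h

/-- The expression bounded is the derivative of t ↦ t Y (t x), which vanishes at t = 0; hence no
initial condition on Y is needed. -/
theorem eq_zero_of_norm_fderiv_radial_add_le {Y : E → W} {x : E} {c : ℝ}
    (hY : ∀ t ∈ Set.Icc (0:ℝ) 1, DifferentiableAt ℂ Y ((t : ℂ) • x))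
    (hb : ∀ t ∈ Set.Icc (0:ℝ) 1,
      ‖fderiv ℂ Y ((t : ℂ) • x) ((t : ℂ) • x) + Y ((t : ℂ) • x)‖ ≤ c * t * ‖Y ((t : ℂ) • x)‖) :
    Y x = 0 := by
  have hd : ∀ t ∈ Set.Icc (0:ℝ) 1, HasDerivAt (fun s : ℝ => (s : ℂ) • Y ((s : ℂ) • x))
      (fderiv ℂ Y ((t : ℂ) • x) ((t : ℂ) • x) + Y ((t : ℂ) • x)) t := by
    intro t ht
    have h1 : HasDerivAt (fun s : ℝ => (s : ℂ)) 1 t := Complex.ofRealCLM.hasDerivAt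
    have h2 := h1.smul (hasDerivAt_radial (hY t ht))
    rw [one_smul] at h2
    rw [map_smul]
    exact h2
  have h := eq_zero_of_abs_deriv_le_mul_abs_self_of_eq_zero_right
    (f := fun s : ℝ => (s : ℂ) • Y ((s : ℂ) • x))
    (f' := fun t => fderiv ℂ Y ((t : ℂ) • x) ((t : ℂ) • x) + Y ((t : ℂ) • x)) (K := c)
    (a := 0) (b := 1) (fun t ht => (hd t ht).continuousAt.continuousWithinAt)
    (fun t ht => (hd t ⟨ht.1, ht.2.le⟩).hasDerivWithinAt) (by simp)
    (fun t ht => by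
      rw [norm_smul, Complex.norm_real, Real.norm_of_nonneg ht.1, ← mul_assoc]
      exact hb t ⟨ht.1, ht.2.le⟩) 1 (by simp)
  simpa using h

theorem smul_mem_eball {x : E} {r : ENNReal} (hx : x ∈ Metric.eball (0 : E) r) {t : ℝ}
    (ht : t ∈ Set.Icc (0:ℝ) 1) : (t : ℂ) • x ∈ Metric.eball (0 : E) r := by
  rw [mem_eball_zero_iff] at hx ⊢
  refine lt_of_le_of_lt ?_ hx
  rw [← ofReal_norm, ← ofReal_norm]
  refine ENNReal.ofReal_le_ofReal ?_
  rw [norm_smul, Complex.norm_real, Real.norm_of_nonneg ht.1]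
  exact mul_le_of_le_one_left (norm_nonneg _) ht.2

theorem exists_norm_radial_le {V : Type*} [NormedAddCommGroup V] {f : E → V} {x : E}
    (hf : ∀ t ∈ Set.Icc (0:ℝ) 1, ContinuousAt f ((t : ℂ) • x)) :
    ∃ c, 0 ≤ c ∧ ∀ t ∈ Set.Icc (0:ℝ) 1, ‖f ((t : ℂ) • x)‖ ≤ c := by
  have hcont : ContinuousOn (fun t : ℝ => f ((t : ℂ) • x)) (Set.Icc 0 1) := fun t ht =>
    (ContinuousAt.comp (f := fun t : ℝ => (t : ℂ) • x) (hf t ht)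
      (by fun_prop)).continuousWithinAt
  obtain ⟨c, hc⟩ := isCompact_Icc.exists_bound_of_continuousOn hcont
  exact ⟨c, (norm_nonneg _).trans (hc 0 (by simp)), hc⟩

theorem eqOn_of_radial_linear [CompleteSpace W] {Z : Type*} [NormedAddCommGroup Z]
    [NormedSpace ℂ Z] (ev : Z →L[ℂ] E →L[ℂ] W →L[ℂ] W) {A : E → Z} {r : ENNReal}
    (hA : ContinuousOn A (Metric.eball 0 r)) {G H : E → W}
    (hG : AnalyticOnNhd ℂ G (Metric.eball 0 r)) (hH : AnalyticOnNhd ℂ H (Metric.eball 0 r))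
    (h0 : G 0 = H 0) (hGe : ∀ x ∈ Metric.eball (0 : E) r, fderiv ℂ G x x = ev (A x) x (G x))
    (hHe : ∀ x ∈ Metric.eball (0 : E) r, fderiv ℂ H x x = ev (A x) x (H x)) :
    Set.EqOn G H (Metric.eball 0 r) := by
  intro x hx
  rw [← sub_eq_zero]
  obtain ⟨c, hc, hAc⟩ := exists_norm_radial_le (f := A) (x := x) fun t ht =>
    hA.continuousAt (Metric.isOpen_eball.mem_nhds (smul_mem_eball hx ht))
  refine eq_zero_of_norm_fderiv_radial_le (Y := fun x => G x - H x) (c := ‖ev‖ * c * ‖x‖)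
    (fun t ht => (hG _ (smul_mem_eball hx ht)).sub (hH _ (smul_mem_eball hx ht)))
    (by simp [h0]) fun t ht => ?_
  have htx := smul_mem_eball hx ht
  rw [fderiv_fun_sub (hG _ htx).differentiableAt (hH _ htx).differentiableAt, sub_apply,
    hGe _ htx, hHe _ htx, ← map_sub]
  refine ((ev _ _).le_opNorm _).trans ?_
  gcongr
  refine (ev.le_opNorm₂ _ _).trans ?_
  rw [norm_smul, Complex.norm_real, Real.norm_of_nonneg ht.1]
  have := hAc t ht
  calc ‖ev‖ * ‖A ((t : ℂ) • x)‖ * (t * ‖x‖) ≤ ‖ev‖ * c * (t * ‖x‖) := by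
        have := ht.1
        gcongr
    _ = _ := by ring

end RadialUniqueness

/-! ### Bounded sequences of coefficients and the gauge operator -/

namespace CoeffSeq

variable {B : Type*} [NormedRing B] [NormedAlgebra ℂ B]

/-- Right multiplication of the terms of a bounded sequence by a constant. -/
noncomputable def mulRight : B →L[ℂ] (ℕ →ᵇ B) →L[ℂ] (ℕ →ᵇ B) :=
  LinearMap.mkContinuous₂
    (LinearMap.mk₂ ℂ (fun (b : B) (w : ℕ →ᵇ B) => w * BoundedContinuousFunction.const ℕ b)
      (fun b b' w => by ext n; simp [mul_add]) (fun c b w => by ext n; simp)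
      (fun b w w' => by ext n; simp [add_mul]) (fun c b w => by ext n; simp)) 1 (by
    intro b w
    refine (norm_mul_le _ _).trans ?_
    rw [one_mul, mul_comm]
    exact mul_le_mul_of_nonneg_right (BoundedContinuousFunction.norm_const_le b) (norm_nonneg _))

@[simp] theorem mulRight_apply (b : B) (w : ℕ →ᵇ B) (n : ℕ) : mulRight b w n = w n * b := rfl

/-- Left multiplication of the terms of a bounded sequence by a constant. -/
noncomputable def mulLeft : B →L[ℂ] (ℕ →ᵇ B) →L[ℂ] (ℕ →ᵇ B) :=
  LinearMap.mkContinuous₂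
    (LinearMap.mk₂ ℂ (fun (b : B) (w : ℕ →ᵇ B) => BoundedContinuousFunction.const ℕ b * w)
      (fun b b' w => by ext n; simp [add_mul]) (fun c b w => by ext n; simp)
      (fun b w w' => by ext n; simp [mul_add]) (fun c b w => by ext n; simp)) 1 (by
    intro b w
    refine (norm_mul_le _ _).trans ?_
    rw [one_mul]
    exact mul_le_mul_of_nonneg_right (BoundedContinuousFunction.norm_const_le b) (norm_nonneg _))

@[simp] theorem mulLeft_apply (b : B) (w : ℕ →ᵇ B) (n : ℕ) : mulLeft b w n = b * w n := rfl

/-- Multiplication of the generating function of a sequence by `h ^ k / h`, truncated to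
nonnegative powers of `h`. -/
noncomputable def shift (k : ℕ) : (ℕ →ᵇ B) →L[ℂ] (ℕ →ᵇ B) :=
  LinearMap.mkContinuous
    { toFun := fun w => BoundedContinuousFunction.ofNormedAddCommGroupDiscrete
        (fun n => if k ≤ n + 1 then w (n + 1 - k) else 0) ‖w‖ (fun n => by
          split_ifs
          · exact w.norm_coe_le_norm _
          · simp)
      map_add' := fun w w' => by
        ext n
        by_cases h : k ≤ n + 1 <;> simp [h]
      map_smul' := fun c w => by
        ext n
        by_cases h : k ≤ n + 1 <;> simp [h] } 1 (by
    intro w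
    rw [one_mul, BoundedContinuousFunction.norm_le (norm_nonneg _)]
    intro n
    simp only [LinearMap.coe_mk, AddHom.coe_mk,
      BoundedContinuousFunction.coe_ofNormedAddCommGroupDiscrete]
    split_ifs
    · exact w.norm_coe_le_norm _
    · simp)

theorem shift_apply (k : ℕ) (w : ℕ →ᵇ B) (n : ℕ) :
    shift k w n = if k ≤ n + 1 then w (n + 1 - k) else 0 := rfl

/-- Multiplication of the `n`-th term of a sequence by `c ^ n`, where `‖c‖ ≤ 1`. -/
noncomputable def scale (c : ℂ) (hc : ‖c‖ ≤ 1) : (ℕ →ᵇ B) →L[ℂ] (ℕ →ᵇ B) :=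
  LinearMap.mkContinuous
    { toFun := fun w => BoundedContinuousFunction.ofNormedAddCommGroupDiscrete
        (fun n => c ^ n • w n) ‖w‖ (fun n => by
          rw [norm_smul, norm_pow]
          exact (mul_le_of_le_one_left (norm_nonneg _) (pow_le_one₀ (norm_nonneg _) hc)).trans
            (w.norm_coe_le_norm _))
      map_add' := fun w w' => by ext n; simp
      map_smul' := fun a w => by ext n; simp [smul_smul, mul_comm] } 1 (by
    intro w
    rw [one_mul, BoundedContinuousFunction.norm_le (norm_nonneg _)]
    intro n
    simp only [LinearMap.coe_mk, AddHom.coe_mk,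
      BoundedContinuousFunction.coe_ofNormedAddCommGroupDiscrete]
    rw [norm_smul, norm_pow]
    exact (mul_le_of_le_one_left (norm_nonneg _) (pow_le_one₀ (norm_nonneg _) hc)).trans
      (w.norm_coe_le_norm _))

@[simp] theorem scale_apply (c : ℂ) (hc : ‖c‖ ≤ 1) (w : ℕ →ᵇ B) (n : ℕ) :
    scale c hc w n = c ^ n • w n := rfl

/-- The `n`-th term of a sequence. -/
noncomputable def term (n : ℕ) : (ℕ →ᵇ B) →L[ℂ] B := BoundedContinuousFunction.evalCLM ℂ n

@[simp] theorem term_apply (n : ℕ) (w : ℕ →ᵇ B) : term n w = w n := rfl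

theorem norm_term_le (n : ℕ) : ‖(term n : (ℕ →ᵇ B) →L[ℂ] B)‖ ≤ 1 :=
  ContinuousLinearMap.opNorm_le_bound _ zero_le_one fun w => by
    rw [one_mul]; exact w.norm_coe_le_norm n

/-- The sequence `1, 0, 0, …`. -/
noncomputable def one {B : Type*} [NormedRing B] : ℕ →ᵇ B :=
  BoundedContinuousFunction.ofNormedAddCommGroupDiscrete (fun n => if n = 0 then 1 else 0) ‖(1 : B)‖
    (fun n => by split_ifs <;> simp)

theorem one_apply {B : Type*} [NormedRing B] (n : ℕ) :
    (one : ℕ →ᵇ B) n = if n = 0 then 1 else 0 := rfl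

section

variable {E : Type*} [NormedAddCommGroup E] [NormedSpace ℂ E] {N : ℕ}

/-- The operator `w ↦ h⁻¹ (w (∑ a_k(v) h^k) - b(v) w)`, truncated to nonnegative powers of `h`, on
sequences of coefficients of power series in `h / c⁻¹`. -/
@[irreducible] noncomputable def gaugeOp (c : ℂ) :
    ((Fin (N + 1) → E →L[ℂ] B) × (E →L[ℂ] B)) →L[ℂ] E →L[ℂ] (ℕ →ᵇ B) →L[ℂ] (ℕ →ᵇ B) :=
  -- The weights come from the change of unknown w n ↦ c ^ n w n; the original system is c = 1 (see
  -- `scale_gaugeOp`).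
  ∑ k : Fin (N + 1), (c ^ (k : ℕ) * c⁻¹) •
    (ContinuousLinearMap.compL ℂ E B ((ℕ →ᵇ B) →L[ℂ] (ℕ →ᵇ B))
      ((ContinuousLinearMap.compL ℂ (ℕ →ᵇ B) (ℕ →ᵇ B) (ℕ →ᵇ B) (shift k)) ∘L mulRight)) ∘L
    ((ContinuousLinearMap.proj k : (Fin (N + 1) → E →L[ℂ] B) →L[ℂ] E →L[ℂ] B) ∘L
      ContinuousLinearMap.fst ℂ (Fin (N + 1) → E →L[ℂ] B) (E →L[ℂ] B)) -
  c⁻¹ • (ContinuousLinearMap.compL ℂ E B ((ℕ →ᵇ B) →L[ℂ] (ℕ →ᵇ B))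
      ((ContinuousLinearMap.compL ℂ (ℕ →ᵇ B) (ℕ →ᵇ B) (ℕ →ᵇ B) (shift 0)) ∘L mulLeft)) ∘L
    ContinuousLinearMap.snd ℂ (Fin (N + 1) → E →L[ℂ] B) (E →L[ℂ] B)

theorem gaugeOp_apply (c : ℂ) (z : (Fin (N + 1) → E →L[ℂ] B) × (E →L[ℂ] B)) (v : E)
    (w : ℕ →ᵇ B) (n : ℕ) : gaugeOp c z v w n =
      (∑ k : Fin (N + 1), (c ^ (k : ℕ) * c⁻¹) •
        (if (k : ℕ) ≤ n + 1 then w (n + 1 - k) * z.1 k v else 0)) - c⁻¹ • (z.2 v * w (n + 1)) := by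
  have h : gaugeOp c z v w = (∑ k : Fin (N + 1), (c ^ (k : ℕ) * c⁻¹) •
      shift k (mulRight (z.1 k v) w)) - c⁻¹ • shift 0 (mulLeft (z.2 v) w) := by
    simp [gaugeOp]
  rw [h]
  simp [shift_apply]

/-- The power series `∑ a_k(v) h^k`. -/
noncomputable def connSeries (a : Fin (N + 1) → E →L[ℂ] B) (v : E) : PowerSeries B :=
  ∑ k : Fin (N + 1), PowerSeries.C (a k v) * PowerSeries.X ^ (k : ℕ)

theorem coeff_mul_connSeries (φ : PowerSeries B) (a : Fin (N + 1) → E →L[ℂ] B) (v : E) (n : ℕ) :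
    PowerSeries.coeff n (φ * connSeries a v) =
      ∑ k : Fin (N + 1), if (k : ℕ) ≤ n then PowerSeries.coeff (n - k) φ * a k v else 0 := by
  rw [connSeries, Finset.mul_sum, map_sum]
  refine Finset.sum_congr rfl fun k _ => ?_
  rw [← mul_assoc, PowerSeries.coeff_mul_X_pow']
  simp

theorem coeff_zero_mul_connSeries (φ : PowerSeries B) (a : Fin (N + 1) → E →L[ℂ] B) (v : E) :
    PowerSeries.coeff 0 (φ * connSeries a v) = PowerSeries.coeff 0 φ * a 0 v := by
  rw [coeff_mul_connSeries, Finset.sum_eq_single 0]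
  · simp
  · intro k _ hk
    rw [if_neg]
    intro h
    exact hk (Fin.ext (by simpa using h))
  · simp

/-- Multiplication by `h` inverts the truncated division by `h`. -/
theorem X_mul_mk_gaugeOp (z : (Fin (N + 1) → E →L[ℂ] B) × (E →L[ℂ] B)) (v : E) (w : ℕ →ᵇ B) :
    PowerSeries.X * PowerSeries.mk (gaugeOp 1 z v w) =
      PowerSeries.mk w * connSeries z.1 v - PowerSeries.C (z.2 v) * PowerSeries.mk w -
        PowerSeries.C (w 0 * z.1 0 v - z.2 v * w 0) := by
  ext n
  cases n with
  | zero =>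
    rw [map_sub, map_sub, coeff_zero_mul_connSeries]
    simp
  | succ n =>
    rw [PowerSeries.coeff_succ_X_mul, PowerSeries.coeff_mk, map_sub, map_sub, coeff_mul_connSeries,
      gaugeOp_apply]
    simp

end

end CoeffSeq

/-! ### Flatness: from the radial equation to all directions -/

section Curvature

-- Here α, β are the connection in the directions u, v, and uh, vh the values of b; p, q and ph, qh
-- are their derivatives in the crossed directions. The equation holds exactly in direction u and
-- with defect ζ in direction v. Flatness removes p − q together with the products of α and β;
-- besides ζ only the curvature terms of b survive, which are not known to vanish.
open PowerSeries in
theorem PowerSeries.X_mul_X_mul_eq_of_flat {B : Type*} [Ring B]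
    {S ζ w wu wv α β p q : PowerSeries B}
    {uh vh ph qh : B}
    (h1 : X * wu = w * α - C uh * w) (h2 : X * wv = X * ζ + w * β - C vh * w)
    (hS : X * S = -((w * p - C ph * w) + (wu * β - C vh * wu) - (w * q - C qh * w) -
      (wv * α - C uh * wv)))
    (hflat : X * (p - q) + (α * β - β * α) = 0) :
    X * (X * S) = X * (ζ * α - C uh * ζ + C (ph - qh) * w) + C (uh * vh - vh * uh) * w := by
  have hX : ∀ y z : PowerSeries B, X * (y * z) = y * (X * z) := fun y z => by
    rw [← mul_assoc, ← mul_assoc, (commute_X y).eq]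
  have e1 : X * (w * p) - X * (w * q) = -(w * α * β) + w * β * α := by
    have : X * (p - q) = -(α * β - β * α) := eq_neg_of_add_eq_zero_left hflat
    rw [hX, hX, ← mul_sub, ← mul_sub, this]; noncomm_ring
  have e2 : X * (wu * β) = w * α * β - C uh * w * β := by rw [← mul_assoc, h1, sub_mul]
  have e3 : X * (C vh * wu) = C vh * w * α - C vh * C uh * w := by rw [hX, h1]; noncomm_ring
  have e4 : X * (wv * α) = X * (ζ * α) + w * β * α - C vh * w * α := by
    rw [← mul_assoc, h2]; noncomm_ring
  have e5 : X * (C uh * wv) = X * (C uh * ζ) + C uh * w * β - C uh * C vh * w := by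
    rw [hX, h2, hX]; noncomm_ring
  rw [hS]
  simp only [map_sub, map_mul, mul_neg, mul_sub, mul_add, sub_mul] at *
  rw [e2, e3, e4, e5]
  have e1' : X * (w * p) = X * (w * q) - w * α * β + w * β * α := by
    rw [sub_eq_iff_eq_add] at e1; rw [e1]; abel
  rw [e1']
  abel

-- The curvature of b is read off from constant terms. The first forces uh and vh to commute, since
-- the constant term of w has a right inverse; after cancelling X, the next expresses ph − qh
-- through ζ. What remains is linear in ζ.
open PowerSeries in
theorem PowerSeries.coeff_eq_of_flat {B : Type*} [Ring B] {S ζ w wu wv α β p q : PowerSeries B}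
    {uh vh ph qh w' : B} (hw : coeff 0 w * w' = 1)
    (h1 : X * wu = w * α - C uh * w) (h2 : X * wv = X * ζ + w * β - C vh * w)
    (hS : X * S = -((w * p - C ph * w) + (wu * β - C vh * wu) - (w * q - C qh * w) -
      (wv * α - C uh * wv)))
    (hflat : X * (p - q) + (α * β - β * α) = 0) (n : ℕ) :
    coeff n S = coeff (n + 1) (ζ * α) - uh * coeff (n + 1) ζ -
      (coeff 0 (ζ * α) - uh * coeff 0 ζ) * w' * coeff (n + 1) w := by
  have h := PowerSeries.X_mul_X_mul_eq_of_flat h1 h2 hS hflat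
  have h0 : uh * vh - vh * uh = 0 := by
    have := congrArg (coeff 0) h
    rw [map_add, coeff_zero_X_mul, coeff_zero_X_mul, zero_add, coeff_C_mul] at this
    have h3 := congrArg (· * w') this
    simp only [zero_mul, mul_assoc, hw, mul_one] at h3
    exact h3.symm
  rw [h0, map_zero, zero_mul, add_zero] at h
  have hc : ∀ m, coeff m (X * S) = coeff m (ζ * α) - uh * coeff m ζ + (ph - qh) * coeff m w := by
    intro m
    have := congrArg (coeff (m + 1)) h
    rw [coeff_succ_X_mul, coeff_succ_X_mul] at this
    rw [this, map_add, map_sub, coeff_C_mul, coeff_C_mul]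
  have hk : ph - qh = -((coeff 0 (ζ * α) - uh * coeff 0 ζ) * w') := by
    have h3 := hc 0
    rw [coeff_zero_X_mul] at h3
    have h4 := congrArg (· * w') h3.symm
    simp only [zero_mul, add_mul _ _ w', mul_assoc (ph - qh), hw, mul_one] at h4
    exact eq_neg_of_add_eq_zero_right h4
  have h5 := hc (n + 1)
  rw [coeff_succ_X_mul] at h5
  rw [h5, hk]
  noncomm_ring

end Curvature

namespace CoeffSeq

variable {B : Type*} [NormedRing B] [NormedAlgebra ℂ B]
  {E : Type*} [NormedAddCommGroup E] [NormedSpace ℂ E] {N : ℕ}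

theorem norm_coeff_mul_connSeries_le (ζ : ℕ →ᵇ B) (a : Fin (N + 1) → E →L[ℂ] B) (v : E) (n : ℕ) :
    ‖PowerSeries.coeff n (PowerSeries.mk ζ * connSeries a v)‖ ≤ ‖ζ‖ * ((N + 1) * (‖a‖ * ‖v‖)) := by
  rw [coeff_mul_connSeries]
  refine (norm_sum_le _ _).trans ?_
  have : ∀ k ∈ (Finset.univ : Finset (Fin (N + 1))),
      ‖(if (k : ℕ) ≤ n then PowerSeries.coeff (n - k) (PowerSeries.mk ζ) * a k v else 0)‖ ≤
        ‖ζ‖ * (‖a‖ * ‖v‖) := by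
    intro k _
    split_ifs
    · rw [PowerSeries.coeff_mk]
      refine (norm_mul_le _ _).trans ?_
      gcongr
      · exact ζ.norm_coe_le_norm _
      · refine ((a k).le_opNorm v).trans ?_
        gcongr
        exact norm_le_pi_norm a k
    · rw [norm_zero]; positivity
  refine (Finset.sum_le_card_nsmul _ _ _ this).trans_eq ?_
  simp
  ring

/-- The factor ‖u‖ is kept apart because u will be the radial vector: at t x it supplies the factor
t that the Grönwall argument needs. The number N + 2 counts the N + 1 connection terms and the term
with b. -/
theorem norm_le_of_flat {S ζ w wu wv : ℕ →ᵇ B} {p q : PowerSeries B}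
    {z : (Fin (N + 1) → E →L[ℂ] B) × (E →L[ℂ] B)} {u v : E} {ph qh w' : B} (hw : w 0 * w' = 1)
    (h1 : PowerSeries.X * PowerSeries.mk wu =
      PowerSeries.mk w * connSeries z.1 u - PowerSeries.C (z.2 u) * PowerSeries.mk w)
    (h2 : PowerSeries.X * PowerSeries.mk wv = PowerSeries.X * PowerSeries.mk ζ +
      PowerSeries.mk w * connSeries z.1 v - PowerSeries.C (z.2 v) * PowerSeries.mk w)
    (hS : PowerSeries.X * PowerSeries.mk S =
      -((PowerSeries.mk w * p - PowerSeries.C ph * PowerSeries.mk w) +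
        (PowerSeries.mk wu * connSeries z.1 v - PowerSeries.C (z.2 v) * PowerSeries.mk wu) -
        (PowerSeries.mk w * q - PowerSeries.C qh * PowerSeries.mk w) -
        (PowerSeries.mk wv * connSeries z.1 u - PowerSeries.C (z.2 u) * PowerSeries.mk wv)))
    (hflat : PowerSeries.X * (p - q) +
      (connSeries z.1 u * connSeries z.1 v - connSeries z.1 v * connSeries z.1 u) = 0) :
    ‖S‖ ≤ ((N + 2) * ‖z‖ * (1 + ‖w'‖ * ‖w‖)) * ‖u‖ * ‖ζ‖ := by
  rw [BoundedContinuousFunction.norm_le (by positivity)]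
  intro n
  have hn := PowerSeries.coeff_eq_of_flat (w' := w') (by simpa using hw) h1 h2 hS hflat n
  rw [PowerSeries.coeff_mk] at hn
  have hT : ∀ m, ‖PowerSeries.coeff m (PowerSeries.mk ζ * connSeries z.1 u) -
      z.2 u * PowerSeries.coeff m (PowerSeries.mk ζ)‖ ≤ (N + 2) * ‖z‖ * ‖u‖ * ‖ζ‖ := by
    intro m
    refine (norm_sub_le _ _).trans ?_
    have e1 := norm_coeff_mul_connSeries_le ζ z.1 u m
    have e2 : ‖z.2 u * PowerSeries.coeff m (PowerSeries.mk ζ)‖ ≤ ‖z‖ * ‖u‖ * ‖ζ‖ := by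
      refine (norm_mul_le _ _).trans ?_
      rw [PowerSeries.coeff_mk]
      gcongr
      · exact (z.2.le_opNorm u).trans (by gcongr; exact norm_snd_le z)
      · exact ζ.norm_coe_le_norm _
    have e3 : ‖ζ‖ * ((N + 1) * (‖z.1‖ * ‖u‖)) ≤ ‖ζ‖ * ((N + 1) * (‖z‖ * ‖u‖)) := by
      gcongr; exact norm_fst_le z
    linarith
  rw [hn]
  refine (norm_sub_le _ _).trans ?_
  have e4 : ‖(PowerSeries.coeff 0 (PowerSeries.mk ζ * connSeries z.1 u) -
      z.2 u * PowerSeries.coeff 0 (PowerSeries.mk ζ)) * w' *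
        PowerSeries.coeff (n + 1) (PowerSeries.mk w)‖ ≤
      (N + 2) * ‖z‖ * ‖u‖ * ‖ζ‖ * ‖w'‖ * ‖w‖ := by
    refine (norm_mul_le _ _).trans ?_
    rw [PowerSeries.coeff_mk (n + 1)]
    gcongr
    · refine (norm_mul_le _ _).trans ?_
      gcongr
      exact hT 0
    · exact w.norm_coe_le_norm _
  have := hT (n + 1)
  linarith

end CoeffSeq

theorem exists_hasFDerivAt_trilinear {E Z W : Type*} [NormedAddCommGroup E] [NormedSpace ℂ E]
    [NormedAddCommGroup Z] [NormedSpace ℂ Z] [NormedAddCommGroup W] [NormedSpace ℂ W]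
    (ev : Z →L[ℂ] E →L[ℂ] W →L[ℂ] W) {a : E → Z} {g : E → E} {G : E → W} {x : E}
    {a' : E →L[ℂ] Z} {g' : E →L[ℂ] E} {G' : E →L[ℂ] W} (ha : HasFDerivAt a a' x)
    (hg : HasFDerivAt g g' x) (hG : HasFDerivAt G G' x) :
    ∃ L : E →L[ℂ] W, HasFDerivAt (fun y => ev (a y) (g y) (G y)) L x ∧
      ∀ u, L u = ev (a' u) (g x) (G x) + ev (a x) (g' u) (G x) + ev (a x) (g x) (G' u) := by
  refine ⟨_, ((ev.hasFDerivAt.comp x ha).clm_apply hg).clm_apply hG, fun u => ?_⟩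
  simp
  abel

namespace CoeffSeq

theorem mk_add {B : Type*} [NormedRing B] (w w' : ℕ →ᵇ B) :
    PowerSeries.mk (w + w') = PowerSeries.mk w + PowerSeries.mk w' := by ext; simp

theorem mk_sub {B : Type*} [NormedRing B] (w w' : ℕ →ᵇ B) :
    PowerSeries.mk (w - w') = PowerSeries.mk w - PowerSeries.mk w' := by ext; simp

theorem mk_neg {B : Type*} [NormedRing B] (w : ℕ →ᵇ B) :
    PowerSeries.mk (-w) = -PowerSeries.mk w := by ext; simp

variable {B : Type*} [NormedRing B] [NormedAlgebra ℂ B]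
  {E : Type*} [NormedAddCommGroup E] [NormedSpace ℂ E] {N : ℕ}

/-- `X_mul_mk_gaugeOp` carries a constant correction. It vanishes at a solution, but not for each
differentiated factor separately; the derivative of the relation G_0 a_0 = b G_0 makes these
corrections cancel in pairs. -/
theorem fderiv_leading_relation {a : E → (Fin (N + 1) → E →L[ℂ] B) × (E →L[ℂ] B)}
    {G : E → ℕ →ᵇ B} {y : E} (ha : DifferentiableAt ℂ a y) (hG : DifferentiableAt ℂ G y)
    (hQ : ∀ᶠ x in 𝓝 y, ∀ v, G x 0 * (a x).1 0 v = (a x).2 v * G x 0) (u e : E) :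
    (fderiv ℂ G y u) 0 * (a y).1 0 e + G y 0 * (fderiv ℂ a y u).1 0 e -
      ((fderiv ℂ a y u).2 e * G y 0 + (a y).2 e * (fderiv ℂ G y u) 0) = 0 := by
  have hG0 : HasFDerivAt (fun y => term 0 (G y)) (term 0 ∘L fderiv ℂ G y) y :=
    ((term 0 : (ℕ →ᵇ B) →L[ℂ] B).hasFDerivAt (x := G y)).comp y hG.hasFDerivAt
  let ℓ₁ : ((Fin (N + 1) → E →L[ℂ] B) × (E →L[ℂ] B)) →L[ℂ] B :=
    ContinuousLinearMap.apply ℂ B e ∘L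
    (ContinuousLinearMap.proj 0 : (Fin (N + 1) → E →L[ℂ] B) →L[ℂ] E →L[ℂ] B) ∘L
      ContinuousLinearMap.fst ℂ (Fin (N + 1) → E →L[ℂ] B) (E →L[ℂ] B)
  let ℓ₂ : ((Fin (N + 1) → E →L[ℂ] B) × (E →L[ℂ] B)) →L[ℂ] B :=
    ContinuousLinearMap.apply ℂ B e ∘L
      ContinuousLinearMap.snd ℂ (Fin (N + 1) → E →L[ℂ] B) (E →L[ℂ] B)
  have h1 : HasFDerivAt (fun y => (a y).1 0 e) (ℓ₁ ∘L fderiv ℂ a y) y :=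
    ℓ₁.hasFDerivAt.comp y ha.hasFDerivAt
  have h2 : HasFDerivAt (fun y => (a y).2 e) (ℓ₂ ∘L fderiv ℂ a y) y :=
    ℓ₂.hasFDerivAt.comp y ha.hasFDerivAt
  have h3 := (hG0.mul' h1).sub (h2.mul' hG0)
  have h4 : HasFDerivAt ((fun y => term 0 (G y)) * (fun y => (a y).1 0 e) -
      (fun y => (a y).2 e) * (fun y => term 0 (G y))) (0 : E →L[ℂ] B) y :=
    (hasFDerivAt_const (0 : B) y).congr_of_eventuallyEq
      (hQ.mono fun y' hy' => sub_eq_zero.2 (hy' e))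
  have h5 := DFunLike.congr_fun (h3.unique h4) u
  simp [ℓ₁, ℓ₂] at h5
  rw [← h5]
  abel

set_option maxHeartbeats 1000000 in
/-- For a flat connection, a solution of the gauge equation along rays is a solution in all
directions. -/
theorem fderiv_eq_gaugeOp_of_radial [CompleteSpace B] {r : ENNReal}
    {a : E → (Fin (N + 1) → E →L[ℂ] B) × (E →L[ℂ] B)} {G : E → ℕ →ᵇ B}
    (ha : AnalyticOnNhd ℂ a (Metric.eball 0 r)) (hG : AnalyticOnNhd ℂ G (Metric.eball 0 r))
    (hrad : ∀ x ∈ Metric.eball (0 : E) r, fderiv ℂ G x x = gaugeOp 1 (a x) x (G x))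
    (hQ : ∀ x ∈ Metric.eball (0 : E) r, ∀ v, G x 0 * (a x).1 0 v = (a x).2 v * G x 0)
    (hU : ∀ x ∈ Metric.eball (0 : E) r, IsUnit (G x 0))
    (hflat : ∀ x ∈ Metric.eball (0 : E) r, ∀ u v,
      PowerSeries.X * (connSeries (fderiv ℂ a x u).1 v - connSeries (fderiv ℂ a x v).1 u) +
        (connSeries (a x).1 u * connSeries (a x).1 v -
          connSeries (a x).1 v * connSeries (a x).1 u) = 0) :
    ∀ x ∈ Metric.eball (0 : E) r, ∀ v, fderiv ℂ G x v = gaugeOp 1 (a x) v (G x) := by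
  intro x hx v
  rw [← sub_eq_zero]
  -- The defect of the equation in the fixed direction v.
  set Y : E → ℕ →ᵇ B := fun y => fderiv ℂ G y v - gaugeOp 1 (a y) v (G y) with hY
  have hball : ∀ y ∈ Metric.eball (0 : E) r, Metric.eball (0 : E) r ∈ 𝓝 y := fun y hy =>
    Metric.isOpen_eball.mem_nhds hy
  have hDG : ∀ y ∈ Metric.eball (0 : E) r, HasFDerivAt (fderiv ℂ G) (fderiv ℂ (fderiv ℂ G) y) y :=
    fun y hy => (hG y hy).fderiv.differentiableAt.hasFDerivAt
  have hYd : ∀ y ∈ Metric.eball (0 : E) r, ∃ L : E →L[ℂ] ℕ →ᵇ B, HasFDerivAt Y L y ∧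
      ∀ u, L u = fderiv ℂ (fderiv ℂ G) y u v - (gaugeOp 1 (fderiv ℂ a y u) v (G y) +
        gaugeOp 1 (a y) v (fderiv ℂ G y u)) := by
    intro y hy
    obtain ⟨L, hL, hLu⟩ := exists_hasFDerivAt_trilinear (gaugeOp 1)
      (ha y hy).differentiableAt.hasFDerivAt (hasFDerivAt_const v y)
      (hG y hy).differentiableAt.hasFDerivAt
    refine ⟨_, ((hDG y hy).clm_apply (hasFDerivAt_const v y)).sub hL, fun u => ?_⟩
    simp [hLu]
  have hbound : ∀ y ∈ Metric.eball (0 : E) r, ‖fderiv ℂ Y y y + Y y‖ ≤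
      ((N + 2) * ‖a y‖ * (1 + ‖Ring.inverse (G y 0)‖ * ‖G y‖)) * ‖y‖ * ‖Y y‖ := by
    intro y hy
    have hzero : ∀ y ∈ Metric.eball (0 : E) r, ∀ e, G y 0 * (a y).1 0 e - (a y).2 e * G y 0 = 0 :=
      fun y hy e => sub_eq_zero.2 (hQ y hy e)
    have hQd := fderiv_leading_relation (ha y hy).differentiableAt (hG y hy).differentiableAt
      (Filter.eventually_of_mem (hball y hy) fun y' hy' => hQ y' hy')
    have hmul : ∀ e, PowerSeries.X * PowerSeries.mk (gaugeOp 1 (a y) e (G y)) =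
        PowerSeries.mk (G y) * connSeries (a y).1 e -
          PowerSeries.C ((a y).2 e) * PowerSeries.mk (G y) := by
      intro e
      rw [X_mul_mk_gaugeOp, hzero y hy e, map_zero, sub_zero]
    -- the derivative of the radial equation
    have hrd : fderiv ℂ (fderiv ℂ G) y v y + fderiv ℂ G y v -
        (gaugeOp 1 (a y) y (fderiv ℂ G y v) +
          (gaugeOp 1 (a y) v (G y) + gaugeOp 1 (fderiv ℂ a y v) y (G y))) = 0 := by
      have h1 : HasFDerivAt (fun y => fderiv ℂ G y y - gaugeOp 1 (a y) y (G y)) (0 : E →L[ℂ] _) y :=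
        (hasFDerivAt_const (0 : ℕ →ᵇ B) y).congr_of_eventuallyEq
          (Filter.eventually_of_mem (hball y hy) fun y' hy' => sub_eq_zero.2 (hrad y' hy'))
      have h2 := (hDG y hy).clm_apply (hasFDerivAt_id y)
      obtain ⟨L, hL, hLu⟩ := exists_hasFDerivAt_trilinear (gaugeOp 1)
        (ha y hy).differentiableAt.hasFDerivAt (hasFDerivAt_id y)
        (hG y hy).differentiableAt.hasFDerivAt
      have h5 := DFunLike.congr_fun ((h2.sub hL).unique h1) v
      simp [hLu] at h5
      rw [← h5]
      abel
    -- Symmetry replaces D²G(y, v) by D²G(v, y), which the differentiated radial equation controls.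
    -- Differentiating the vector y itself there produces exactly Y y, whence the sum DY(y) y + Y y.
    have hsymm : fderiv ℂ (fderiv ℂ G) y y v = fderiv ℂ (fderiv ℂ G) y v y :=
      (hG y hy).contDiffAt.isSymmSndFDerivAt_of_omega y v
    refine norm_le_of_flat (S := fderiv ℂ Y y y + Y y) (ζ := Y y) (w := G y) (z := a y)
      (wu := fderiv ℂ G y y) (wv := fderiv ℂ G y v) (u := y) (v := v)
      (p := connSeries (fderiv ℂ a y y).1 v) (q := connSeries (fderiv ℂ a y v).1 y)
      (ph := (fderiv ℂ a y y).2 v) (qh := (fderiv ℂ a y v).2 y)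
      (Ring.mul_inverse_cancel _ (hU y hy)) ?_ ?_ ?_ (hflat y hy y v)
    · rw [hrad y hy, hmul]
    · have h1 : fderiv ℂ G y v = Y y + gaugeOp 1 (a y) v (G y) := by simp [hY]
      rw [h1, mk_add, mul_add, hmul]
      abel
    · have h1 : fderiv ℂ Y y y + Y y = -(gaugeOp 1 (fderiv ℂ a y y) v (G y) +
          gaugeOp 1 (a y) v (fderiv ℂ G y y) - gaugeOp 1 (fderiv ℂ a y v) y (G y) -
          gaugeOp 1 (a y) y (fderiv ℂ G y v)) := by
        obtain ⟨L, hL, hLu⟩ := hYd y hy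
        rw [hL.fderiv, hLu, hsymm]
        simp only [hY]
        rw [← sub_eq_zero, ← hrd]
        abel
      rw [h1, mk_neg, mk_sub, mk_sub, mk_add, mul_neg, mul_sub, mul_sub, mul_add,
        X_mul_mk_gaugeOp, X_mul_mk_gaugeOp, X_mul_mk_gaugeOp, X_mul_mk_gaugeOp]
      have e1 := hQd y v
      have e2 := hQd v y
      have e1' : PowerSeries.C (G y 0 * (fderiv ℂ a y y).1 0 v - (fderiv ℂ a y y).2 v * G y 0) +
          PowerSeries.C ((fderiv ℂ G y y) 0 * (a y).1 0 v -
            (a y).2 v * (fderiv ℂ G y y) 0) = 0 := by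
        rw [← map_add, ← map_zero PowerSeries.C, ← e1]; congr 1; abel
      have e2' : PowerSeries.C (G y 0 * (fderiv ℂ a y v).1 0 y - (fderiv ℂ a y v).2 y * G y 0) +
          PowerSeries.C ((fderiv ℂ G y v) 0 * (a y).1 0 y -
            (a y).2 y * (fderiv ℂ G y v) 0) = 0 := by
        rw [← map_add, ← map_zero PowerSeries.C, ← e2]; congr 1; abel
      have e3 := eq_neg_of_add_eq_zero_left e1'
      have e4 := eq_neg_of_add_eq_zero_left e2'
      rw [e3, e4]
      abel
  obtain ⟨c, hc, hcb⟩ := exists_norm_radial_le (x := x)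
    (f := fun y => (N + 2) * ‖a y‖ * (1 + ‖Ring.inverse (G y 0)‖ * ‖G y‖)) fun t ht => by
      have hy := smul_mem_eball hx ht
      have h1 : ContinuousAt (fun y => G y 0) ((t : ℂ) • x) :=
        ((term 0).continuous.continuousAt).comp (hG _ hy).continuousAt
      have h2 : ContinuousAt (fun y => Ring.inverse (G y 0)) ((t : ℂ) • x) :=
        ContinuousAt.comp (f := fun y => G y 0) (g := Ring.inverse)
          (NormedRing.inverse_continuousAt (hU _ hy).unit) h1
      exact (continuousAt_const.mul (ha _ hy).continuousAt.norm).mul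
        (continuousAt_const.add (h2.norm.mul (hG _ hy).continuousAt.norm))
  refine eq_zero_of_norm_fderiv_radial_add_le (Y := Y) (c := c * ‖x‖)
    (fun t ht => (hYd _ (smul_mem_eball hx ht)).choose_spec.1.differentiableAt) fun t ht => ?_
  refine (hbound _ (smul_mem_eball hx ht)).trans ?_
  have h1 := (le_abs_self _).trans (hcb t ht)
  have h2 : ‖(t : ℂ) • x‖ = t * ‖x‖ := by
    rw [norm_smul, Complex.norm_real, Real.norm_of_nonneg ht.1]
  have ht0 := ht.1
  rw [h2]
  calc _ ≤ c * (t * ‖x‖) * ‖Y ((t : ℂ) • x)‖ := by gcongr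
    _ = _ := by ring

end CoeffSeq

/-! ### Summing the power series in h -/

theorem HasSum.congr_terms {V : Type*} [AddCommMonoid V] [TopologicalSpace V] {f g : ℕ → V} {a : V}
    (h : HasSum f a) (hfg : ∀ n, g n = f n) : HasSum g a := by
  rwa [show g = f from funext hfg]

theorem HasSum.clm_apply_const {W V : Type*} [NormedAddCommGroup W] [NormedSpace ℂ W]
    [NormedAddCommGroup V] [NormedSpace ℂ V] {f : ℕ → W →L[ℂ] V} {L : W →L[ℂ] V}
    (h : HasSum f L) (w : W) : HasSum (fun n => f n w) (L w) :=
  (ContinuousLinearMap.apply ℂ V w).hasSum h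

namespace CoeffSeq

variable {B : Type*} [NormedRing B] [NormedAlgebra ℂ B]

theorem norm_pow_smul_term_le (n : ℕ) {c : ℂ} (hc : c ∈ Metric.ball (0 : ℂ) (1 / 2)) :
    ‖c ^ n • (term n : (ℕ →ᵇ B) →L[ℂ] B)‖ ≤ (1 / 2) ^ n := by
  rw [norm_smul, norm_pow]
  refine (mul_le_of_le_one_right (by positivity) (norm_term_le n)).trans ?_
  gcongr
  exact (mem_ball_zero_iff.1 hc).le

/-- The evaluation of power series with bounded coefficients. -/
@[irreducible] noncomputable def eval (c : ℂ) : (ℕ →ᵇ B) →L[ℂ] B := ∑' n, c ^ n • term n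

theorem hasSum_eval [CompleteSpace B] {c : ℂ} (hc : c ∈ Metric.ball (0 : ℂ) (1 / 2)) (w : ℕ →ᵇ B) :
    HasSum (fun n => c ^ n • w n) (eval c w) := by
  have h : Summable fun n => c ^ n • (term n : (ℕ →ᵇ B) →L[ℂ] B) :=
    Summable.of_norm_bounded summable_geometric_two fun n => norm_pow_smul_term_le n hc
  have h1 := h.hasSum.clm_apply_const w
  rw [eval]
  exact h1

theorem differentiableOn_eval [CompleteSpace B] :
    DifferentiableOn ℂ (eval : ℂ → (ℕ →ᵇ B) →L[ℂ] B) (Metric.ball 0 (1 / 2)) := by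
  have h : (eval : ℂ → (ℕ →ᵇ B) →L[ℂ] B) = fun c => ∑' n, c ^ n • term n := by
    funext c; rw [eval]
  rw [h]
  exact Complex.differentiableOn_tsum_of_summable_norm summable_geometric_two
    (fun n => ((differentiable_id.pow n).smul_const _).differentiableOn) Metric.isOpen_ball
    fun n _ hc => norm_pow_smul_term_le n hc

section

variable {E : Type*} [NormedAddCommGroup E] [NormedSpace ℂ E] {N : ℕ}

/-- If w solves the system with parameter c, then the sequence c⁻ⁿ w n solves the one with parameter
1; bounded solutions for large c therefore mean rapidly decaying solutions of the original system.
-/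
theorem scale_gaugeOp {c : ℂ} (hc0 : c ≠ 0) (hc : ‖c⁻¹‖ ≤ 1)
    (z : (Fin (N + 1) → E →L[ℂ] B) × (E →L[ℂ] B)) (v : E) (w : ℕ →ᵇ B) :
    scale c⁻¹ hc (gaugeOp c z v w) = gaugeOp 1 z v (scale c⁻¹ hc w) := by
  ext n
  rw [scale_apply, gaugeOp_apply, gaugeOp_apply, smul_sub, Finset.smul_sum]
  congr 1
  · refine Finset.sum_congr rfl fun k _ => ?_
    split_ifs with h
    · rw [scale_apply, smul_smul, smul_mul_assoc, smul_smul]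
      congr 1
      obtain ⟨m, hm⟩ := Nat.exists_eq_add_of_le h
      have h1 : n + 1 - k = m := by omega
      rw [h1]
      have h2 : c⁻¹ ^ n * c⁻¹ = c⁻¹ ^ (k : ℕ) * c⁻¹ ^ m := by rw [← pow_succ, hm, pow_add]
      calc c⁻¹ ^ n * (c ^ (k : ℕ) * c⁻¹) = c ^ (k : ℕ) * (c⁻¹ ^ n * c⁻¹) := by ring
        _ = (c * c⁻¹) ^ (k : ℕ) * c⁻¹ ^ m := by rw [h2, mul_pow]; ring
        _ = _ := by rw [mul_inv_cancel₀ hc0]; simp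
    · simp
  · rw [scale_apply, smul_smul, mul_smul_comm, smul_smul, ← pow_succ]
    simp

theorem hasSum_gaugeOp (z : (Fin (N + 1) → E →L[ℂ] B) × (E →L[ℂ] B)) (v : E) (w : ℕ →ᵇ B)
    {h : ℂ} (hh : h ≠ 0) {g : B} (hg : HasSum (fun n => h ^ n • w n) g)
    (h0 : w 0 * z.1 0 v = z.2 v * w 0) :
    HasSum (fun n => h ^ n • gaugeOp 1 z v w n)
      (h⁻¹ • (g * ∑ k : Fin (N + 1), h ^ (k : ℕ) • z.1 k v - z.2 v * g)) := by
  let s : ℕ → B := fun n => (∑ k : Fin (N + 1),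
    if (k : ℕ) ≤ n then h ^ n • (w (n - k) * z.1 k v) else 0) - z.2 v * (h ^ n • w n)
  have hs : HasSum s (g * ∑ k : Fin (N + 1), h ^ (k : ℕ) • z.1 k v - z.2 v * g) := by
    refine HasSum.sub ?_ (hg.mul_left _)
    rw [Finset.mul_sum]
    refine hasSum_sum fun k _ => ?_
    have hinj : Function.Injective (fun n : ℕ => n + (k : ℕ)) := add_left_injective _
    rw [← hinj.hasSum_iff]
    · have h1 := (hg.mul_right (z.1 k v)).const_smul (h ^ (k : ℕ))
      rw [mul_smul_comm]
      refine HasSum.congr_terms h1 fun n => ?_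
      simp only [Function.comp_apply, le_add_iff_nonneg_left, zero_le, if_true,
        Nat.add_sub_cancel]
      rw [smul_mul_assoc, smul_smul, pow_add, mul_comm]
    · intro n hn
      rw [if_neg]
      intro hkn
      exact hn ⟨n - k, by simp [hkn]⟩
  -- The relation h0 kills the coefficient of h⁻¹, so the truncation built into `gaugeOp` discards
  -- nothing.
  have hs0 : s 0 = 0 := by
    simp only [s]
    rw [Finset.sum_eq_single 0]
    · simp [h0]
    · intro k _ hk
      rw [if_neg]
      intro h'
      exact hk (Fin.ext (by simpa using h'))
    · simp
  have h1 := (hasSum_nat_add_iff' 1).2 hs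
  rw [Finset.sum_range_one, hs0, sub_zero] at h1
  have h2 := h1.const_smul h⁻¹
  refine HasSum.congr_terms h2 fun n => ?_
  rw [gaugeOp_apply]
  simp only [s, one_pow, inv_one, mul_one, one_smul]
  rw [smul_sub, smul_sub, Finset.smul_sum, Finset.smul_sum]
  have hp : h⁻¹ * h ^ (n + 1) = h ^ n := by
    rw [pow_succ, mul_comm, mul_assoc, mul_inv_cancel₀ hh, mul_one]
  congr 1
  · refine Finset.sum_congr rfl fun k _ => ?_
    split_ifs
    · rw [smul_smul, hp]
    · simp
  · rw [mul_smul_comm, smul_smul, hp]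

end

end CoeffSeq

/-! ### The local gauge transformation, entire in h -/

theorem AnalyticAt.flip_clm_apply {X E Z W : Type*} [NormedAddCommGroup X] [NormedSpace ℂ X]
    [NormedAddCommGroup E] [NormedSpace ℂ E] [NormedAddCommGroup Z] [NormedSpace ℂ Z]
    [NormedAddCommGroup W] [NormedSpace ℂ W] (ev : Z →L[ℂ] E →L[ℂ] W →L[ℂ] W)
    {z : X → Z} {w : X → W} {x : X} (hz : AnalyticAt ℂ z x) (hw : AnalyticAt ℂ w x) :
    AnalyticAt ℂ (fun y => (ev (z y)).flip (w y)) x := by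
  have h1 : AnalyticAt ℂ (fun y =>
      (ContinuousLinearMap.flipₗᵢ ℂ E W W).toContinuousLinearEquiv.toContinuousLinearMap
      (ev (z y))) x := AnalyticAt.const_clm_apply _ (AnalyticAt.const_clm_apply ev hz)
  exact h1.clm_apply hw

namespace CoeffSeq

variable {B : Type*} [NormedRing B] [NormedAlgebra ℂ B]
  {E : Type*} [NormedAddCommGroup E] [NormedSpace ℂ E] {N : ℕ}

/-- The form `q a₀ q⁻¹`. -/
noncomputable def conjForm (a : E →L[ℂ] B) (q : B) : E →L[ℂ] B :=
  ContinuousLinearMap.compL ℂ E B B (ContinuousLinearMap.mulLeftRight ℂ B q (Ring.inverse q)) a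

@[simp] theorem conjForm_apply (a : E →L[ℂ] B) (q : B) (v : E) :
    conjForm a q v = q * a v * Ring.inverse q := rfl

theorem analyticAt_conjForm [CompleteSpace B] {X : Type*} [NormedAddCommGroup X] [NormedSpace ℂ X]
    {a : X → E →L[ℂ] B} {q : X → B} {x : X} (ha : AnalyticAt ℂ a x) (hq : AnalyticAt ℂ q x)
    (hu : IsUnit (q x)) : AnalyticAt ℂ (fun y => conjForm (a y) (q y)) x := by
  have h1 : AnalyticAt ℂ (fun y => Ring.inverse (q y)) x :=
    AnalyticAt.comp (g := Ring.inverse) (f := q) (analyticAt_inverse (𝕜 := ℂ) hu.unit) hq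
  have h2 : AnalyticAt ℂ
      (fun y => ContinuousLinearMap.mulLeftRight ℂ B (q y) (Ring.inverse (q y))) x :=
    AnalyticAt.clm_apply (AnalyticAt.const_clm_apply (ContinuousLinearMap.mulLeftRight ℂ B) hq) h1
  have h3 : AnalyticAt ℂ (fun y => ContinuousLinearMap.compL ℂ E B B
      (ContinuousLinearMap.mulLeftRight ℂ B (q y) (Ring.inverse (q y)))) x :=
    AnalyticAt.const_clm_apply _ h2
  exact h3.clm_apply ha

/-- Substituting b = G_0 a_0 G_0⁻¹ closes the system. It becomes nonlinear, but stays analytic near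
`one`, where G_0 = 1 is invertible. -/
theorem exists_gauge_sequence [CompleteSpace B] [CompleteSpace E] {a : E → Fin (N + 1) → E →L[ℂ] B}
    (ha : AnalyticAt ℂ a 0) :
    ∃ G : E → ℕ →ᵇ B, AnalyticAt ℂ G 0 ∧ G 0 = one ∧ ∀ᶠ x in 𝓝 (0 : E),
      fderiv ℂ G x x = gaugeOp 1 (a x, conjForm (a x 0) (G x 0)) x (G x) := by
  let z : E × (ℕ →ᵇ B) → (Fin (N + 1) → E →L[ℂ] B) × (E →L[ℂ] B) := fun y =>
    (a y.1, conjForm (a y.1 0) (y.2 0))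
  have ha1 : AnalyticAt ℂ (fun y : E × (ℕ →ᵇ B) => a y.1) (0, one) :=
    AnalyticAt.comp (g := a) (f := Prod.fst) ha analyticAt_fst
  have hq : AnalyticAt ℂ (fun y : E × (ℕ →ᵇ B) => y.2 0) (0, one) :=
    AnalyticAt.comp (g := (term 0 : (ℕ →ᵇ B) →L[ℂ] B)) (f := Prod.snd)
      (x := ((0 : E), (one : ℕ →ᵇ B)))
      ((term 0 : (ℕ →ᵇ B) →L[ℂ] B).analyticAt _) analyticAt_snd
  have ha0 : AnalyticAt ℂ (fun y : E × (ℕ →ᵇ B) => a y.1 0) (0, one) :=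
    AnalyticAt.const_clm_apply
      (ContinuousLinearMap.proj 0 : (Fin (N + 1) → E →L[ℂ] B) →L[ℂ] E →L[ℂ] B) ha1
  have hz : AnalyticAt ℂ z (0, one) :=
    ha1.prod (analyticAt_conjForm ha0 hq (by simp [one_apply]))
  obtain ⟨G, hG, hG0, hGe⟩ := exists_radial_solution
    (AnalyticAt.flip_clm_apply (gaugeOp 1) hz analyticAt_snd)
  exact ⟨G, hG, hG0, hGe⟩

/-- The endomorphisms `S ↦ -(∑ h^{k-1} a_k(v)) S + h⁻¹ S b(v)`. -/
noncomputable def inverseOp (h : ℂ) :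
    ((Fin (N + 1) → E →L[ℂ] B) × (E →L[ℂ] B)) →L[ℂ] E →L[ℂ] B →L[ℂ] B :=
  h⁻¹ • (ContinuousLinearMap.compL ℂ E B (B →L[ℂ] B) (ContinuousLinearMap.mul ℂ B).flip ∘L
      ContinuousLinearMap.snd ℂ (Fin (N + 1) → E →L[ℂ] B) (E →L[ℂ] B)) -
  h⁻¹ • ∑ k : Fin (N + 1), h ^ (k : ℕ) •
    (ContinuousLinearMap.compL ℂ E B (B →L[ℂ] B) (ContinuousLinearMap.mul ℂ B)) ∘L
    ((ContinuousLinearMap.proj k : (Fin (N + 1) → E →L[ℂ] B) →L[ℂ] E →L[ℂ] B) ∘L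
      ContinuousLinearMap.fst ℂ (Fin (N + 1) → E →L[ℂ] B) (E →L[ℂ] B))

theorem inverseOp_apply (h : ℂ) (z : (Fin (N + 1) → E →L[ℂ] B) × (E →L[ℂ] B)) (v : E) (S : B) :
    inverseOp h z v S = h⁻¹ • (S * z.2 v) -
      h⁻¹ • ((∑ k : Fin (N + 1), h ^ (k : ℕ) • z.1 k v) * S) := by
  simp [inverseOp, Finset.sum_mul]

/-- The endomorphisms `P ↦ h⁻¹ (P b(v) - b(v) P)`. -/
noncomputable def commutatorOp (h : ℂ) : (E →L[ℂ] B) →L[ℂ] E →L[ℂ] B →L[ℂ] B :=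
  ContinuousLinearMap.compL ℂ E B (B →L[ℂ] B)
    (h⁻¹ • ((ContinuousLinearMap.mul ℂ B).flip - ContinuousLinearMap.mul ℂ B))

theorem commutatorOp_apply (h : ℂ) (b : E →L[ℂ] B) (v : E) (P : B) :
    commutatorOp h b v P = h⁻¹ • (P * b v - b v * P) := by
  simp [commutatorOp]

/-- S is taken to solve the linear equation that an inverse of g would satisfy. Then P = g S and the
constant 1 both solve dP = h⁻¹ (P b − b P) along rays with the same value at 0, so they agree. -/
theorem exists_right_inverse [CompleteSpace B]
    {z : E → (Fin (N + 1) → E →L[ℂ] B) × (E →L[ℂ] B)} {r : ENNReal}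
    {p : FormalMultilinearSeries ℂ E ((Fin (N + 1) → E →L[ℂ] B) × (E →L[ℂ] B))}
    (hz : HasFPowerSeriesOnBall z p 0 r) {h : ℂ} {g : E → B}
    (hg : AnalyticOnNhd ℂ g (Metric.eball 0 r)) (hg0 : g 0 = 1)
    (hge : ∀ x ∈ Metric.eball (0 : E) r, fderiv ℂ g x x =
      h⁻¹ • (g x * ∑ k : Fin (N + 1), h ^ (k : ℕ) • (z x).1 k x - (z x).2 x * g x)) :
    ∀ x ∈ Metric.eball (0 : E) r, ∃ S, g x * S = 1 := by
  obtain ⟨S, hS, hS0, hSe⟩ := exists_radial_solution_of_linear (inverseOp h) hz (1 : B)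
  have hz2 : ContinuousOn (fun x => (z x).2) (Metric.eball (0 : E) r) := fun x hx =>
    (hz.analyticOnNhd x hx).continuousAt.snd.continuousWithinAt
  have hmul : AnalyticOnNhd ℂ (fun x => g x * S x) (Metric.eball (0 : E) r) := fun x hx =>
    (hg x hx).mul (hS x hx)
  have key := eqOn_of_radial_linear (commutatorOp h) hz2 hmul
    (analyticOnNhd_const (v := (1 : B))) (by simp [hg0, hS0]) (fun x hx => ?_) (fun x hx => ?_)
  · exact fun x hx => ⟨S x, key hx⟩
  · have h1 := ((hg x hx).differentiableAt.hasFDerivAt.mul'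
      (hS x hx).differentiableAt.hasFDerivAt).fderiv
    have h2 := DFunLike.congr_fun h1 x
    rw [show fderiv ℂ (fun x => g x * S x) x = fderiv ℂ (g * S) x from rfl, h2]
    simp only [add_apply, smul_apply, MulOpposite.smul_eq_mul_unop, MulOpposite.unop_op,
      smul_eq_mul]
    rw [hge x hx, hSe x hx, inverseOp_apply, commutatorOp_apply]
    simp only [mul_sub, sub_mul, smul_sub, mul_smul_comm, smul_mul_assoc, mul_assoc]
    abel
  · rw [commutatorOp_apply]
    simp

end CoeffSeq

namespace CoeffSeq

variable {B : Type*} [NormedRing B] [NormedAlgebra ℂ B] [CompleteSpace B]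
  {E : Type*} [NormedAddCommGroup E] [NormedSpace ℂ E] {N : ℕ}

/-- With b frozen inside z the equation is linear, so the system with parameter R is solvable on the
same ball; by uniqueness its solution is the sequence Rⁿ G_n. Hence G_n = O(|R|⁻ⁿ) pointwise for
every admissible R, with no shrinking of the ball. -/
theorem exists_scale_eq {z : E → (Fin (N + 1) → E →L[ℂ] B) × (E →L[ℂ] B)} {r : ENNReal}
    {p : FormalMultilinearSeries ℂ E ((Fin (N + 1) → E →L[ℂ] B) × (E →L[ℂ] B))}
    (hz : HasFPowerSeriesOnBall z p 0 r) {G : E → ℕ →ᵇ B}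
    (hG : AnalyticOnNhd ℂ G (Metric.eball 0 r)) (hG0 : G 0 = one)
    (hrad : ∀ x ∈ Metric.eball (0 : E) r, fderiv ℂ G x x = gaugeOp 1 (z x) x (G x))
    {R : ℂ} (hR0 : R ≠ 0) (hR : ‖R⁻¹‖ ≤ 1) :
    ∃ H : E → ℕ →ᵇ B, AnalyticOnNhd ℂ H (Metric.eball 0 r) ∧ H 0 = one ∧
      ∀ x ∈ Metric.eball (0 : E) r, scale R⁻¹ hR (H x) = G x := by
  obtain ⟨H, hH, hH0, hHe⟩ := exists_radial_solution_of_linear (gaugeOp R) hz (one : ℕ →ᵇ B)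
  refine ⟨H, hH, hH0, ?_⟩
  have hsc : ∀ x ∈ Metric.eball (0 : E) r, HasFDerivAt (fun y => scale R⁻¹ hR (H y))
      ((scale R⁻¹ hR : (ℕ →ᵇ B) →L[ℂ] (ℕ →ᵇ B)).comp (fderiv ℂ H x)) x := fun x hx =>
    ((scale R⁻¹ hR : (ℕ →ᵇ B) →L[ℂ] (ℕ →ᵇ B)).hasFDerivAt (x := H x)).comp x
      (hH x hx).differentiableAt.hasFDerivAt
  refine eqOn_of_radial_linear (gaugeOp 1) (fun x hx =>
    (hz.analyticOnNhd x hx).continuousAt.continuousWithinAt)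
    (G := fun y => scale R⁻¹ hR (H y)) (H := G) ?_ hG ?_ ?_ hrad
  · exact fun x hx => ((scale R⁻¹ hR : (ℕ →ᵇ B) →L[ℂ] (ℕ →ᵇ B)).analyticAt (H x)).comp (hH x hx)
  · rw [hH0, hG0]
    ext n
    rw [scale_apply, one_apply]
    split_ifs with h
    · simp [h]
    · simp
  · intro x hx
    rw [(hsc x hx).fderiv]
    change scale R⁻¹ hR (fderiv ℂ H x x) = _
    rw [hHe x hx, scale_gaugeOp hR0 hR]

theorem hasSum_eval_div {R h : ℂ} (hR : ‖R⁻¹‖ ≤ 1)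
    (hh : h / R ∈ Metric.ball (0 : ℂ) (1 / 2)) (w : ℕ →ᵇ B) :
    HasSum (fun n => h ^ n • scale R⁻¹ hR w n) (eval (h / R) w) := by
  refine (hasSum_eval hh w).congr_terms fun n => ?_
  rw [scale_apply, smul_smul, div_eq_mul_inv, mul_pow]

theorem exists_radius (h : ℂ) :
    ∃ R : ℂ, R ≠ 0 ∧ ‖R⁻¹‖ ≤ 1 ∧ h / R ∈ Metric.ball (0 : ℂ) (1 / 2) := by
  have hpos : 0 < 2 * ‖h‖ + 1 := by positivity
  have hn : ‖((2 * ‖h‖ + 1 : ℝ) : ℂ)‖ = 2 * ‖h‖ + 1 := by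
    rw [Complex.norm_real, Real.norm_of_nonneg hpos.le]
  refine ⟨((2 * ‖h‖ + 1 : ℝ) : ℂ), by exact_mod_cast hpos.ne', ?_, ?_⟩
  · rw [norm_inv, hn]
    exact inv_le_one_of_one_le₀ (by linarith [norm_nonneg h])
  · rw [mem_ball_zero_iff, norm_div, hn, div_lt_iff₀ hpos]
    linarith [norm_nonneg h]

/-- A flat connection `d + h⁻¹ ∑ h^k a_k` is gauge equivalent, locally and by a gauge transformation
which is entire in `h`, to a connection of the form `d + h⁻¹ b`. -/
theorem exists_gauge [CompleteSpace E] {a : E → Fin (N + 1) → E →L[ℂ] B} (ha : AnalyticAt ℂ a 0)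
    (hflat : ∀ᶠ x in 𝓝 (0 : E), ∀ u v, PowerSeries.X * (connSeries (fderiv ℂ a x u) v -
      connSeries (fderiv ℂ a x v) u) + (connSeries (a x) u * connSeries (a x) v -
        connSeries (a x) v * connSeries (a x) u) = 0) :
    ∃ r : ENNReal, 0 < r ∧ ∃ G : E × ℂ → B,
      DifferentiableOn ℂ G (Metric.eball 0 r ×ˢ Set.univ) ∧
      (∀ x ∈ Metric.eball (0 : E) r, ∀ h, ∃ S, G (x, h) * S = 1) ∧
      (∀ x ∈ Metric.eball (0 : E) r, IsUnit (G (x, 0))) ∧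
      ∀ x ∈ Metric.eball (0 : E) r, ∀ h : ℂ, h ≠ 0 → ∀ v,
        fderiv ℂ (fun y => G (y, h)) x v = h⁻¹ • (G (x, h) *
          ∑ k : Fin (N + 1), h ^ (k : ℕ) • a x k v - conjForm (a x 0) (G (x, 0)) v * G (x, h)) := by
  obtain ⟨G, hG, hG0, hGe⟩ := exists_gauge_sequence ha
  have hQ : AnalyticAt ℂ (fun x => G x 0) 0 := ((term 0 : (ℕ →ᵇ B) →L[ℂ] B).analyticAt _).comp hG
  have hQ0 : G 0 0 = 1 := by simp [hG0, one_apply]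
  have hU : ∀ᶠ x in 𝓝 (0 : E), IsUnit (G x 0) :=
    hQ.continuousAt.eventually (by
      change ∀ᶠ y in 𝓝 (G 0 0), IsUnit y
      rw [hQ0]
      exact Units.nhds (1 : Bˣ))
  have ha0 : AnalyticAt ℂ (fun x => a x 0) 0 :=
    AnalyticAt.const_clm_apply
      (ContinuousLinearMap.proj 0 : (Fin (N + 1) → E →L[ℂ] B) →L[ℂ] E →L[ℂ] B) ha
  -- From here on b is a known analytic form, and the equation is treated as linear in G.
  let z : E → (Fin (N + 1) → E →L[ℂ] B) × (E →L[ℂ] B) := fun x => (a x, conjForm (a x 0) (G x 0))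
  have hz : AnalyticAt ℂ z 0 := ha.prod (analyticAt_conjForm ha0 hQ (by simp [hQ0]))
  obtain ⟨p, r₀, hp⟩ := hz
  obtain ⟨r₁, hr₁, hev⟩ := Metric.nhds_basis_eball.mem_iff.1
    (hG.eventually_analyticAt.and (hU.and (hGe.and hflat)))
  let r := min r₀ r₁
  have hr : 0 < r := lt_min hp.r_pos hr₁
  have hzr : HasFPowerSeriesOnBall z p 0 r := hp.mono hr (min_le_left _ _)
  have hev' : ∀ x ∈ Metric.eball (0 : E) r, _ := fun x hx =>
    hev (Metric.eball_subset_eball (min_le_right _ _) hx)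
  have hGr : AnalyticOnNhd ℂ G (Metric.eball 0 r) := fun x hx => (hev' x hx).1
  have hUr : ∀ x ∈ Metric.eball (0 : E) r, IsUnit (G x 0) := fun x hx => (hev' x hx).2.1
  have hrad : ∀ x ∈ Metric.eball (0 : E) r, fderiv ℂ G x x = gaugeOp 1 (z x) x (G x) :=
    fun x hx => (hev' x hx).2.2.1
  have hcomm : ∀ x ∈ Metric.eball (0 : E) r, ∀ v, G x 0 * (z x).1 0 v = (z x).2 v * G x 0 := by
    intro x hx v
    change G x 0 * a x 0 v = G x 0 * a x 0 v * Ring.inverse (G x 0) * G x 0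
    rw [mul_assoc _ _ (G x 0), Ring.inverse_mul_cancel _ (hUr x hx), mul_one]
  have hpde : ∀ x ∈ Metric.eball (0 : E) r, ∀ v, fderiv ℂ G x v = gaugeOp 1 (z x) v (G x) := by
    refine fderiv_eq_gaugeOp_of_radial (hzr.analyticOnNhd) hGr hrad hcomm hUr ?_
    intro x hx u v
    have hf : ∀ u, (fderiv ℂ z x u).1 = fderiv ℂ a x u := fun u =>
      (DFunLike.congr_fun (hzr.analyticOnNhd x hx).differentiableAt.hasFDerivAt.fst.fderiv u).symm
    rw [hf, hf]
    exact (hev' x hx).2.2.2 u v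
  have hopen : IsOpen (Metric.eball (0 : E) r) := Metric.isOpen_eball
  have h0mem : (0 : E) ∈ Metric.eball (0 : E) r := Metric.mem_eball_self hr
  let g : E × ℂ → B := fun y => ∑' n, y.2 ^ n • G y.1 n
  have hg0 : ∀ x, g (x, 0) = G x 0 := fun x => by
    refine (tsum_eq_single 0 fun n hn => ?_).trans (by simp)
    simp [hn]
  -- the local description of `g`
  have hloc : ∀ h : ℂ, ∃ R : ℂ, ∃ hR : ‖R⁻¹‖ ≤ 1, R ≠ 0 ∧ h / R ∈ Metric.ball (0 : ℂ) (1 / 2) ∧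
      ∃ H : E → ℕ →ᵇ B, AnalyticOnNhd ℂ H (Metric.eball 0 r) ∧ H 0 = one ∧
        (∀ x ∈ Metric.eball (0 : E) r, scale R⁻¹ hR (H x) = G x) ∧
        ∀ x ∈ Metric.eball (0 : E) r, ∀ h' : ℂ, h' / R ∈ Metric.ball (0 : ℂ) (1 / 2) →
          HasSum (fun n => h' ^ n • G x n) (g (x, h')) ∧ g (x, h') = eval (h' / R) (H x) := by
    intro h
    obtain ⟨R, hR0, hR, hh⟩ := exists_radius h
    obtain ⟨H, hH, hH0, hHG⟩ := exists_scale_eq hzr hGr hG0 hrad hR0 hR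
    refine ⟨R, hR, hR0, hh, H, hH, hH0, hHG, fun x hx h' hh' => ?_⟩
    have hs := hasSum_eval_div hR hh' (H x)
    rw [hHG x hx] at hs
    exact ⟨hs.summable.hasSum, hs.tsum_eq⟩
  have hgpde : ∀ x ∈ Metric.eball (0 : E) r, ∀ h : ℂ, h ≠ 0 → ∀ v,
      fderiv ℂ (fun y => g (y, h)) x v = h⁻¹ • (g (x, h) *
        ∑ k : Fin (N + 1), h ^ (k : ℕ) • a x k v - (z x).2 v * g (x, h)) := by
    intro x hx h hh v
    obtain ⟨R, hR, hR0, hhR, H, hH, hH0, hHG, hsum⟩ := hloc h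
    have h1 : (fun y => g (y, h)) =ᶠ[𝓝 x] fun y => eval (h / R) (H y) := by
      filter_upwards [hopen.mem_nhds hx] with y hy
      exact (hsum y hy h hhR).2
    have h2 : HasFDerivAt (fun y => eval (h / R) (H y))
        ((eval (h / R) : (ℕ →ᵇ B) →L[ℂ] B).comp (fderiv ℂ H x)) x :=
      ((eval (h / R) : (ℕ →ᵇ B) →L[ℂ] B).hasFDerivAt (x := H x)).comp x
        (hH x hx).differentiableAt.hasFDerivAt
    have h3 : HasFDerivAt (fun y => scale R⁻¹ hR (H y))
        ((scale R⁻¹ hR : (ℕ →ᵇ B) →L[ℂ] (ℕ →ᵇ B)).comp (fderiv ℂ H x)) x :=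
      ((scale R⁻¹ hR : (ℕ →ᵇ B) →L[ℂ] (ℕ →ᵇ B)).hasFDerivAt (x := H x)).comp x
        (hH x hx).differentiableAt.hasFDerivAt
    -- Rescaling is a continuous linear map, so it commutes with the derivative; this replaces a
    -- termwise differentiation of the series in h.
    have h4 : scale R⁻¹ hR (fderiv ℂ H x v) = fderiv ℂ G x v := by
      have h5 : (fun y => scale R⁻¹ hR (H y)) =ᶠ[𝓝 x] G := by
        filter_upwards [hopen.mem_nhds hx] with y hy
        exact hHG y hy
      rw [← h5.fderiv_eq, h3.fderiv]
      rfl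
    rw [h1.fderiv_eq, h2.fderiv]
    change eval (h / R) (fderiv ℂ H x v) = _
    have h6 := hasSum_eval_div hR hhR (fderiv ℂ H x v)
    rw [h4, hpde x hx v] at h6
    exact h6.unique (hasSum_gaugeOp (z x) v (G x) hh (hsum x hx h hhR).1 (hcomm x hx v))
  refine ⟨r, hr, g, ?_, ?_, ?_, ?_⟩
  · rintro ⟨x, h⟩ ⟨hx, -⟩
    obtain ⟨R, hR, hR0, hhR, H, hH, hH0, hHG, hsum⟩ := hloc h
    refine DifferentiableAt.differentiableWithinAt ?_
    have hcont : ContinuousAt (fun y : E × ℂ => y.2 / R) (x, h) := by fun_prop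
    -- One R serves for all parameters near h, which gives joint holomorphy in the point and h.
    have h1 : g =ᶠ[𝓝 (x, h)] fun y => eval (y.2 / R) (H y.1) := by
      filter_upwards [continuousAt_fst.preimage_mem_nhds (hopen.mem_nhds hx),
        hcont.preimage_mem_nhds (Metric.isOpen_ball.mem_nhds hhR)] with y hy1 hy2
      exact (hsum y.1 hy1 y.2 hy2).2
    refine DifferentiableAt.congr_of_eventuallyEq ?_ h1
    have h2 : DifferentiableAt ℂ (fun y : E × ℂ => (eval (y.2 / R) : (ℕ →ᵇ B) →L[ℂ] B)) (x, h) :=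
      DifferentiableAt.comp (x, h) (g := (eval : ℂ → (ℕ →ᵇ B) →L[ℂ] B))
        (f := fun y : E × ℂ => y.2 / R)
        (differentiableOn_eval.differentiableAt (Metric.isOpen_ball.mem_nhds hhR))
        (by fun_prop)
    have h3 : DifferentiableAt ℂ (fun y : E × ℂ => H y.1) (x, h) :=
      DifferentiableAt.comp (x, h) (g := H) (f := Prod.fst) (hH x hx).differentiableAt
        differentiableAt_fst
    exact h2.clm_apply h3
  · intro x hx h
    by_cases hh : h = 0
    · obtain ⟨S, hS⟩ := (hUr x hx).exists_right_inv
      exact ⟨S, by rw [hh, hg0, hS]⟩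
    · obtain ⟨R, hR, hR0, hhR, H, hH, hH0, hHG, hsum⟩ := hloc h
      refine exists_right_inverse (h := h) hzr (g := fun y => g (y, h)) ?_ ?_ ?_ x hx
      · refine AnalyticOnNhd.congr (f := fun y => eval (h / R) (H y)) hopen ?_ ?_
        · exact fun y hy => ((eval (h / R) : (ℕ →ᵇ B) →L[ℂ] B).analyticAt (H y)).comp (hH y hy)
        · exact fun y hy => ((hsum y hy h hhR).2).symm
      · refine (tsum_eq_single 0 fun n hn => ?_).trans (by simp [hQ0])
        simp [hG0, one_apply, hn]
      · exact fun y hy => hgpde y hy h hh y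
  · exact fun x hx => by rw [hg0]; exact hUr x hx
  · intro x hx h hh v
    rw [hgpde x hx h hh v, hg0]

end CoeffSeq

/-! ### Calculus in the function algebra -/

namespace FunctionAlgebra

variable {r : ℕ} {K : Type*} [CommRing K] [Algebra ℂ K] (F : FunctionAlgebra r K)

theorem value_of_mem {f : K} {x : Fin r → ℂ} (hx : f ∈ F.regularAt x) :
    F.value f x = F.ev x ⟨f, hx⟩ := dif_pos hx

theorem analyticAt_value {f : K} {x : Fin r → ℂ} (hx : f ∈ F.regularAt x) :
    AnalyticAt ℂ (F.value f) x :=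
  F.holomorphic f (F.value f) (fun _ hy => F.value_of_mem hy) x hx

theorem eventually_mem {f : K} {x : Fin r → ℂ} (hx : f ∈ F.regularAt x) :
    ∀ᶠ y in 𝓝 x, f ∈ F.regularAt y := (F.isOpen_dom f).mem_nhds hx

theorem value_add {f g : K} {x : Fin r → ℂ} (hf : f ∈ F.regularAt x) (hg : g ∈ F.regularAt x) :
    F.value (f + g) x = F.value f x + F.value g x := by
  rw [F.value_of_mem hf, F.value_of_mem hg, F.value_of_mem (add_mem hf hg), ← map_add]
  rfl

theorem value_mul {f g : K} {x : Fin r → ℂ} (hf : f ∈ F.regularAt x) (hg : g ∈ F.regularAt x) :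
    F.value (f * g) x = F.value f x * F.value g x := by
  rw [F.value_of_mem hf, F.value_of_mem hg, F.value_of_mem (mul_mem hf hg), ← map_mul]
  rfl

theorem value_sub {f g : K} {x : Fin r → ℂ} (hf : f ∈ F.regularAt x) (hg : g ∈ F.regularAt x) :
    F.value (f - g) x = F.value f x - F.value g x := by
  rw [F.value_of_mem hf, F.value_of_mem hg, F.value_of_mem (sub_mem hf hg), ← map_sub]
  rfl

theorem value_sum {ι : Type*} (t : Finset ι) {f : ι → K} {x : Fin r → ℂ}
    (hf : ∀ i ∈ t, f i ∈ F.regularAt x) :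
    F.value (∑ i ∈ t, f i) x = ∑ i ∈ t, F.value (f i) x := by
  classical
  induction t using Finset.induction_on with
  | empty =>
    rw [Finset.sum_empty, Finset.sum_empty, F.value_of_mem (zero_mem _)]
    exact map_zero (F.ev x)
  | insert i t hi ih =>
    rw [Finset.sum_insert hi, Finset.sum_insert hi, F.value_add (hf i (Finset.mem_insert_self i t))
      (sum_mem fun j hj => hf j (Finset.mem_insert_of_mem hj)),
      ih fun j hj => hf j (Finset.mem_insert_of_mem hj)]

theorem value_algebraMap (c : ℂ) (x : Fin r → ℂ) : F.value (algebraMap ℂ K c) x = c := by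
  rw [F.value_of_mem (Subalgebra.algebraMap_mem _ c)]
  exact (F.ev x).commutes c

theorem value_zero (x : Fin r → ℂ) : F.value 0 x = 0 := by
  simpa using F.value_algebraMap 0 x

theorem value_coord (i : Fin r) (x : Fin r → ℂ) : F.value (F.coord i) x = x i := by
  rw [F.value_of_mem (F.coord_mem i x), F.ev_coord]

theorem value_pd (i : Fin r) {f : K} {x : Fin r → ℂ} (hx : f ∈ F.regularAt x) :
    F.value (F.pd i f) x = fderiv ℂ (F.value f) x (Pi.single i 1) := by
  rw [F.value_of_mem (F.pd_mem i f x hx)]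
  exact F.ev_pd i f _ (fun _ hy => F.value_of_mem hy) x hx

theorem dlog_apply (i : Fin r) (f : K) : F.dlog i f = F.coord i * F.pd i f := rfl

theorem dlog_mem (i : Fin r) {f : K} {x : Fin r → ℂ} (hx : f ∈ F.regularAt x) :
    F.dlog i f ∈ F.regularAt x := mul_mem (F.coord_mem i x) (F.pd_mem i f x hx)

theorem value_dlog (i : Fin r) {f : K} {x : Fin r → ℂ} (hx : f ∈ F.regularAt x) :
    F.value (F.dlog i f) x = x i * fderiv ℂ (F.value f) x (Pi.single i 1) := by
  rw [dlog_apply, F.value_mul (F.coord_mem i x) (F.pd_mem i f x hx), F.value_coord,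
    F.value_pd i hx]

theorem eq_zero_of_value {f : K} {W : Set (Fin r → ℂ)} (hW : IsOpen W) (hne : W.Nonempty)
    (h : ∀ x ∈ W, f ∈ F.regularAt x ∧ F.value f x = 0) : f = 0 :=
  F.eq_zero_of_ev f W hW hne fun x hx => ⟨(h x hx).1, by
    rw [← F.value_of_mem (h x hx).1, (h x hx).2]⟩

theorem pd_coord (i j : Fin r) : F.pd i (F.coord j) = if i = j then 1 else 0 := by
  have hc : (if i = j then 1 else 0 : K) = algebraMap ℂ K (if i = j then 1 else 0) := by
    split_ifs <;> simp
  rw [hc, ← sub_eq_zero]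
  refine F.eq_zero_of_value isOpen_univ Set.univ_nonempty fun x _ => ?_
  have h1 : F.coord j ∈ F.regularAt x := F.coord_mem j x
  refine ⟨sub_mem (F.pd_mem i _ x h1) (Subalgebra.algebraMap_mem _ _), ?_⟩
  rw [F.value_sub (F.pd_mem i _ x h1) (Subalgebra.algebraMap_mem _ _), F.value_pd i h1,
    F.value_algebraMap]
  have h2 : F.value (F.coord j) = fun y => y j := funext fun y => F.value_coord j y
  have h3 : HasFDerivAt (fun y : Fin r → ℂ => y j)
      (ContinuousLinearMap.proj j : (Fin r → ℂ) →L[ℂ] ℂ) x := hasFDerivAt_apply j x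
  rw [h2, h3.fderiv]
  simp [Pi.single_apply, eq_comm]

/-- Symmetry of second derivatives on the domain of f, transported to K by the identity principle.
-/
theorem pd_comm (i j : Fin r) (f : K) : F.pd i (F.pd j f) = F.pd j (F.pd i f) := by
  rw [← sub_eq_zero]
  refine F.eq_zero_of_value (F.isOpen_dom f) (F.dom_nonempty f) fun x hx => ?_
  have hm : ∀ i j, F.pd i (F.pd j f) ∈ F.regularAt x := fun i j =>
    F.pd_mem i _ x (F.pd_mem j f x hx)
  refine ⟨sub_mem (hm i j) (hm j i), ?_⟩
  have hval : ∀ i j, F.value (F.pd i (F.pd j f)) x =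
      fderiv ℂ (fderiv ℂ (F.value f)) x (Pi.single i 1) (Pi.single j 1) := fun i j => by
    rw [F.value_pd i (F.pd_mem j f x hx)]
    have h1 : F.value (F.pd j f) =ᶠ[𝓝 x] fun y => fderiv ℂ (F.value f) y (Pi.single j 1) := by
      filter_upwards [F.eventually_mem hx] with y hy using F.value_pd j hy
    rw [h1.fderiv_eq]
    have h2 := ((F.analyticAt_value hx).fderiv.differentiableAt.hasFDerivAt.clm_apply
      (hasFDerivAt_const (Pi.single j 1 : Fin r → ℂ) x)).fderiv
    rw [h2]
    simp
  rw [F.value_sub (hm i j) (hm j i), hval, hval, sub_eq_zero]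
  have hs : IsSymmSndFDerivAt ℂ (F.value f) x :=
    (F.analyticAt_value hx).contDiffAt.isSymmSndFDerivAt (n := ω) (by simp)
  exact hs.eq _ _

theorem dlog_comm (i j : Fin r) (f : K) : F.dlog i (F.dlog j f) = F.dlog j (F.dlog i f) := by
  simp only [dlog_apply, Derivation.leibniz, smul_eq_mul, pd_coord, F.pd_comm j i]
  by_cases h : i = j
  · subst h; rfl
  · simp only [h, Ne.symm h, if_false]
    ring

theorem exists_mem_ne_zero {W : Set (Fin r → ℂ)} (hW : IsOpen W) (hne : W.Nonempty) :
    (W ∩ {x | ∀ i, x i ≠ 0}).Nonempty := by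
  have h : Dense (Set.pi Set.univ fun _ : Fin r => ({0}ᶜ : Set ℂ)) :=
    dense_pi _ fun _ _ => dense_compl_singleton 0
  obtain ⟨x, hx, hx'⟩ := h.inter_open_nonempty W hW hne
  exact ⟨x, hx, fun i => hx' i (Set.mem_univ i)⟩

/-- The monomial `q^J`. -/
def coordMonomial (J : Fin r → ℕ) : K := ∏ i, F.coord i ^ J i

theorem dlog_coord_pow (i j : Fin r) (m : ℕ) :
    F.dlog i (F.coord j ^ m) = (if i = j then (m : K) else 0) * F.coord j ^ m := by
  rw [dlog_apply, Derivation.leibniz_pow, pd_coord, smul_eq_mul, nsmul_eq_mul]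
  split_ifs with h
  · subst h
    rcases Nat.eq_zero_or_pos m with h | h
    · simp [h]
    · obtain ⟨n, rfl⟩ := Nat.exists_eq_succ_of_ne_zero h.ne'
      rw [Nat.succ_sub_one, pow_succ]
      ring
  · simp

theorem dlog_prod_coord_pow (i : Fin r) (J : Fin r → ℕ) (t : Finset (Fin r)) :
    F.dlog i (∏ j ∈ t, F.coord j ^ J j) =
      (if i ∈ t then (J i : K) else 0) * ∏ j ∈ t, F.coord j ^ J j := by
  induction t using Finset.induction_on with
  | empty => simp
  | insert j t hj ih =>
    rw [Finset.prod_insert hj, Derivation.leibniz, ih, dlog_coord_pow, smul_eq_mul, smul_eq_mul]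
    by_cases h : i = j
    · subst h
      rw [if_neg hj, if_pos rfl, if_pos (Finset.mem_insert_self i t)]
      ring
    · simp [h]
      split_ifs
      · ring
      · ring

theorem dlog_coordMonomial (i : Fin r) (J : Fin r → ℕ) :
    F.dlog i (F.coordMonomial J) = (J i : K) * F.coordMonomial J := by
  rw [coordMonomial, dlog_prod_coord_pow, if_pos (Finset.mem_univ i)]

/-- K need not be a domain, but monomials vanish only on coordinate hyperplanes, whose complement is
open and dense; the identity principle does the rest. -/
theorem eq_zero_of_mul_coordMonomial {f : K} {J : Fin r → ℕ} (h : f * F.coordMonomial J = 0) :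
    f = 0 := by
  have ho : IsOpen ({x | f ∈ F.regularAt x} ∩ {x | ∀ i, x i ≠ 0}) := by
    refine (F.isOpen_dom f).inter ?_
    simp only [Set.ofPred_forall]
    exact isOpen_iInter_of_finite fun i => isOpen_ne_fun (continuous_apply i) continuous_const
  refine F.eq_zero_of_value ho (exists_mem_ne_zero (F.isOpen_dom f) (F.dom_nonempty f)) ?_
  rintro x ⟨hx, hx0⟩
  refine ⟨hx, ?_⟩
  have hm : F.coordMonomial J ∈ F.regularAt x :=
    prod_mem fun i _ => pow_mem (F.coord_mem i x) _
  have hv : F.value (F.coordMonomial J) x = ∏ i, x i ^ J i := by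
    rw [F.value_of_mem hm]
    have : (⟨F.coordMonomial J, hm⟩ : F.regularAt x) =
        ∏ i, (⟨F.coord i, F.coord_mem i x⟩ : F.regularAt x) ^ J i := by
      apply Subtype.ext
      simp [coordMonomial]
    rw [this, map_prod]
    refine Finset.prod_congr rfl fun i _ => ?_
    rw [map_pow, F.ev_coord]
  have h1 := F.value_mul hx hm
  rw [h, F.value_zero, hv] at h1
  exact (mul_eq_zero.1 h1.symm).resolve_right
    (Finset.prod_ne_zero_iff.2 fun i _ => pow_ne_zero _ (hx0 i))

end FunctionAlgebra

/-! ### Differential operators, symbols and their limits -/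

namespace FunctionAlgebra

variable {r : ℕ} {K : Type*} [CommRing K] [Algebra ℂ K] (F : FunctionAlgebra r K)

theorem hdOp_monomial (i : Fin r) (n : ℕ) (a : K) :
    F.hdOp i (monomial n a) = monomial (n + 1) (F.dlog i a) := by
  rw [hdOp, Polynomial.lsum_apply, Polynomial.sum_monomial_index _ _ (by simp)]
  rfl

theorem coeff_hdOp_zero (i : Fin r) (f : K[X]) : (F.hdOp i f).coeff 0 = 0 := by
  induction f using Polynomial.induction_on' with
  | add p q hp hq => rw [map_add, coeff_add, hp, hq, add_zero]
  | monomial n a => rw [hdOp_monomial, coeff_monomial, if_neg (Nat.succ_ne_zero n)]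

theorem coeff_hdOp_succ (i : Fin r) (f : K[X]) (n : ℕ) :
    (F.hdOp i f).coeff (n + 1) = F.dlog i (f.coeff n) := by
  induction f using Polynomial.induction_on' with
  | add p q hp hq => rw [map_add, coeff_add, hp, hq, coeff_add, map_add]
  | monomial m a =>
    rw [hdOp_monomial, coeff_monomial, coeff_monomial]
    by_cases h : m = n
    · simp [h]
    · simp [h]

theorem hdOp_mul (i : Fin r) (f g : K[X]) :
    F.hdOp i (f * g) = F.hdOp i f * g + f * F.hdOp i g := by
  induction f using Polynomial.induction_on' with
  | add p q hp hq => rw [add_mul, map_add, hp, hq, map_add]; ring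
  | monomial m a =>
    induction g using Polynomial.induction_on' with
    | add p q hp hq => rw [mul_add, map_add, hp, hq, map_add]; ring
    | monomial n b =>
      rw [monomial_mul_monomial, hdOp_monomial, hdOp_monomial, hdOp_monomial,
        monomial_mul_monomial, monomial_mul_monomial, Derivation.leibniz, smul_eq_mul, smul_eq_mul,
        add_right_comm m 1 n, ← add_assoc m n 1, ← map_add]
      congr 1
      ring

theorem hdOp_comm (i j : Fin r) (f : K[X]) : F.hdOp i (F.hdOp j f) = F.hdOp j (F.hdOp i f) := by
  induction f using Polynomial.induction_on' with
  | add p q hp hq => simp only [map_add, hp, hq]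
  | monomial n a => simp only [hdOp_monomial, F.dlog_comm i j]

/-- The action of differential operators on `K[h]`. -/
noncomputable def toEnd : F.Dh →+* Module.End ℂ K[X] where
  toFun P := Subtype.val (p := (· ∈ F.diffOps)) P
  map_one' := rfl
  map_mul' _ _ := rfl
  map_zero' := rfl
  map_add' _ _ := rfl

theorem toEnd_injective : Function.Injective F.toEnd :=
  fun _ _ h => Subtype.val_injective (p := (· ∈ F.diffOps)) h

@[simp] theorem toEnd_hd (i : Fin r) : F.toEnd (F.hd i) = F.hdOp i := rfl

@[simp] theorem toEnd_coeff (f g : K[X]) : F.toEnd (F.coeff f) g = f * g := rfl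

theorem hd_comm (i j : Fin r) : F.hd i * F.hd j = F.hd j * F.hd i :=
  F.toEnd_injective (LinearMap.ext fun f => by
    rw [map_mul, map_mul]
    exact F.hdOp_comm i j f)

theorem hd_mul_coeff (i : Fin r) (f : K[X]) :
    F.hd i * F.coeff f = F.coeff f * F.hd i + F.coeff (F.hdOp i f) :=
  F.toEnd_injective (LinearMap.ext fun g => by
    rw [map_add, map_mul, map_mul]
    exact (F.hdOp_mul i f g).trans (add_comm _ _))

/-- The monomial `(h∂)^I`. -/
noncomputable def hdMonomial (I : Fin r →₀ ℕ) : F.Dh := (List.ofFn fun i => F.hd i ^ I i).prod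

/-- The commuting h∂_i generate a commutative submonoid, in which the ordered list product becomes a
finite product that can be rearranged. -/
theorem exists_prod_eq_hdMonomial.{w} {K : Type w} [CommRing K] [Algebra ℂ K]
    (F : FunctionAlgebra r K) : ∃ (M : Type w) (_ : CommMonoid M) (φ : M →* F.Dh)
    (g : Fin r → M), (∀ i, φ (g i) = F.hd i) ∧ ∀ I, F.hdMonomial I = φ (∏ i, g i ^ I i) := by
  let S := Submonoid.closure (Set.range F.hd)
  have hS : IsMulCommutative S := Submonoid.isMulCommutative_closure _ (by
    rintro _ ⟨i, rfl⟩ _ ⟨j, rfl⟩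
    exact F.hd_comm i j)
  refine ⟨S, { (inferInstance : Monoid S) with mul_comm := hS.is_comm.comm }, ?_⟩
  let _ : CommMonoid S := { (inferInstance : Monoid S) with mul_comm := hS.is_comm.comm }
  refine ⟨S.subtype, fun i => ⟨F.hd i, Submonoid.subset_closure ⟨i, rfl⟩⟩, fun i => rfl,
    fun I => ?_⟩
  rw [← List.prod_ofFn, map_list_prod, hdMonomial, List.map_ofFn]
  rfl

theorem hdMonomial_add (I J : Fin r →₀ ℕ) :
    F.hdMonomial (I + J) = F.hdMonomial I * F.hdMonomial J := by
  obtain ⟨M, _, φ, g, _, h⟩ := F.exists_prod_eq_hdMonomial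
  rw [h, h, h, ← map_mul, ← Finset.prod_mul_distrib]
  simp only [Finsupp.add_apply, pow_add]

theorem hdMonomial_zero : F.hdMonomial 0 = 1 := by
  obtain ⟨M, _, φ, g, _, h⟩ := F.exists_prod_eq_hdMonomial
  rw [h]
  simp

theorem hdMonomial_single (i : Fin r) (n : ℕ) :
    F.hdMonomial (Finsupp.single i n) = F.hd i ^ n := by
  obtain ⟨M, _, φ, g, hg, h⟩ := F.exists_prod_eq_hdMonomial
  rw [h, Finset.prod_eq_single i (fun j _ hj => by simp [hj.symm]) (by simp), map_pow, hg,
    Finsupp.single_eq_same]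

theorem ofSymbol_eq_sum {p : MvPolynomial (Fin r) K[X]} {T : Finset (Fin r →₀ ℕ)}
    (hT : p.support ⊆ T) : F.ofSymbol p = ∑ I ∈ T, F.coeff (p.coeff I) * F.hdMonomial I :=
  Finset.sum_subset hT fun I _ hI => by
    rw [MvPolynomial.notMem_support_iff.1 hI, map_zero, zero_mul]

theorem ofSymbol_add (p q : MvPolynomial (Fin r) K[X]) :
    F.ofSymbol (p + q) = F.ofSymbol p + F.ofSymbol q := by
  classical
  rw [F.ofSymbol_eq_sum MvPolynomial.support_add,
    F.ofSymbol_eq_sum (Finset.subset_union_left : p.support ⊆ p.support ∪ q.support),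
    F.ofSymbol_eq_sum (Finset.subset_union_right : q.support ⊆ p.support ∪ q.support),
    ← Finset.sum_add_distrib]
  refine Finset.sum_congr rfl fun I _ => ?_
  rw [MvPolynomial.coeff_add, map_add, add_mul]

theorem ofSymbol_monomial (I : Fin r →₀ ℕ) (a : K[X]) :
    F.ofSymbol (MvPolynomial.monomial I a) = F.coeff a * F.hdMonomial I := by
  rw [F.ofSymbol_eq_sum MvPolynomial.support_monomial_subset, Finset.sum_singleton,
    MvPolynomial.coeff_monomial, if_pos rfl]

theorem ofSymbol_zero : F.ofSymbol 0 = 0 := by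
  simp [ofSymbol]

theorem ofSymbol_neg (p : MvPolynomial (Fin r) K[X]) : F.ofSymbol (-p) = -F.ofSymbol p := by
  rw [eq_neg_iff_add_eq_zero, ← ofSymbol_add, neg_add_cancel, ofSymbol_zero]

theorem hdOp_coordMonomial (i : Fin r) (J : Fin r → ℕ) (n : ℕ) :
    F.hdOp i (monomial n (F.coordMonomial J)) =
      (J i : ℂ) • monomial (n + 1) (F.coordMonomial J) := by
  rw [hdOp_monomial, dlog_coordMonomial, Polynomial.smul_monomial, Algebra.smul_def, map_natCast]

theorem toEnd_hdMonomial_coordMonomial (I : Fin r →₀ ℕ) (J : Fin r → ℕ) (n : ℕ) :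
    F.toEnd (F.hdMonomial I) (monomial n (F.coordMonomial J)) =
      (∏ i, (J i : ℂ) ^ I i) • monomial (n + I.degree) (F.coordMonomial J) := by
  induction I using Finsupp.induction_linear generalizing n with
  | zero => simp [hdMonomial_zero]
  | add I I' h h' =>
    rw [hdMonomial_add, map_mul, Module.End.mul_apply, h', map_smul, h, smul_smul,
      ← Finset.prod_mul_distrib]
    simp only [Finsupp.add_apply, map_add, pow_add, mul_comm]
    rw [add_assoc, add_comm I'.degree]
  | single i m =>
    rw [hdMonomial_single, Finset.prod_eq_single i (fun j _ hj => by simp [hj.symm]) (by simp)]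
    simp only [Finsupp.single_eq_same, Finsupp.degree_single]
    induction m generalizing n with
    | zero => simp
    | succ m ih =>
      rw [pow_succ, map_mul, Module.End.mul_apply, toEnd_hd, hdOp_coordMonomial, map_smul, ih,
        smul_smul, ← pow_succ', add_assoc, add_comm 1 m]

/-- Operators are tested on the monomials q^J, for which (h∂)^I q^J = J^I h^|I| q^J. A vanishing
operator gives a polynomial relation in J valid on all of ℕ^r, so every coefficient is zero. This is
what makes S(P) and its limit well defined. -/
theorem ofSymbol_eq_zero {p : MvPolynomial (Fin r) K[X]} (hp : F.ofSymbol p = 0) : p = 0 := by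
  have h1 : ∀ J : Fin r → ℕ,
      ∑ I ∈ p.support, (∏ i, (J i : ℂ) ^ I i) • (p.coeff I * X ^ I.degree) = 0 := by
    intro J
    have h2 : (∑ I ∈ p.support, (∏ i, (J i : ℂ) ^ I i) • (p.coeff I * X ^ I.degree)) *
        C (F.coordMonomial J) = 0 := by
      have h3 := LinearMap.congr_fun (congrArg F.toEnd hp) (monomial 0 (F.coordMonomial J))
      rw [F.ofSymbol_eq_sum subset_rfl, map_sum, map_zero, LinearMap.sum_apply,
        LinearMap.zero_apply] at h3
      rw [Finset.sum_mul, ← h3]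
      refine Finset.sum_congr rfl fun I _ => ?_
      rw [map_mul, Module.End.mul_apply, toEnd_hdMonomial_coordMonomial, map_smul, toEnd_coeff,
        smul_mul_assoc, zero_add, ← C_mul_X_pow_eq_monomial]
      congr 1
      ring
    ext n
    have h4 := congrArg (fun f => Polynomial.coeff f n) h2
    simp only [coeff_mul_C, coeff_zero] at h4
    rw [coeff_zero]
    exact F.eq_zero_of_mul_coordMonomial h4
  ext1 I
  rw [MvPolynomial.coeff_zero]
  by_cases hI : I ∈ p.support
  swap
  · exact MvPolynomial.notMem_support_iff.1 hI
  suffices h : p.coeff I * X ^ I.degree = 0 by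
    ext n
    have := congrArg (fun f => Polynomial.coeff f (n + I.degree)) h
    simpa using this
  -- A linear functional turns the coefficients in K[h] into complex numbers, so that P below is an
  -- ordinary complex polynomial.
  rw [← Module.forall_dual_apply_eq_zero_iff ℂ]
  intro φ
  let P : MvPolynomial (Fin r) ℂ :=
    ∑ I ∈ p.support, MvPolynomial.monomial I (φ (p.coeff I * X ^ I.degree))
  have hP : P = 0 := by
    refine MvPolynomial.funext_set (fun _ => Set.range ((↑) : ℕ → ℂ))
      (fun _ => Set.infinite_range_of_injective Nat.cast_injective) fun x hx => ?_
    choose J hJ using fun i => hx i (Set.mem_univ i)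
    obtain rfl : (fun i => (J i : ℂ)) = x := funext hJ
    have h2 := congrArg φ (h1 J)
    rw [map_sum, map_zero] at h2
    rw [map_zero, ← h2, map_sum]
    refine Finset.sum_congr rfl fun I _ => ?_
    rw [MvPolynomial.eval_monomial, map_smul, smul_eq_mul, mul_comm,
      Finsupp.prod_fintype _ _ (by simp)]
  have h2 := congrArg (MvPolynomial.coeff I) hP
  rw [MvPolynomial.coeff_zero, MvPolynomial.coeff_sum, Finset.sum_eq_single I] at h2
  · simpa using h2
  · intro I' _ hI'
    rw [MvPolynomial.coeff_monomial, if_neg hI']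
  · exact fun h => absurd hI h

theorem ofSymbol_injective : Function.Injective F.ofSymbol := fun p q h => by
  rw [← sub_eq_zero]
  apply F.ofSymbol_eq_zero
  rw [sub_eq_add_neg, ofSymbol_add, ofSymbol_neg, h, add_neg_cancel]

theorem coeff_mul_ofSymbol (f : K[X]) (p : MvPolynomial (Fin r) K[X]) :
    F.coeff f * F.ofSymbol p = F.ofSymbol (MvPolynomial.C f * p) := by
  induction p using MvPolynomial.induction_on' with
  | monomial I a =>
    rw [ofSymbol_monomial, MvPolynomial.C_mul_monomial, ofSymbol_monomial, map_mul, mul_assoc]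
  | add p q hp hq => rw [ofSymbol_add, mul_add, mul_add, ofSymbol_add, hp, hq]

/-- Moving h∂_i past a coefficient a costs h∂_i(a), which is divisible by h and so disappears in the
limit. -/
theorem exists_hd_mul_ofSymbol (i : Fin r) (p : MvPolynomial (Fin r) K[X]) :
    ∃ p', F.hd i * F.ofSymbol p = F.ofSymbol (MvPolynomial.X i * p + p') ∧
      MvPolynomial.map (Polynomial.evalRingHom (0 : K)) p' = 0 := by
  induction p using MvPolynomial.induction_on' with
  | monomial I a =>
    refine ⟨MvPolynomial.monomial I (F.hdOp i a), ?_, ?_⟩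
    · rw [ofSymbol_add, ofSymbol_monomial, ofSymbol_monomial, ← mul_assoc, hd_mul_coeff, add_mul,
        MvPolynomial.X, MvPolynomial.monomial_mul, one_mul, ofSymbol_monomial, hdMonomial_add,
        hdMonomial_single, pow_one, mul_assoc]
    · rw [MvPolynomial.map_monomial, coe_evalRingHom, ← coeff_zero_eq_eval_zero, coeff_hdOp_zero,
        MvPolynomial.monomial_zero]
  | add p q hp hq =>
    obtain ⟨p', hp, hp'⟩ := hp
    obtain ⟨q', hq, hq'⟩ := hq
    refine ⟨p' + q', ?_, by rw [map_add, hp', hq', add_zero]⟩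
    rw [ofSymbol_add, mul_add, hp, hq, ← ofSymbol_add]
    congr 1
    ring

theorem HasLimit.unique {P : F.Dh} {c d : MvPolynomial (Fin r) K} (hc : F.HasLimit P c)
    (hd : F.HasLimit P d) : c = d := by
  obtain ⟨p, hp, rfl⟩ := hc
  obtain ⟨q, hq, rfl⟩ := hd
  rw [F.ofSymbol_injective (hp.symm.trans hq)]

theorem HasLimit.add {P Q : F.Dh} {c d : MvPolynomial (Fin r) K} (hP : F.HasLimit P c)
    (hQ : F.HasLimit Q d) : F.HasLimit (P + Q) (c + d) := by
  obtain ⟨p, hp, rfl⟩ := hP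
  obtain ⟨q, hq, rfl⟩ := hQ
  exact ⟨p + q, by rw [IsSymbol, hp, hq, ofSymbol_add], map_add _ _ _⟩

theorem HasLimit.neg {P : F.Dh} {c : MvPolynomial (Fin r) K} (hP : F.HasLimit P c) :
    F.HasLimit (-P) (-c) := by
  obtain ⟨p, hp, rfl⟩ := hP
  exact ⟨-p, by rw [IsSymbol, hp, ofSymbol_neg], map_neg _ _⟩

theorem hasLimit_zero : F.HasLimit 0 0 := ⟨0, (F.ofSymbol_zero).symm, map_zero _⟩

theorem HasLimit.coeff_mul (f : K[X]) {P : F.Dh} {c : MvPolynomial (Fin r) K}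
    (hP : F.HasLimit P c) : F.HasLimit (F.coeff f * P) (MvPolynomial.C (f.coeff 0) * c) := by
  obtain ⟨p, hp, rfl⟩ := hP
  refine ⟨MvPolynomial.C f * p, by rw [IsSymbol, hp, coeff_mul_ofSymbol], ?_⟩
  rw [map_mul, MvPolynomial.map_C, coe_evalRingHom, ← coeff_zero_eq_eval_zero]

theorem HasLimit.hd_mul (i : Fin r) {P : F.Dh} {c : MvPolynomial (Fin r) K}
    (hP : F.HasLimit P c) : F.HasLimit (F.hd i * P) (MvPolynomial.X i * c) := by
  obtain ⟨p, hp, rfl⟩ := hP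
  obtain ⟨p', h, h'⟩ := F.exists_hd_mul_ofSymbol i p
  exact ⟨_, by rw [IsSymbol, hp, h], by rw [map_add, map_mul, h', add_zero, MvPolynomial.map_X]⟩

theorem HasLimit.sum {ι : Type*} (t : Finset ι) {P : ι → F.Dh}
    {c : ι → MvPolynomial (Fin r) K} (h : ∀ i ∈ t, F.HasLimit (P i) (c i)) :
    F.HasLimit (∑ i ∈ t, P i) (∑ i ∈ t, c i) := by
  classical
  induction t using Finset.induction_on with
  | empty => simpa using F.hasLimit_zero
  | insert i t hi ih =>
    rw [Finset.sum_insert hi, Finset.sum_insert hi]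
    exact (h i (Finset.mem_insert_self i t)).add _
      (ih fun j hj => h j (Finset.mem_insert_of_mem hj))

theorem Dh_induction {motive : F.Dh → Prop} (coeff : ∀ f, motive (F.coeff f))
    (hd : ∀ i, motive (F.hd i)) (add : ∀ P Q, motive P → motive Q → motive (P + Q))
    (mul : ∀ P Q, motive P → motive Q → motive (P * Q)) (P : F.Dh) : motive P := by
  have h : ∀ (x : Module.End ℂ K[X]) (hx : x ∈ F.diffOps), motive (⟨x, hx⟩ : F.diffOps) := by
    intro x hx
    refine Algebra.adjoin_induction (p := fun x hx => motive (⟨x, hx⟩ : F.diffOps)) ?_ ?_ ?_ ?_ hx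
    · rintro x (⟨f, rfl⟩ | ⟨i, rfl⟩)
      · exact coeff f
      · exact hd i
    -- Complex scalars are themselves multiplication operators by constant coefficients.
    · intro c
      have h : F.coeff (algebraMap ℂ K[X] c) = (⟨algebraMap ℂ _ c, Subalgebra.algebraMap_mem _ c⟩ :
          F.diffOps) := Subtype.ext (LinearMap.ext fun f => (Algebra.smul_def c f).symm)
      have := coeff (algebraMap ℂ K[X] c)
      rwa [h] at this
    · exact fun x y hx hy h h' => add _ _ h h'
    · exact fun x y hx hy h h' => mul _ _ h h'
  exact h _ (Subtype.property (p := (· ∈ F.diffOps)) P)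

/-- The polynomial c depends on P only. This is what sends the left ideal of the D_i into the ideal
of the R_i under the limit. -/
theorem exists_mul_hasLimit (P : F.Dh) : ∃ c : MvPolynomial (Fin r) K, ∀ Q d,
    F.HasLimit Q d → F.HasLimit (P * Q) (c * d) := by
  induction P using F.Dh_induction with
  | coeff f => exact ⟨_, fun Q d h => h.coeff_mul F f⟩
  | hd i => exact ⟨_, fun Q d h => h.hd_mul F i⟩
  | add P P' h h' =>
    obtain ⟨c, hc⟩ := h
    obtain ⟨d, hd⟩ := h'
    refine ⟨c + d, fun Q e he => ?_⟩
    rw [add_mul, add_mul]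
    exact (hc Q e he).add F (hd Q e he)
  | mul P P' h h' =>
    obtain ⟨c, hc⟩ := h
    obtain ⟨d, hd⟩ := h'
    refine ⟨c * d, fun Q e he => ?_⟩
    rw [mul_assoc, mul_assoc]
    exact hc _ _ (hd Q e he)

end FunctionAlgebra

/-! ### The module M^h: flatness and leading term -/

namespace FunctionAlgebra

variable {r s u : ℕ} {K : Type*} [CommRing K] [Algebra ℂ K] (F : FunctionAlgebra r K)

theorem exists_hasLimit_of_mem_span {R : Fin u → MvPolynomial (Fin r) K} {D : Fin u → F.Dh}
    (hD : ∀ i, F.HasLimit (D i) (R i)) {P : F.Dh} (hP : P ∈ Submodule.span F.Dh (Set.range D)) :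
    ∃ c ∈ Ideal.span (Set.range R), F.HasLimit P c := by
  induction hP using Submodule.span_induction with
  | mem x hx =>
    obtain ⟨i, rfl⟩ := hx
    exact ⟨R i, Ideal.subset_span ⟨i, rfl⟩, hD i⟩
  | zero => exact ⟨0, zero_mem _, F.hasLimit_zero⟩
  | add x y hx hy h h' =>
    obtain ⟨c, hc, hc'⟩ := h
    obtain ⟨d, hd, hd'⟩ := h'
    exact ⟨c + d, add_mem hc hd, hc'.add F hd'⟩
  | smul a x hx h =>
    obtain ⟨c, hc, hc'⟩ := h
    obtain ⟨d, hd⟩ := F.exists_mul_hasLimit a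
    exact ⟨d * c, Ideal.mul_mem_left _ _ hc, hd _ _ hc'⟩

theorem hd_smul_cls {D : Fin u → F.Dh} (P Q : F.Dh) : P • F.cls D Q = F.cls D (P * Q) := rfl

theorem smul_eq_coeff_smul {D : Fin u → F.Dh} (f : K[X]) (m : F.Mh D) :
    f • m = F.coeff f • m := rfl

theorem hd_smul_smul {D : Fin u → F.Dh} (i : Fin r) (f : K[X]) (m : F.Mh D) :
    F.hd i • f • m = f • F.hd i • m + F.hdOp i f • m := by
  rw [smul_eq_coeff_smul, smul_eq_coeff_smul, smul_eq_coeff_smul, smul_smul, hd_mul_coeff,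
    add_smul, smul_smul]

theorem hd_smul_basis {D : Fin u → F.Dh} (bM : Module.Basis (Fin (s + 1)) K[X] (F.Mh D))
    (i : Fin r) (j : Fin (s + 1)) :
    F.hd i • bM j = ∑ k, F.actionMatrix bM i k j • bM k :=
  (bM.sum_repr (F.hd i • bM j)).symm

/-- The connection `d + Ω^h` is flat. -/
theorem actionMatrix_mul_add {D : Fin u → F.Dh} (bM : Module.Basis (Fin (s + 1)) K[X] (F.Mh D))
    (i l : Fin r) :
    F.actionMatrix bM l * F.actionMatrix bM i + (F.actionMatrix bM i).map (F.hdOp l) =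
      F.actionMatrix bM i * F.actionMatrix bM l + (F.actionMatrix bM l).map (F.hdOp i) := by
  -- By the Leibniz rule each side is the matrix of a composite h∂_l h∂_i, taken in one of the two
  -- orders, and the two operators commute.
  have h : ∀ (i l : Fin r) (k j), (F.actionMatrix bM l * F.actionMatrix bM i +
      (F.actionMatrix bM i).map (F.hdOp l)) k j = bM.repr (F.hd l • F.hd i • bM j) k := by
    intro i l k j
    rw [hd_smul_basis, Finset.smul_sum]
    simp only [hd_smul_smul, Finset.sum_add_distrib, map_add, map_sum, map_smul, Finsupp.add_apply,
      Finsupp.finsetSum_apply, Finsupp.smul_apply, Module.Basis.repr_self]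
    rw [Matrix.add_apply, Matrix.mul_apply, Matrix.map_apply]
    congr 1
    · exact Finset.sum_congr rfl fun m _ => mul_comm _ _
    · rw [Finset.sum_eq_single k (fun m _ hm => by simp [hm]) (by simp)]
      simp
  ext1 k j
  rw [h, h, smul_smul, smul_smul, hd_comm]

/-- The leading part of the connection is multiplication by the `b_i`. -/
theorem coeff_zero_actionMatrix {R : Fin u → MvPolynomial (Fin r) K} {D : Fin u → F.Dh}
    (hD : ∀ i, F.HasLimit (D i) (R i)) {P : Fin (s + 1) → F.Dh}
    (bM : Module.Basis (Fin (s + 1)) K[X] (F.Mh D)) (hbM : ∀ j, bM j = F.cls D (P j))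
    {c : Fin (s + 1) → MvPolynomial (Fin r) K} (hc : ∀ j, F.HasLimit (P j) (c j))
    (bA : Module.Basis (Fin (s + 1)) K (RelAlgebra R))
    (hbA : ∀ j, bA j = Ideal.Quotient.mk (Ideal.span (Set.range R)) (c j))
    (i : Fin r) (k j : Fin (s + 1)) :
    (F.actionMatrix bM i k j).coeff 0 =
      bA.repr (Ideal.Quotient.mk (Ideal.span (Set.range R)) (MvPolynomial.X i) * bA j) k := by
  -- The relation defining the action matrix, lifted to operators: the difference lies in the left
  -- ideal, so its limit lies in the ideal of relations. That limit is b_i c_j minus the combination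
  -- of the c_k with coefficients at h = 0.
  have h1 : F.hd i * P j + -∑ k, F.coeff (F.actionMatrix bM i k j) * P k ∈
      Submodule.span F.Dh (Set.range D) := by
    have h2 := F.hd_smul_basis bM i j
    rw [hbM, hd_smul_cls] at h2
    have h3 : ∑ k, F.actionMatrix bM i k j • bM k =
        F.cls D (∑ k, F.coeff (F.actionMatrix bM i k j) * P k) := by
      refine (Finset.sum_congr rfl fun k _ => ?_).trans
        (map_sum (Submodule.mkQ (Submodule.span F.Dh (Set.range D))) _ _).symm
      rw [hbM]
      rfl
    rw [h3] at h2
    rw [← sub_eq_add_neg]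
    exact (Submodule.Quotient.eq _).1 h2
  obtain ⟨d, hd, hd'⟩ := F.exists_hasLimit_of_mem_span hD h1
  have h2 := ((hc j).hd_mul F i).add F ((HasLimit.sum F Finset.univ fun k _ =>
    (hc k).coeff_mul F (F.actionMatrix bM i k j)).neg F)
  obtain rfl := hd'.unique F h2
  have h3 : Ideal.Quotient.mk (Ideal.span (Set.range R)) (MvPolynomial.X i) * bA j =
      ∑ k, (F.actionMatrix bM i k j).coeff 0 • bA k := by
    rw [hbA, ← map_mul, ← sub_eq_zero]
    have h4 : ∑ k, (F.actionMatrix bM i k j).coeff 0 • bA k = Ideal.Quotient.mk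
        (Ideal.span (Set.range R))
        (∑ k, MvPolynomial.C ((F.actionMatrix bM i k j).coeff 0) * c k) := by
      rw [map_sum]
      refine Finset.sum_congr rfl fun k _ => ?_
      rw [hbA, ← MvPolynomial.smul_eq_C_mul]
      rfl
    rw [h4, ← map_sub, sub_eq_add_neg]
    exact Ideal.Quotient.eq_zero_iff_mem.2 hd
  rw [h3, map_sum, Finsupp.finsetSum_apply, Finset.sum_eq_single k]
  · simp
  · intro m _ hm
    simp [hm]
  · simp

end FunctionAlgebra

/-! ### Logarithmic coordinates -/

/-- D l i plays the part of q_l ∂A_i/∂q_l. The term T collects the derivatives of the factors 1/q_i,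
is symmetric in the two directions, and so drops out. -/
theorem curvature_sum_eq_zero {ι S : Type*} [Fintype ι] [Ring S] [Algebra ℂ S] (h : S)
    (D : ι → ι → S) (A : ι → S)
    (hf : ∀ l i, h * D l i + A l * A i = h * D i l + A i * A l) (p q : ι → ℂ) (T : S) :
    h * ((∑ i, ∑ l, (q i * p l) • D l i - T) - (∑ i, ∑ l, (p i * q l) • D l i - T)) +
      ((∑ l, p l • A l) * (∑ i, q i • A i) - (∑ l, q l • A l) * ∑ i, p i • A i) = 0 := by
  have hA : ∀ p q : ι → ℂ, (∑ l, p l • A l) * (∑ i, q i • A i) =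
      ∑ l, ∑ i, (p l * q i) • (A l * A i) := fun p q => by
    rw [Finset.sum_mul_sum]
    refine Finset.sum_congr rfl fun l _ => Finset.sum_congr rfl fun i _ => ?_
    rw [smul_mul_smul_comm]
  have h1 : ∑ i, ∑ l, (q i * p l) • D l i = ∑ l, ∑ i, (p l * q i) • D l i := by
    rw [Finset.sum_comm]
    refine Finset.sum_congr rfl fun l _ => Finset.sum_congr rfl fun i _ => ?_
    rw [mul_comm]
  have h2 : ∑ l, ∑ i, (q l * p i) • (A l * A i) = ∑ l, ∑ i, (p l * q i) • (A i * A l) := by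
    rw [Finset.sum_comm]
    refine Finset.sum_congr rfl fun l _ => Finset.sum_congr rfl fun i _ => ?_
    rw [mul_comm]
  rw [hA, hA, h1, h2, sub_sub_sub_cancel_right, mul_sub, Finset.mul_sum, Finset.mul_sum,
    ← Finset.sum_sub_distrib, ← Finset.sum_sub_distrib, ← Finset.sum_add_distrib]
  refine Finset.sum_eq_zero fun l _ => ?_
  rw [Finset.mul_sum, Finset.mul_sum, ← Finset.sum_sub_distrib, ← Finset.sum_sub_distrib,
    ← Finset.sum_add_distrib]
  refine Finset.sum_eq_zero fun i _ => ?_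
  rw [mul_smul_comm, mul_smul_comm, ← smul_sub, ← smul_sub, ← smul_add]
  rw [show h * D l i - h * D i l + (A l * A i - A i * A l) =
    (h * D l i + A l * A i) - (h * D i l + A i * A l) by abel, hf, sub_self, smul_zero]

namespace CoeffSeq

variable {B : Type*} [NormedRing B] [NormedAlgebra ℂ B]

theorem connSeries_eq_mk {E : Type*} [NormedAddCommGroup E] [NormedSpace ℂ E] {N : ℕ}
    {z : Fin (N + 1) → E →L[ℂ] B} {v : E} {f : ℕ → B} (hf : ∀ m, N < m → f m = 0)
    (h : ∀ k : Fin (N + 1), z k v = f k) : connSeries z v = PowerSeries.mk f := by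
  ext m
  rw [PowerSeries.coeff_mk, ← one_mul (connSeries z v), coeff_mul_connSeries]
  by_cases hm : m < N + 1
  · rw [Finset.sum_eq_single ⟨m, hm⟩]
    · simp [h]
    · intro k _ hk
      split_ifs with hkm
      · have : m - (k : ℕ) ≠ 0 := fun h0 => hk (Fin.ext (by simp; omega))
        rw [PowerSeries.coeff_one, if_neg this, zero_mul]
      · rfl
    · simp
  · rw [hf m (by omega)]
    refine Finset.sum_eq_zero fun k _ => ?_
    have : m - (k : ℕ) ≠ 0 := by omega
    rw [PowerSeries.coeff_one, if_neg this, zero_mul, ite_self]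

/-- A flat connection `d + h⁻¹ ∑ h^k α_{i,k} dq_i / q_i` is gauge equivalent near a point with
nonzero coordinates, by a gauge transformation which is entire in `h`, to one with only a pole term. -/
theorem exists_gauge_dlog [CompleteSpace B] {r N : ℕ} {α : Fin r → ℕ → (Fin r → ℂ) → B}
    {q₀ : Fin r → ℂ} (hq₀ : ∀ i, q₀ i ≠ 0) (hα : ∀ i m, AnalyticAt ℂ (α i m) q₀)
    (hN : ∀ i m, N < m → α i m = 0)
    (hflat : ∀ᶠ x in 𝓝 q₀, ∀ l i,
      PowerSeries.X * PowerSeries.mk (fun m => x l • fderiv ℂ (α i m) x (Pi.single l 1)) +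
        PowerSeries.mk (fun m => α l m x) * PowerSeries.mk (fun m => α i m x) =
      PowerSeries.X * PowerSeries.mk (fun m => x i • fderiv ℂ (α l m) x (Pi.single i 1)) +
        PowerSeries.mk (fun m => α i m x) * PowerSeries.mk (fun m => α l m x)) :
    ∃ U : Set (Fin r → ℂ), IsOpen U ∧ q₀ ∈ U ∧ (∀ x ∈ U, ∀ i, x i ≠ 0) ∧
      ∃ G : (Fin r → ℂ) × ℂ → B,
      DifferentiableOn ℂ G (U ×ˢ Set.univ) ∧
      (∀ x ∈ U, ∀ h, ∃ S, G (x, h) * S = 1) ∧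
      ∀ x ∈ U, ∀ h : ℂ, h ≠ 0 → ∀ i, x i • fderiv ℂ (fun y => G (y, h)) x (Pi.single i 1) =
        h⁻¹ • (G (x, h) * ∑ k : Fin (N + 1), h ^ (k : ℕ) • α i k x -
          G (x, 0) * α i 0 x * Ring.inverse (G (x, 0)) * G (x, h)) := by
  -- The forms Σ α_i dq_i/q_i, recentred at q₀; evaluation on q_i times the i-th basis vector
  -- recovers α_i.
  let a : (Fin r → ℂ) → Fin (N + 1) → (Fin r → ℂ) →L[ℂ] B := fun x k => ∑ i, ((q₀ + x) i)⁻¹ •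
    ContinuousLinearMap.smulRightL ℂ (Fin r → ℂ) B (ContinuousLinearMap.proj i) (α i k (q₀ + x))
  have ha_apply : ∀ x k v, a x k v = ∑ i, (v i * ((q₀ + x) i)⁻¹) • α i k (q₀ + x) := by
    intro x k v
    simp [a, smul_smul, mul_comm]
  have hsh : ∀ i m, AnalyticAt ℂ (fun x => α i m (q₀ + x)) 0 := fun i m =>
    AnalyticAt.comp (g := α i m) (f := fun x => q₀ + x) (by simpa using hα i m)
      (analyticAt_const.add analyticAt_id)
  have hinv : ∀ i, AnalyticAt ℂ (fun x : Fin r → ℂ => ((q₀ + x) i)⁻¹) 0 := fun i =>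
    AnalyticAt.inv (f := fun x : Fin r → ℂ => (q₀ + x) i)
      (((ContinuousLinearMap.proj i : (Fin r → ℂ) →L[ℂ] ℂ).analyticAt _).comp
        (analyticAt_const.add analyticAt_id)) (by simpa using hq₀ i)
  have ha : AnalyticAt ℂ a 0 := by
    refine AnalyticAt.pi fun k => ?_
    refine Finset.analyticAt_fun_sum _ fun i _ => ?_
    exact (hinv i).smul (AnalyticAt.const_clm_apply
      (ContinuousLinearMap.smulRightL ℂ (Fin r → ℂ) B (ContinuousLinearMap.proj i)) (hsh i k))
  have htend : Filter.Tendsto (fun x => q₀ + x) (𝓝 0) (𝓝 q₀) := by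
    have : ContinuousAt (fun x => q₀ + x) 0 := by fun_prop
    simpa [ContinuousAt] using this
  have hne : ∀ᶠ x in 𝓝 q₀, ∀ i, x i ≠ 0 := Filter.eventually_all.2 fun i =>
    (continuous_apply i).continuousAt.eventually_ne (hq₀ i)
  have hflat' : ∀ᶠ x in 𝓝 (0 : Fin r → ℂ), ∀ u v, PowerSeries.X * (connSeries (fderiv ℂ a x u) v -
      connSeries (fderiv ℂ a x v) u) + (connSeries (a x) u * connSeries (a x) v -
        connSeries (a x) v * connSeries (a x) u) = 0 := by
    have han : ∀ᶠ x in 𝓝 q₀, ∀ i, ∀ k : Fin (N + 1), AnalyticAt ℂ (α i k) x :=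
      Filter.eventually_all.2 fun i => Filter.eventually_all.2 fun k =>
        (hα i k).eventually_analyticAt
    filter_upwards [ha.eventually_analyticAt, htend.eventually (hne.and (hflat.and han))]
      with x hax ⟨hx0, hxf, hxa⟩ u v
    let A : Fin r → PowerSeries B := fun i => PowerSeries.mk fun m => α i m (q₀ + x)
    let D : Fin r → Fin r → PowerSeries B := fun l i =>
      PowerSeries.mk fun m => (q₀ + x) l • fderiv ℂ (α i m) (q₀ + x) (Pi.single l 1)
    let c : Fin r → ℂ := fun i => ((q₀ + x) i)⁻¹
    have hA : ∀ v, connSeries (a x) v = ∑ i, (v i * c i) • A i := by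
      intro v
      rw [connSeries_eq_mk (f := fun m => ∑ i, (v i * c i) • α i m (q₀ + x))]
      · ext m
        simp [A]
      · intro m hm
        simp [hN _ m hm]
      · exact fun k => ha_apply x k v
    have hderiv : ∀ u v (k : Fin (N + 1)), fderiv ℂ a x u k v =
        ∑ i, ∑ l, (v i * c i * (u l * c l)) •
          ((q₀ + x) l • fderiv ℂ (α i k) (q₀ + x) (Pi.single l 1)) -
          ∑ i, (v i * c i * (u i * c i)) • α i k (q₀ + x) := by
      intro u v k
      have h1 : HasFDerivAt (fun y => a y k v) (((ContinuousLinearMap.apply ℂ B v).comp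
          (ContinuousLinearMap.proj k : (Fin (N + 1) → (Fin r → ℂ) →L[ℂ] B) →L[ℂ] _)).comp
            (fderiv ℂ a x)) x :=
        ((ContinuousLinearMap.apply ℂ B v).comp (ContinuousLinearMap.proj k :
          (Fin (N + 1) → (Fin r → ℂ) →L[ℂ] B) →L[ℂ] _)).hasFDerivAt.comp x
          hax.differentiableAt.hasFDerivAt
      have h2 : ∀ i, HasFDerivAt (fun y => (v i * ((q₀ + y) i)⁻¹) • α i k (q₀ + y)) _ x := fun i =>
        HasFDerivAt.smul (HasFDerivAt.const_mul ((hasDerivAt_inv (hx0 i)).comp_hasFDerivAt x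
            (HasFDerivAt.comp x (g := fun y : Fin r → ℂ => y i) (f := fun y => q₀ + y)
              (hasFDerivAt_apply i _) ((hasFDerivAt_id x).const_add q₀))) (v i))
          (HasFDerivAt.comp x (g := α i k) (f := fun y => q₀ + y)
            (hxa i k).differentiableAt.hasFDerivAt ((hasFDerivAt_id x).const_add q₀))
      have h3 := HasFDerivAt.fun_sum (u := Finset.univ) fun i _ => h2 i
      have h4 := h1.unique (h3.congr_of_eventuallyEq
        (Filter.Eventually.of_forall fun y => ha_apply y k v))
      have h5 := DFunLike.congr_fun h4 u
      refine h5.trans ?_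
      rw [← Finset.sum_sub_distrib, sum_apply]
      refine Finset.sum_congr rfl fun i _ => ?_
      have hu : fderiv ℂ (α i k) (q₀ + x) u =
          ∑ l, (u l * c l) • ((q₀ + x) l • fderiv ℂ (α i k) (q₀ + x) (Pi.single l 1)) := by
        have hu' : u = ∑ l, u l • (Pi.single l 1 : Fin r → ℂ) := by
          ext j
          simp [Finset.sum_apply, Pi.single_apply]
        conv_lhs => rw [hu']
        rw [map_sum]
        refine Finset.sum_congr rfl fun l _ => ?_
        rw [map_smul, smul_smul, mul_assoc, inv_mul_cancel₀ (hx0 l), mul_one]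
      have h6 : (v i * c i) • fderiv ℂ (α i k) (q₀ + x) u +
          (v i * (-((q₀ + x) i ^ 2)⁻¹ * u i)) • α i k (q₀ + x) =
          ∑ l, (v i * c i * (u l * c l)) •
            ((q₀ + x) l • fderiv ℂ (α i k) (q₀ + x) (Pi.single l 1)) -
          (v i * c i * (u i * c i)) • α i k (q₀ + x) := by
        rw [hu, Finset.smul_sum, sub_eq_add_neg, ← neg_smul]
        congr 1
        · exact Finset.sum_congr rfl fun l _ => by rw [smul_smul]
        · congr 1
          simp only [c]
          rw [sq, mul_inv]
          ring
      exact h6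
    have hD : ∀ u v, connSeries (fderiv ℂ a x u) v =
        ∑ i, ∑ l, (v i * c i * (u l * c l)) • D l i - ∑ i, (v i * c i * (u i * c i)) • A i := by
      intro u v
      rw [connSeries_eq_mk (f := fun m => ∑ i, ∑ l, (v i * c i * (u l * c l)) •
          ((q₀ + x) l • fderiv ℂ (α i m) (q₀ + x) (Pi.single l 1)) -
          ∑ i, (v i * c i * (u i * c i)) • α i m (q₀ + x)) ?_ (hderiv u v)]
      · ext m
        simp [A, D]
      · intro m hm
        simp [hN _ m hm]
    rw [hD, hD, hA, hA]
    -- The contribution of the derivative of 1/q_i is symmetric in u and v.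
    have hT : ∑ i, (u i * c i * (v i * c i)) • A i = ∑ i, (v i * c i * (u i * c i)) • A i :=
      Finset.sum_congr rfl fun i _ => by rw [mul_comm]
    rw [hT]
    exact curvature_sum_eq_zero PowerSeries.X D A (fun l i => hxf l i) (fun i => u i * c i)
      (fun i => v i * c i) _
  obtain ⟨ρ, hρ, G, hG, hGS, hGU, hGe⟩ := exists_gauge ha hflat'
  obtain ⟨W, hW, hWo, hqW⟩ := eventually_nhds_iff.1 hne
  have hcont : Continuous fun x : Fin r → ℂ => x - q₀ := by fun_prop
  refine ⟨W ∩ (fun x => x - q₀) ⁻¹' Metric.eball 0 ρ,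
    hWo.inter (Metric.isOpen_eball.preimage hcont),
    ⟨hqW, by simpa using hρ⟩, fun x hx => hW x hx.1, fun y => G (y.1 - q₀, y.2), ?_,
    fun x hx h => hGS _ hx.2 h, ?_⟩
  · refine hG.comp (f := fun y : (Fin r → ℂ) × ℂ => (y.1 - q₀, y.2)) ?_ ?_
    · fun_prop
    · rintro ⟨y, h⟩ ⟨hy, -⟩
      exact ⟨hy.2, trivial⟩
  · intro x hx h hh i
    have h1 := hGe _ hx.2 h hh (x i • Pi.single i 1)
    have h2 : fderiv ℂ (fun y => G (y - q₀, h)) x = fderiv ℂ (fun y => G (y, h)) (x - q₀) :=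
      fderiv_comp_sub (f := fun y => G (y, h)) q₀
    change x i • fderiv ℂ (fun y => G (y - q₀, h)) x (Pi.single i 1) = _
    rw [h2, ← map_smul, h1]
    have h3 : ∀ k, a (x - q₀) k (x i • Pi.single i 1) = α i k x := by
      intro k
      rw [ha_apply, Finset.sum_eq_single i (fun j _ hj => by simp [hj]) (by simp)]
      simp [hW x hx.1 i]
    simp only [conjForm_apply, h3]
    rfl

end CoeffSeq

/-! ### Matrices: the abstract gauge made entrywise -/

section MatrixNorm

attribute [local instance] Matrix.linftyOpNormedRing Matrix.linftyOpNormedAlgebra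

theorem Matrix.analyticAt_of_entries {E : Type*} [NormedAddCommGroup E] [NormedSpace ℂ E] {n : ℕ}
    {f : E → Matrix (Fin n) (Fin n) ℂ} {x : E} (h : ∀ k j, AnalyticAt ℂ (fun y => f y k j) x) :
    AnalyticAt ℂ f x := by
  have hf : f = fun y => ∑ k, ∑ j, f y k j • Matrix.single k j (1 : ℂ) := by
    funext y
    conv_lhs => rw [Matrix.matrix_eq_sum_single (f y)]
    simp [Matrix.smul_single]
  rw [hf]
  exact Finset.analyticAt_fun_sum _ fun k _ => Finset.analyticAt_fun_sum _ fun j _ =>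
    (h k j).smul analyticAt_const

theorem Matrix.hasFDerivAt_entry {E : Type*} [NormedAddCommGroup E] [NormedSpace ℂ E] {n : ℕ}
    {f : E → Matrix (Fin n) (Fin n) ℂ} {f' : E →L[ℂ] Matrix (Fin n) (Fin n) ℂ} {x : E}
    (hf : HasFDerivAt f f' x) (k j : Fin n) : HasFDerivAt (fun y => f y k j)
      ((LinearMap.toContinuousLinearMap (Matrix.entryLinearMap ℂ ℂ k j)).comp f') x :=
  (LinearMap.toContinuousLinearMap (Matrix.entryLinearMap ℂ ℂ k j)).hasFDerivAt.comp x hf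

theorem matDlog_eq {r n : ℕ} {G : (Fin r → ℂ) → Matrix (Fin n) (Fin n) ℂ} {x : Fin r → ℂ}
    (hG : DifferentiableAt ℂ G x) (i : Fin r) :
    matDlog i G x = x i • fderiv ℂ G x (Pi.single i 1) := by
  ext k j
  rw [matDlog, Matrix.of_apply, (Matrix.hasFDerivAt_entry hG.hasFDerivAt k j).fderiv]
  rfl

/-- A flat connection `d + h⁻¹ ∑ h^k α_{i,k} dq_i / q_i` on a trivial vector bundle is gauge
equivalent near a point with nonzero coordinates to its pole term. -/
theorem exists_matrix_gauge {r n N : ℕ}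
    {α : Fin r → ℕ → (Fin r → ℂ) → Matrix (Fin n) (Fin n) ℂ} {V : Set (Fin r → ℂ)} (hV : IsOpen V)
    {q₀ : Fin r → ℂ} (hq₀V : q₀ ∈ V) (hq₀ : ∀ i, q₀ i ≠ 0)
    (hα : ∀ x ∈ V, ∀ i m k j, AnalyticAt ℂ (fun y => α i m y k j) x)
    (hN : ∀ i m, N < m → α i m = 0)
    (hflat : ∀ x ∈ V, ∀ l i,
      PowerSeries.X * PowerSeries.mk (fun m => matDlog l (α i m) x) +
        PowerSeries.mk (fun m => α l m x) * PowerSeries.mk (fun m => α i m x) =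
      PowerSeries.X * PowerSeries.mk (fun m => matDlog i (α l m) x) +
        PowerSeries.mk (fun m => α i m x) * PowerSeries.mk (fun m => α l m x)) :
    ∃ U₀ : Set (Fin r → ℂ), IsOpen U₀ ∧ q₀ ∈ U₀ ∧ U₀ ⊆ V ∧
      ∃ G : (Fin r → ℂ) × ℂ → GL (Fin n) ℂ, GLHolomorphicOn G (U₀ ×ˢ Set.univ) ∧
        ∀ x ∈ U₀, ∀ h : ℂ, h ≠ 0 → ∀ i,
          matDlog i (fun y => (G (y, h) : Matrix (Fin n) (Fin n) ℂ)) x =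
            h⁻¹ • ((G (x, h) : Matrix (Fin n) (Fin n) ℂ) *
              ∑ k : Fin (N + 1), h ^ (k : ℕ) • α i k x -
              (G (x, 0) : Matrix (Fin n) (Fin n) ℂ) * α i 0 x *
                ((G (x, 0))⁻¹ : GL (Fin n) ℂ) * (G (x, h) : Matrix (Fin n) (Fin n) ℂ)) := by
  have hα' : ∀ x ∈ V, ∀ i m, AnalyticAt ℂ (α i m) x := fun x hx i m =>
    Matrix.analyticAt_of_entries fun k j => hα x hx i m k j
  obtain ⟨U, hU, hqU, -, G, hG, hGS, hGe⟩ := CoeffSeq.exists_gauge_dlog hq₀ (hα' q₀ hq₀V) hN (by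
    filter_upwards [hV.mem_nhds hq₀V] with x hx l i
    have h := hflat x hx l i
    simp only [matDlog_eq (hα' x hx _ _).differentiableAt] at h
    exact h)
  -- A right inverse of a square matrix is two-sided.
  have hunit : ∀ x ∈ U, ∀ h, IsUnit (G (x, h)) := fun x hx h => by
    obtain ⟨S, hS⟩ := hGS x hx h
    exact ⟨⟨G (x, h), S, hS, mul_eq_one_comm.1 hS⟩, rfl⟩
  classical
  -- The default value 1 is never used over U.
  let g : (Fin r → ℂ) × ℂ → GL (Fin n) ℂ := fun y => if hy : IsUnit (G y) then hy.unit else 1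
  have hg : ∀ x ∈ U, ∀ h, (g (x, h) : Matrix (Fin n) (Fin n) ℂ) = G (x, h) := fun x hx h => by
    simp [g, hunit x hx h]
  have hprod : IsOpen (U ×ˢ (Set.univ : Set ℂ)) := hU.prod isOpen_univ
  refine ⟨U ∩ V, hU.inter hV, ⟨hqU, hq₀V⟩, Set.inter_subset_right, g, ?_, ?_⟩
  · intro k j
    refine DifferentiableOn.congr (f := fun y => G y k j) ?_ ?_
    · rintro y ⟨hy, -⟩
      exact (Matrix.hasFDerivAt_entry ((hG.differentiableAt (hprod.mem_nhds
        ⟨hy.1, trivial⟩)).hasFDerivAt) k j).differentiableAt.differentiableWithinAt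
    · rintro ⟨x, h⟩ ⟨hy, -⟩
      rw [hg x hy.1 h]
  · rintro x ⟨hx, -⟩ h hh i
    have hd : DifferentiableAt ℂ (fun y => G (y, h)) x :=
      DifferentiableAt.comp x (g := G) (f := fun y => (y, h))
        (hG.differentiableAt (hprod.mem_nhds ⟨hx, trivial⟩)) (by fun_prop)
    have heq : (fun y => (g (y, h) : Matrix (Fin n) (Fin n) ℂ)) =ᶠ[𝓝 x] fun y => G (y, h) := by
      filter_upwards [hU.mem_nhds hx] with y hy using hg y hy h
    rw [matDlog_eq (hd.congr_of_eventuallyEq heq), heq.fderiv_eq]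
    refine (hGe x hx h hh i).trans ?_
    rw [← hg x hx h, ← hg x hx 0, Ring.inverse_unit]

end MatrixNorm

/-! ### From the D-module to the gauge theorem -/

namespace FunctionAlgebra

variable {r s u : ℕ} {K : Type*} [CommRing K] [Algebra ℂ K] (F : FunctionAlgebra r K)

/-- The value at `x` of the coefficient of `h^m` in the matrix `hΩ^h_i`. -/
noncomputable def connCoeff {D : Fin u → F.Dh}
    (bM : Module.Basis (Fin (s + 1)) K[X] (F.Mh D)) (i : Fin r) (m : ℕ) (x : Fin r → ℂ) :
    Matrix (Fin (s + 1)) (Fin (s + 1)) ℂ :=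
  Matrix.of fun k j => F.value ((F.actionMatrix bM i k j).coeff m) x

/-- Evaluation at a point carries flatness over K[h] to the power series form used by the gauge
theorem; the factor X records that `hdOp` raises the degree in h by one. -/
theorem coeff_connCoeff_eq_value {D : Fin u → F.Dh}
    {bM : Module.Basis (Fin (s + 1)) K[X] (F.Mh D)} {V : Set (Fin r → ℂ)}
    (hol : F.ConnHolomorphicOn bM V) {x : Fin r → ℂ} (hx : x ∈ V) (l i : Fin r) (m : ℕ)
    (k j : Fin (s + 1)) :
    (PowerSeries.coeff m
      (PowerSeries.X * PowerSeries.mk (fun m => matDlog l (F.connCoeff bM i m) x) +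
      PowerSeries.mk (fun m => F.connCoeff bM l m x) *
        PowerSeries.mk (fun m => F.connCoeff bM i m x)) :
          Matrix (Fin (s + 1)) (Fin (s + 1)) ℂ) k j =
    F.value (((F.actionMatrix bM l * F.actionMatrix bM i +
      (F.actionMatrix bM i).map (F.hdOp l)) k j).coeff m) x := by
  have hreg := hol x hx
  have h1 : F.value (((F.actionMatrix bM l * F.actionMatrix bM i) k j).coeff m) x =
      (PowerSeries.coeff m (PowerSeries.mk (fun m => F.connCoeff bM l m x) *
        PowerSeries.mk (fun m => F.connCoeff bM i m x)) :
          Matrix (Fin (s + 1)) (Fin (s + 1)) ℂ) k j ∧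
      ((F.actionMatrix bM l * F.actionMatrix bM i) k j).coeff m ∈ F.regularAt x := by
    rw [Matrix.mul_apply, Polynomial.finsetSum_coeff, PowerSeries.coeff_mul, Matrix.sum_apply]
    simp only [Polynomial.coeff_mul, PowerSeries.coeff_mk, Matrix.mul_apply]
    refine ⟨?_, sum_mem fun _ _ => sum_mem fun _ _ => mul_mem (hreg _ _ _ _) (hreg _ _ _ _)⟩
    rw [F.value_sum _ fun _ _ => sum_mem fun _ _ => mul_mem (hreg _ _ _ _) (hreg _ _ _ _),
      Finset.sum_comm]
    refine Finset.sum_congr rfl fun e _ => ?_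
    rw [F.value_sum _ fun _ _ => mul_mem (hreg _ _ _ _) (hreg _ _ _ _)]
    exact Finset.sum_congr rfl fun p _ => F.value_mul (hreg _ _ _ _) (hreg _ _ _ _)
  have h2 : F.value ((F.hdOp l (F.actionMatrix bM i k j)).coeff m) x =
      (PowerSeries.coeff m (PowerSeries.X *
        PowerSeries.mk (fun m => matDlog l (F.connCoeff bM i m) x)) :
          Matrix (Fin (s + 1)) (Fin (s + 1)) ℂ) k j ∧
      (F.hdOp l (F.actionMatrix bM i k j)).coeff m ∈ F.regularAt x := by
    cases m with
    | zero =>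
      rw [coeff_hdOp_zero, F.value_zero, PowerSeries.coeff_zero_X_mul]
      exact ⟨rfl, zero_mem _⟩
    | succ m =>
      rw [coeff_hdOp_succ, PowerSeries.coeff_succ_X_mul, PowerSeries.coeff_mk,
        F.value_dlog l (hreg _ _ _ _)]
      exact ⟨rfl, F.dlog_mem l (hreg _ _ _ _)⟩
  rw [Matrix.add_apply, Polynomial.coeff_add, Matrix.map_apply, F.value_add h1.2 h2.2, h1.1, h2.1,
    map_add, Matrix.add_apply, add_comm]

theorem connForm_eq_sum {D : Fin u → F.Dh} (bM : Module.Basis (Fin (s + 1)) K[X] (F.Mh D)) {N : ℕ}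
    (hN : ∀ i k j, (F.actionMatrix bM i k j).natDegree ≤ N) (h : ℂ) (i : Fin r) (x : Fin r → ℂ) :
    F.connForm bM h i x = h⁻¹ • ∑ k : Fin (N + 1), h ^ (k : ℕ) • F.connCoeff bM i k x := by
  ext k j
  rw [connForm, Matrix.of_apply,
    Polynomial.sum_over_range' _ (fun n => by rw [F.value_zero, zero_mul])
    (N + 1) (Nat.lt_succ_of_le (hN i k j)), Matrix.smul_apply, Matrix.sum_apply, smul_eq_mul,
    Finset.sum_range]
  congr 1
  exact Finset.sum_congr rfl fun n _ => mul_comm _ _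

end FunctionAlgebra

theorem proposition3p2 {K : Type*} [CommRing K] [Algebra ℂ K] {r s u : ℕ}
    (F : FunctionAlgebra r K)
    -- the algebra `A = K[b_1, …, b_r] / (R_1, …, R_u)` and a quantization `M^h` of it
    (R : Fin u → MvPolynomial (Fin r) K) (D : Fin u → F.Dh) (hD : IsQuantization F s R D)
    -- a `K[h]`-basis `[P_0], …, [P_s]` of `M^h`, giving a `K`-basis `[c_0], …, [c_s]` of `A`
    (P : Fin (s + 1) → F.Dh) (bM : Module.Basis (Fin (s + 1)) K[X] (F.Mh D))
    (hbM : ∀ j, bM j = F.cls D (P j))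
    (c : Fin (s + 1) → MvPolynomial (Fin r) K) (hc : ∀ j, F.HasLimit (P j) (c j))
    (bA : Module.Basis (Fin (s + 1)) K (RelAlgebra R))
    (hbA : ∀ j, bA j = Ideal.Quotient.mk (Ideal.span (Set.range R)) (c j))
    (V : Set (Fin r → ℂ)) (hV : IsOpen V) (hol : F.ConnHolomorphicOn bM V)
    (q₀ : Fin r → ℂ) (hq₀V : q₀ ∈ V)
    -- `q_i = exp t_i`
    (hq₀ : ∀ i, q₀ i ≠ 0) :
    ∃ U₀ : Set (Fin r → ℂ), IsOpen U₀ ∧ q₀ ∈ U₀ ∧ U₀ ⊆ V ∧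
      ∃ Q₀ : (Fin r → ℂ) → GL (Fin (s + 1)) ℂ, GLHolomorphicOn Q₀ U₀ ∧
        ∃ G : (Fin r → ℂ) × ℂ → GL (Fin (s + 1)) ℂ,
          GLHolomorphicOn G (U₀ ×ˢ Set.univ) ∧
          (∀ x ∈ U₀, G (x, 0) = Q₀ x) ∧
          GaugeTransforms U₀ G (F.connForm bM) (fun h i x =>
            h⁻¹ • ((Q₀ x : Matrix (Fin (s + 1)) (Fin (s + 1)) ℂ) * F.mulForm bA i x *
              ((Q₀ x)⁻¹ : GL (Fin (s + 1)) ℂ))) := by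

  obtain ⟨N, hN⟩ : ∃ N, ∀ i k j, (F.actionMatrix bM i k j).natDegree ≤ N := by
    obtain ⟨N, hN⟩ := (Set.finite_range fun t : Fin r × Fin (s + 1) × Fin (s + 1) =>
      (F.actionMatrix bM t.1 t.2.1 t.2.2).natDegree).bddAbove
    exact ⟨N, fun i k j => hN ⟨(i, k, j), rfl⟩⟩
  obtain ⟨U₀, hU₀, hqU₀, hU₀V, G, hG, hGe⟩ := exists_matrix_gauge (N := N) (α := F.connCoeff bM)
    hV hq₀V hq₀ (fun x hx i m k j => F.analyticAt_value (hol x hx i k j m))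
    (fun i m hm => by
      funext x
      ext k j
      change F.value ((F.actionMatrix bM i k j).coeff m) x = 0
      rw [Polynomial.coeff_eq_zero_of_natDegree_lt ((hN i k j).trans_lt hm), F.value_zero])
    (fun x hx l i => by
      ext m k j
      rw [F.coeff_connCoeff_eq_value hol hx, F.coeff_connCoeff_eq_value hol hx,
        F.actionMatrix_mul_add])
  refine ⟨U₀, hU₀, hqU₀, hU₀V, fun x => G (x, 0), ?_, G, hG, fun x _ => rfl, ?_⟩
  · exact fun k j => (hG k j).comp (f := fun x => (x, (0 : ℂ))) (by fun_prop)
      fun x hx => ⟨hx, trivial⟩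
  · intro h hh x hx i
    -- The pole of the connection is identified with ω, so conjugating it by Q₀ gives the required
    -- form.
    have hω : F.mulForm bA i x = F.connCoeff bM i 0 x := by
      ext k j
      change F.value _ x = F.value _ x
      rw [F.coeff_zero_actionMatrix hD.limit bM hbM hc bA hbA]
    beta_reduce
    -- In G Ω G⁻¹ − (dG) G⁻¹ the equation for dG cancels G Ω G⁻¹ and leaves the conjugated pole
    -- term.
    rw [hGe x hx h hh i, F.connForm_eq_sum bM hN, hω, mul_smul_comm, smul_mul_assoc, smul_mul_assoc,
      ← smul_sub, sub_mul, sub_sub_cancel, Units.mul_inv_cancel_right]
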